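/- **Setting.** Let $\beta>0$, $\mathcal J=[a,b]$ with $a<b$, and $\widetilde{\mathcal J}=[a',b']$ with $a'<a$, $b<b'$. For $t\in[0,1]$ let $\eta_t:\widetilde{\mathcal J}\to\mathbb C$ be curves depending smoothly on $(t,x)\in[0,1]\times\widetilde{\mathcal J}$, all of whose $x$-derivatives are bounded uniformly in $t$, and such that for some $c>0$, $c<\left|\frac{\eta_t(x)-\eta_t(y)}{x-y}\right|<c^{-1}$ for all $t\in[0,1]$ and all $x\neq y$ in $\widetilde{\mathcal J}$. Let $W_t$ be analytic in a neighbourhood of $\eta_t(\mathcal J)$, jointly analytic in $(t,z)$, with each derivative $W_t^{(p)}$ bounded on $\eta_t(\mathcal J)$ uniformly in $t$, and put $\widetilde\varphi_t=\operatorname{Re}(W_t\circ\eta_t)$. Let $\mathbb P_{N,\eta_t}$ be the probability measure on $\mathcal J^N$ with density proportional to $$\prod_{i<j}|\eta_t(x_i)-\eta_t(x_j)|^\beta\ \prod_{k=1}^N|\eta_t'(x_k)|\,e^{-N\beta\widetilde\varphi_t(x_k)} .$$ Let $\widetilde\mu_t$ be the minimiser, among Borel probability measures $\nu$ on $\mathcal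 J$, of $$\iint\Big(\ln\tfrac1{|\eta_t(x)-\eta_t(y)|}+\widetilde\varphi_t(x)+\widetilde\varphi_t(y)\Big)\,d\nu(x)\,d\nu(y),$$ and assume that there is an open set $O\subset\mathcal J$ with $\operatorname{supp}\widetilde\mu_t\subset O$ for all $t\in[0,1]$. For measures on $\widetilde{\mathcal J}$ write $$\mathfrak D_{\eta_t}(\mu,\nu)=\Big(\iint\ln\tfrac1{|\eta_t(x)-\eta_t(y)|}\,d(\mu-\nu)(x)\,d(\mu-\nu)(y)\Big)^{1/2}\in[0,+\infty].$$ For $\mathbf x\in\mathbb R^N$, with coordinates relabelled so that $x_1\le\dots\le x_N$, set $\widetilde x_1=x_1$, $\widetilde x_k=\widetilde x_{k-1}+\max(x_k-x_{k-1},N^{-3})$, and let $\overline L_N^{(\mathbf x)}$ be the average over $k$ of the uniform probability measures on $[\widetilde x_k-\frac1{2N^6},\widetilde x_k+\frac1{2N^6}]$. Finally $\|f\|=\operatorname{ess\,sup}_{\widetilde{\mathcal J}}|f|+\operatorname{ess\,sup}_{\widetilde{\mathcal J}}|f'|$ is the norm of the space $\mathcal W^\infty_1(\widetilde{\mathcal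 J})$ of bounded complex functions with bounded weak derivative. **Statement.** There are constants $C,C'>0$ and $N_0\ge2$, independent of $t\in[0,1]$, such that: 1. for all $t\in[0,1]$, all $\delta>0$, and all $N\ge2$ for which $\overline L_N^{(\mathbf x)}$ is carried by $\widetilde{\mathcal J}$ for every $\mathbf x\in\mathcal J^N$, $$\mathbb P_{N,\eta_t}\Big[\mathfrak D_{\eta_t}\big(\overline L_N^{(\mathbf x)},\widetilde\mu_t\big)\ge\delta\Big]\le e^{-\frac\beta2N^2\delta^2+CN\ln N};$$ 2. for all $N\ge N_0$ and all $\mathbf x\in\mathcal J^N$, the points $\widetilde x_1,\dots,\widetilde x_N$ lie in $\widetilde{\mathcal J}$ and $\overline L_N^{(\mathbf x)}$ is carried by $\widetilde{\mathcal J}$ (so that 1 applies to all $N\ge N_0$); 3. for all $N\ge N_0$, $t\in[0,1]$, $\delta>0$ and $f\in\mathcal W^\infty_1(\widetilde{\mathcal J})$ with $\|f\|\neq0$, $$\mathbb P_{N,\eta_t}\Big[\Big|\int_{\widetilde{\mathcal J}}f\,d\big(\overline L_N^{(\mathbf x)}-\widetilde\mu_t\big)\Big|\ge\delta\Big]\le\exp\Big\{-\frac{C'N^2\delta^2}{\|f\|^2}+CN\ln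 N\Big\};$$ 4. consequently, for every $A>0$ there is $K>0$, independent of $t$, $N$ and $f$, such that for all $N\ge N_0$, $t\in[0,1]$ and $f\in\mathcal W^\infty_1(\widetilde{\mathcal J})$ with $\|f\|\ne0$, $$\mathbb P_{N,\eta_t}\Big[\Big|\int_{\widetilde{\mathcal J}}f\,d\big(\overline L_N^{(\mathbf x)}-\widetilde\mu_t\big)\Big|\ge K\|f\|\sqrt{\tfrac{\ln N}N}\Big]\le e^{-AN\ln N}.$$ -/

import Mathlib

open Set MeasureTheory
open scoped ENNReal ContDiff

noncomputable section

namespace CurveGas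

/-! ### Curve families and potentials -/

/-- A smooth family `η t : [a', b'] → ℂ`, `t ∈ [0, 1]`, of simple curves, with derivatives and
bi-Lipschitz constants bounded uniformly in `t`. -/
structure IsCurveFamily (a' b' : ℝ) (η : ℝ → ℝ → ℂ) : Prop where
  smooth : ContDiffOn ℝ ∞ (fun p : ℝ × ℝ => η p.1 p.2) (Icc 0 1 ×ˢ Icc a' b')
  deriv_bound : ∀ p : ℕ, ∃ Cp : ℝ, ∀ t ∈ Icc (0 : ℝ) 1, ∀ x ∈ Icc a' b',
    ‖iteratedDerivWithin p (η t) (Icc a' b') x‖ ≤ Cp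
  bilipschitz : ∃ c : ℝ, 0 < c ∧ ∀ t ∈ Icc (0 : ℝ) 1, ∀ x ∈ Icc a' b', ∀ y ∈ Icc a' b', x ≠ y →
    c < ‖(η t x - η t y) / ((x - y : ℝ) : ℂ)‖ ∧ ‖(η t x - η t y) / ((x - y : ℝ) : ℂ)‖ < c⁻¹

/-- A family `W t` of potentials, analytic near the curve `η t ([a, b])`, jointly analytic in
`(t, z)`, with all derivatives bounded on the curves uniformly in `t ∈ [0, 1]`. -/
structure IsPotentialFamily (a b : ℝ) (η : ℝ → ℝ → ℂ) (W : ℝ → ℂ → ℂ) : Prop where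
  analytic : ∀ t ∈ Icc (0 : ℝ) 1, AnalyticOnNhd ℂ (W t) (η t '' Icc a b)
  joint_analytic : ∀ t ∈ Icc (0 : ℝ) 1, ∀ z ∈ η t '' Icc a b,
    AnalyticWithinAt ℝ (fun p : ℝ × ℂ => W p.1 p.2) (Icc 0 1 ×ˢ univ) (t, z)
  deriv_bound : ∀ p : ℕ, ∃ Cp : ℝ, ∀ t ∈ Icc (0 : ℝ) 1, ∀ z ∈ η t '' Icc a b,
    ‖iteratedDeriv p (W t) z‖ ≤ Cp

/-! ### The real model, for one curve `γ` on `[a, b]` and one external potential `W` -/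

/-- The external field `φ = Re (W ∘ γ)`. -/
def field (γ : ℝ → ℂ) (W : ℂ → ℂ) (x : ℝ) : ℝ := (W (γ x)).re

/-- The unnormalised density of the real model. -/
def weight (β : ℝ) (γ : ℝ → ℂ) (W : ℂ → ℂ) (N : ℕ) (x : Fin N → ℝ) : ℝ :=
  (∏ i : Fin N, ∏ j ∈ Finset.Ioi i, ‖γ (x i) - γ (x j)‖ ^ β) *
    ∏ k : Fin N, (‖deriv γ (x k)‖ * Real.exp (-(N * β * field γ W (x k))))

/-- The configuration space `[a, b]^N`. -/
def configs (a b : ℝ) (N : ℕ) : Set (Fin N → ℝ) := Set.pi univ fun _ => Icc a b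

/-- The partition function. -/
def partitionFunction (β a b : ℝ) (γ : ℝ → ℂ) (W : ℂ → ℂ) (N : ℕ) : ℝ≥0∞ :=
  ∫⁻ x in configs a b N, ENNReal.ofReal (weight β γ W N x)

/-- The real model: the law of the `N` particles on `[a, b]^N`. -/
def realModel (β a b : ℝ) (γ : ℝ → ℂ) (W : ℂ → ℂ) (N : ℕ) : Measure (Fin N → ℝ) :=
  (partitionFunction β a b γ W N)⁻¹ •
    (volume.restrict (configs a b N)).withDensity fun x => ENNReal.ofReal (weight β γ W N x)

/-! ### Logarithmic energy, equilibrium measure, logarithmic distance -/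

/-- The kernel `ln (1 / |γ x - γ y|)`, equal to `+∞` where `γ x = γ y`. -/
def logKernel (γ : ℝ → ℂ) (p : ℝ × ℝ) : EReal := -ENNReal.log ‖γ p.1 - γ p.2‖ₑ

/-- The integral of an extended real function: integral of the positive part minus integral of the
negative part. -/
def eintegral {α : Type*} [MeasurableSpace α] (μ : Measure α) (f : α → EReal) : EReal :=
  ((∫⁻ x, (f x).toENNReal ∂μ : ℝ≥0∞) : EReal) - ((∫⁻ x, (-f x).toENNReal ∂μ : ℝ≥0∞) : EReal)

/-- The energy `∬ (ln (1 / |γ x - γ y|) + φ x + φ y) dν(x) dν(y) ∈ (-∞, +∞]`. -/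
def energy (γ : ℝ → ℂ) (W : ℂ → ℂ) (ν : Measure ℝ) : EReal :=
  eintegral (ν.prod ν) fun p =>
    logKernel γ p + ((field γ W p.1 + field γ W p.2 : ℝ) : EReal)

/-- `ν` is a Borel probability measure on `[a, b]`. -/
structure IsProbOn (a b : ℝ) (ν : Measure ℝ) : Prop where
  prob : IsProbabilityMeasure ν
  carried : ν (Icc a b)ᶜ = 0

/-- `ν` minimises the energy among all Borel probability measures on `[a, b]`. -/
structure IsEquilibriumMeasure (a b : ℝ) (γ : ℝ → ℂ) (W : ℂ → ℂ) (ν : Measure ℝ) : Prop where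
  isProbOn : IsProbOn a b ν
  minimal : ∀ ρ : Measure ℝ, IsProbOn a b ρ → energy γ W ν ≤ energy γ W ρ

/-- For finite measures, the signed measure `μ - ν` has Jordan decomposition with positive part
`μ - ν` and negative part `ν - μ` (truncated subtraction of measures). Hence
`(μ - ν) ⊗ (μ - ν)` has the following positive part. -/
def diffSqPos (μ ν : Measure ℝ) : Measure (ℝ × ℝ) :=
  (μ - ν).prod (μ - ν) + (ν - μ).prod (ν - μ)

/-- The negative part of `(μ - ν) ⊗ (μ - ν)`. -/
def diffSqNeg (μ ν : Measure ℝ) : Measure (ℝ × ℝ) :=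
  (μ - ν).prod (ν - μ) + (ν - μ).prod (μ - ν)

open Classical in
/-- The logarithmic distance
`D(μ, ν) = (∬ ln (1 / |γ x - γ y|) d(μ - ν)(x) d(μ - ν)(y))^(1/2) ∈ [0, +∞]`,
which is `+∞` when the kernel is not absolutely integrable. -/
def logDist (γ : ℝ → ℂ) (μ ν : Measure ℝ) : ℝ≥0∞ :=
  if ∫⁻ p, (logKernel γ p).abs ∂(diffSqPos μ ν + diffSqNeg μ ν) = ⊤ then ⊤
  else ENNReal.ofReal (Real.sqrt
    ((∫ p, (logKernel γ p).toReal ∂(diffSqPos μ ν)) -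
      ∫ p, (logKernel γ p).toReal ∂(diffSqNeg μ ν)))

/-! ### The regularised empirical measure -/

/-- The points `x_1, …, x_N` rearranged in nondecreasing order, extended by `0` to a sequence
indexed by `ℕ` (only the first `N` terms matter). -/
def sortedSeq {N : ℕ} (x : Fin N → ℝ) (k : ℕ) : ℝ :=
  if h : k < N then x (Tuple.sort x ⟨k, h⟩) else 0

/-- The points pushed apart to mutual distance at least `N⁻³`. -/
def spreadSeq {N : ℕ} (x : Fin N → ℝ) : ℕ → ℝ
  | 0 => sortedSeq x 0
  | k + 1 => spreadSeq x k + max (sortedSeq x (k + 1) - sortedSeq x k) (((N : ℝ) ^ 3)⁻¹)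

/-- The regularised empirical measure: the average of the uniform laws on the intervals of length
`N⁻⁶` centred at the spread points. -/
def regEmpirical {N : ℕ} (x : Fin N → ℝ) : Measure ℝ :=
  (N : ℝ≥0∞)⁻¹ • ∑ k : Fin N, ((N : ℝ≥0∞) ^ 6) •
    volume.restrict (Icc (spreadSeq x k - (2 * (N : ℝ) ^ 6)⁻¹) (spreadSeq x k + (2 * (N : ℝ) ^ 6)⁻¹))

/-- Every configuration in `[a, b]^N` has its regularised empirical measure carried by
`[a', b']`. -/
def RegFits (a b a' b' : ℝ) (N : ℕ) : Prop :=
  ∀ x ∈ configs a b N, regEmpirical x (Icc a' b')ᶜ = 0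

/-! ### The space `W^∞_1` of an interval -/

/-- `f ∈ W^∞_1([a, b])` with weak derivative `g`: both are essentially bounded on `[a, b]`. -/
structure IsW1Inf (a b : ℝ) (f g : ℝ → ℂ) : Prop where
  memLp : MemLp f ⊤ (volume.restrict (Icc a b))
  memLp_deriv : MemLp g ⊤ (volume.restrict (Icc a b))
  weak_deriv : ∀ ψ : ℝ → ℝ, ContDiff ℝ ∞ ψ → HasCompactSupport ψ → tsupport ψ ⊆ Ioo a b →
    ∫ x in Icc a b, deriv ψ x • f x = -∫ x in Icc a b, ψ x • g x

/-- The norm `ess sup |f| + ess sup |f'|` on `[a, b]`, where `g = f'`. -/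
def w1InfNorm (a b : ℝ) (f g : ℝ → ℂ) : ℝ :=
  (eLpNorm f ⊤ (volume.restrict (Icc a b))).toReal +
    (eLpNorm g ⊤ (volume.restrict (Icc a b))).toReal

end CurveGas

end

noncomputable section
namespace CurveGas
open Filter Topology Real

/-! Off a null set of configurations the density is the product of the speeds times `exp (-(β / 2)
N² H)`, with `H` the discrete energy (`weight_eq`). The speeds lie between `c` and `c⁻¹` and cost
only `exp (O(N))`. The first estimate therefore needs a lower bound for `H` and a lower bound for
the partition function, both with error `O(log N / N)` in the energy; the minimal energy cancels in
the quotient.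

Lower bound for `H` (`exists_discreteEnergy_ge`): spreading the points never shrinks a gap, and
smearing them over length `N⁻⁶` changes the kernel little, so the continuous energy of the
regularised measure `L` is at most `H` plus self-energies of order `log N` per particle
(`integral_curveLog_regEmpirical_le`). The energy is quadratic along mixtures, with the squared
distance `D²` as leading coefficient, so minimality of `μ` gives an excess of at least `D² (L, μ)`.
As `L` may leave `[a, b]` by `N⁻²`, it is first contracted affinely (`energy_coercive`).

Lower bound for the partition function (`exists_lintegral_gibbs_ge`): take `N` independent samples
of `μ`, contract them by `1 - N⁻²` towards a point `v` of the box, and average over `v`. Jensen's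
inequality controls the mean energy for fixed `v`; for a fixed sample, the map in `v` has Jacobian
`N ^ (-2 N)`, which is the admissible loss. No density of `μ` is involved.

Behind all this is the positivity of `D²`. Frullani's formula writes `-log r` as half the integral
of `(exp (-t r²) - exp (-t)) / t`; on neutral signed measures the constant drops out and the
Gaussians have a positive Fourier transform. In the limit `D²` dominates the integral of `|ξ|⁻²`
times the squared difference of characteristic functions (`lintegral_charFun_le`), a negative
Sobolev norm. By Cauchy–Schwarz `D` bounds the action on test functions by their Dirichlet integral
(`sq_integral_sub_le`), and hence the action on Lipschitz functions of the curve parameter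
(`exists_abs_integral_sub_le`).

Functions with bounded weak derivative agree with Lipschitz functions only up to Lebesgue null sets,
so `μ` must be absolutely continuous (`absolutelyContinuous_of_isMinimiser`). Its support stays away
from the endpoints, so `μ` can be translated both ways by small `h`. The two first-order
inequalities, together with bounds on second differences of the chord kernel and of the field, give
`D² (μ, τ_h μ) = O(h²)` on the line; the derivative of `μ` is then bounded on Sobolev functions,
which rules out mass on null sets. The Gaussian tail is then the first estimate at `δ` divided by a
multiple of `‖f‖`, and the last claim is a choice of `K`. -/

/-- The quadratic form of the kernel `k` on the signed measure `α - β`. -/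
def quadDiff {X : Type*} [MeasurableSpace X] (k : X × X → ℝ) (α β : Measure X) : ℝ :=
  (∫ p, k p ∂(α.prod α)) - 2 * (∫ p, k p ∂(α.prod β)) + ∫ p, k p ∂(β.prod β)

/-! ### Truncations of the logarithmic kernel -/

/-- Truncated Frullani integral, converging to `- log a / 2`. -/
def truncLog (n : ℕ) (a : ℝ) : ℝ :=
  2⁻¹ * ∫ t in ((n : ℝ) + 1)⁻¹..((n : ℝ) + 1), t⁻¹ * (exp (-(t * a)) - exp (-t))

lemma intervalIntegrable_truncLog {p q : ℝ} (hp : 0 < p) (hq : 0 < q) (a : ℝ) :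
    IntervalIntegrable (fun t => t⁻¹ * (exp (-(t * a)) - exp (-t))) volume p q := by
  apply ContinuousOn.intervalIntegrable
  apply ContinuousOn.mul
  · exact continuousOn_inv₀.mono fun x hx => by
      have : 0 < x := lt_of_lt_of_le (lt_min hp hq) hx.1
      exact this.ne'
  · fun_prop

/-- Frullani's integral for `exp (-x)` with parameters `a` and `1`: the limits `1` at zero and `0`
at infinity give `log (1 / a)`, and the intervals `[1 / (n + 1), n + 1]` exhaust the half-line. -/
lemma tendsto_truncLog {a : ℝ} (ha : 0 < a) :
    Tendsto (fun n => truncLog n a) atTop (𝓝 (-(2⁻¹ * log a))) := by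
  have h := Frullani.tendsto_intervalIntegral (f := fun x => exp (-x)) (a := a) (b := 1)
    (L := 1) (R := 0)
    ((by fun_prop : Continuous fun x : ℝ => exp (-x)).locallyIntegrable.locallyIntegrableOn _)
    ha one_pos
    (by
      have : Continuous fun x : ℝ => exp (-x) := by fun_prop
      simpa using (this.tendsto 0).mono_left nhdsWithin_le_nhds)
    (by simpa using Real.tendsto_exp_neg_atTop_nhds_zero)
  have h2 : Tendsto (fun n : ℕ => (((n : ℝ) + 1)⁻¹, (n : ℝ) + 1)) atTop ((𝓝[>] 0) ×ˢ atTop) := by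
    have h3 : Tendsto (fun n : ℕ => (n : ℝ) + 1) atTop atTop :=
      tendsto_atTop_add_const_right _ _ tendsto_natCast_atTop_atTop
    exact (tendsto_inv_atTop_nhdsGT_zero.comp h3).prodMk h3
  have h4 := (h.comp h2).const_mul 2⁻¹
  convert h4 using 2
  · simp [truncLog, mul_comm]
  · simp

/-- The integrand has one sign on each side of `a = 1`, so the truncations move monotonically in `n`
from the side of zero towards the limit. Domination and one-sided bounds both come from this. -/
lemma truncLog_sign_nonneg {t a : ℝ} (ht : 0 < t) (ha : a ≤ 1) :
    0 ≤ t⁻¹ * (exp (-(t * a)) - exp (-t)) := by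
  apply mul_nonneg (by positivity)
  rw [sub_nonneg, exp_le_exp]
  nlinarith

lemma truncLog_sign_nonpos {t a : ℝ} (ht : 0 < t) (ha : 1 ≤ a) :
    t⁻¹ * (exp (-(t * a)) - exp (-t)) ≤ 0 := by
  apply mul_nonpos_of_nonneg_of_nonpos (by positivity)
  rw [sub_nonpos, exp_le_exp]
  nlinarith

lemma truncLog_nonneg (n : ℕ) {a : ℝ} (ha : a ≤ 1) : 0 ≤ truncLog n a := by
  unfold truncLog
  have h1 : ((n : ℝ) + 1)⁻¹ ≤ (n : ℝ) + 1 := by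
    have : (1 : ℝ) ≤ n + 1 := by simp
    exact (inv_le_one_of_one_le₀ this).trans this
  have := intervalIntegral.integral_nonneg (μ := volume)
    (f := fun t => t⁻¹ * (exp (-(t * a)) - exp (-t))) h1 fun t ht =>
    truncLog_sign_nonneg (lt_of_lt_of_le (by positivity) ht.1) ha
  positivity

lemma abs_integral_mono_sign (n m : ℕ) (hnm : n ≤ m) {f : ℝ → ℝ}
    (hf : ∀ p q : ℝ, 0 < p → 0 < q → IntervalIntegrable f volume p q)
    (h0 : ∀ t, 0 < t → 0 ≤ f t) :
    ∫ t in ((n : ℝ) + 1)⁻¹..((n : ℝ) + 1), f t ≤ ∫ t in ((m : ℝ) + 1)⁻¹..((m : ℝ) + 1), f t := by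
  have hn : (0 : ℝ) < n + 1 := by positivity
  have hm : (0 : ℝ) < m + 1 := by positivity
  have hc : (n : ℝ) ≤ m := by exact_mod_cast hnm
  have h1 : ((n : ℝ) + 1)⁻¹ ≤ (n : ℝ) + 1 := by
    have : (1 : ℝ) ≤ n + 1 := by simp
    exact (inv_le_one_of_one_le₀ this).trans this
  apply intervalIntegral.integral_mono_interval (c := ((m : ℝ) + 1)⁻¹) (d := (m : ℝ) + 1)
  · gcongr
  · exact h1
  · linarith
  · rw [Filter.EventuallyLE, ae_restrict_iff' measurableSet_Ioc]
    exact .of_forall fun t ht => h0 t (lt_trans (by positivity) ht.1)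
  · exact hf _ _ (by positivity) hm

lemma truncLog_mono {a : ℝ} (ha : a ≤ 1) : Monotone fun n => truncLog n a := by
  intro n m hnm
  unfold truncLog
  have := abs_integral_mono_sign n m hnm
    (fun p q hp hq => intervalIntegrable_truncLog hp hq a)
    (fun t ht => truncLog_sign_nonneg ht ha)
  linarith

lemma truncLog_anti {a : ℝ} (ha : 1 ≤ a) : Antitone fun n => truncLog n a := by
  intro n m hnm
  unfold truncLog
  have := abs_integral_mono_sign n m hnm
    (fun p q hp hq => (intervalIntegrable_truncLog hp hq a).neg)
    (fun t ht => neg_nonneg.2 (truncLog_sign_nonpos ht ha))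
  simp only [Pi.neg_apply, intervalIntegral.integral_neg] at this
  linarith

lemma truncLog_le {a : ℝ} (n : ℕ) (ha0 : 0 < a) (ha : a ≤ 1) : truncLog n a ≤ -(2⁻¹ * log a) :=
  (truncLog_mono ha).ge_of_tendsto (tendsto_truncLog ha0) n

lemma le_truncLog {a : ℝ} (n : ℕ) (ha : 1 ≤ a) : -(2⁻¹ * log a) ≤ truncLog n a :=
  (truncLog_anti ha).le_of_tendsto (tendsto_truncLog (by linarith)) n

lemma truncLog_nonpos (n : ℕ) {a : ℝ} (ha : 1 ≤ a) : truncLog n a ≤ 0 := by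
  unfold truncLog
  have h1 : ((n : ℝ) + 1)⁻¹ ≤ (n : ℝ) + 1 := by
    have : (1 : ℝ) ≤ n + 1 := by simp
    exact (inv_le_one_of_one_le₀ this).trans this
  have := intervalIntegral.integral_nonneg (μ := volume)
    (f := fun t => -(t⁻¹ * (exp (-(t * a)) - exp (-t)))) h1 fun t ht =>
    neg_nonneg.2 (truncLog_sign_nonpos (lt_of_lt_of_le (by positivity) ht.1) ha)
  rw [intervalIntegral.integral_neg] at this
  linarith

lemma abs_truncLog_le {a : ℝ} (n : ℕ) (ha0 : 0 < a) : |truncLog n a| ≤ 2⁻¹ * |log a| := by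
  rcases le_total a 1 with h | h
  · rw [abs_of_nonneg (truncLog_nonneg n h), abs_of_nonpos (log_nonpos ha0.le h)]
    linarith [truncLog_le n ha0 h]
  · rw [abs_of_nonpos (truncLog_nonpos n h), abs_of_nonneg (log_nonneg h)]
    linarith [le_truncLog n h]

/-- A lower bound uniform in `n`: on bounded sets a fixed constant makes every truncated kernel
nonnegative, as Fatou's lemma requires. -/
lemma truncLog_lower {a R : ℝ} (n : ℕ) (hR : 1 ≤ R) (haR : a ≤ R) :
    -(2⁻¹ * log R) ≤ truncLog n a := by
  rcases le_total a 1 with h | h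
  · linarith [truncLog_nonneg n h, log_nonneg hR]
  · linarith [le_truncLog n h, log_le_log (by linarith) haR]

/-! ### Gaussian kernels -/

/-- The width `1 / (4 t)` on the Fourier side reproduces `exp (-t ‖z‖²)` exactly. In real dimension
two the exponent `finrank / 2` is `1`, which makes the prefactor `4 π t`. -/
lemma gauss_fourier {t : ℝ} (ht : 0 < t) (z : ℂ) :
    ∫ ξ : ℂ, Complex.exp (-((4 * t : ℝ) : ℂ)⁻¹ * ‖ξ‖ ^ 2 + Complex.I * (inner ℝ z ξ : ℝ)) =
      ((4 * π * t : ℝ) : ℂ) * (exp (-(t * ‖z‖ ^ 2)) : ℝ) := by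
  have := GaussianFourier.integral_cexp_neg_mul_sq_norm_add (V := ℂ)
    (b := ((4 * t : ℝ) : ℂ)⁻¹) (by rw [← Complex.ofReal_inv, Complex.ofReal_re]; positivity)
    Complex.I z
  rw [this]
  have h2 : (Module.finrank ℝ ℂ / 2 : ℂ) = 1 := by simp [Complex.finrank_real_complex]
  rw [h2, Complex.cpow_one]
  have ht' : (t : ℂ) ≠ 0 := by exact_mod_cast ht.ne'
  push_cast
  congr 1
  · field_simp
  · congr 1
    rw [Complex.I_sq]
    field_simp

lemma integrable_gauss {t : ℝ} (ht : 0 < t) :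
    Integrable fun ξ : ℂ => exp (-((4 * t)⁻¹ * ‖ξ‖ ^ 2)) := by
  have := (GaussianFourier.integrable_cexp_neg_mul_sq_norm_add (V := ℂ)
    (b := ((4 * t : ℝ) : ℂ)⁻¹) (by rw [← Complex.ofReal_inv, Complex.ofReal_re]; positivity)
    0 0).norm
  refine this.congr (.of_forall fun ξ => ?_)
  simp only [zero_mul, add_zero, Complex.norm_exp]
  rw [← Complex.ofReal_inv]
  congr 1
  norm_cast
  ring

/-- Fubini: inserting the Fourier representation of the kernel separates the two variables, and the
inner integrals become characteristic functions. -/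
lemma gauss_energy (α β : Measure ℂ) [IsFiniteMeasure α] [IsFiniteMeasure β] {t : ℝ}
    (ht : 0 < t) :
    ((4 * π * t : ℝ) : ℂ) * ((∫ p, exp (-(t * ‖p.1 - p.2‖ ^ 2)) ∂(α.prod β) : ℝ) : ℂ) =
      ∫ ξ : ℂ, (exp (-((4 * t)⁻¹ * ‖ξ‖ ^ 2)) : ℝ) *
        (charFun α ξ * (starRingEnd ℂ) (charFun β ξ)) := by
  rw [← integral_complex_ofReal, ← integral_const_mul]
  have h1 : ∀ p : ℂ × ℂ, ((4 * π * t : ℝ) : ℂ) * ((exp (-(t * ‖p.1 - p.2‖ ^ 2)) : ℝ) : ℂ) =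
      ∫ ξ : ℂ, (exp (-((4 * t)⁻¹ * ‖ξ‖ ^ 2)) : ℝ) *
        (Complex.exp ((inner ℝ p.1 ξ : ℝ) * Complex.I) *
          Complex.exp (-((inner ℝ p.2 ξ : ℝ) * Complex.I))) := by
    intro p
    rw [← gauss_fourier ht]
    congr 1 with ξ
    rw [← Complex.exp_add, Complex.ofReal_exp, ← Complex.exp_add]
    congr 1
    rw [inner_sub_left]
    push_cast
    ring
  simp_rw [h1]
  rw [integral_integral_swap]
  · congr 1 with ξ
    rw [integral_const_mul]
    congr 1
    rw [← charFun_neg, charFun_apply, charFun_apply]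
    rw [← integral_prod_mul]
    congr 1 with p
    simp only [inner_neg_right, Complex.ofReal_neg, neg_mul]
  · have hg : Integrable (fun q : (ℂ × ℂ) × ℂ => (exp (-((4 * t)⁻¹ * ‖q.2‖ ^ 2)) : ℝ))
        ((α.prod β).prod volume) := (integrable_gauss ht).comp_snd _
    refine hg.mono' ?_ ?_
    · apply Continuous.aestronglyMeasurable
      unfold Function.uncurry
      fun_prop
    · refine .of_forall fun q => ?_
      simp only [Function.uncurry, norm_mul, Complex.norm_real, Real.norm_eq_abs, abs_exp]
      rw [Complex.norm_exp_ofReal_mul_I, Complex.norm_exp]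
      simp

lemma integrable_gauss_charFun (α β : Measure ℂ) [IsFiniteMeasure α] [IsFiniteMeasure β] {t : ℝ}
    (ht : 0 < t) : Integrable fun ξ : ℂ => ((exp (-((4 * t)⁻¹ * ‖ξ‖ ^ 2)) : ℝ) : ℂ) *
        (charFun α ξ * (starRingEnd ℂ) (charFun β ξ)) := by
  refine ((integrable_gauss ht).mul_const (α.real univ * β.real univ)).mono' ?_ ?_
  · exact ((by fun_prop : Measurable fun ξ : ℂ =>
      ((exp (-((4 * t)⁻¹ * ‖ξ‖ ^ 2)) : ℝ) : ℂ)).mul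
      ((stronglyMeasurable_charFun.measurable).mul
        (Complex.continuous_conj.measurable.comp
          (stronglyMeasurable_charFun.measurable)))).aestronglyMeasurable
  · refine .of_forall fun ξ => ?_
    simp only [norm_mul, Complex.norm_real, Real.norm_eq_abs, abs_exp, RCLike.norm_conj]
    gcongr
    · exact norm_charFun_le ξ
    · exact norm_charFun_le ξ

/-- Positive definiteness of the Gaussian kernel: the expansion of the squared modulus consists of
four Gaussian energies, and the two mixed ones coincide because the kernel is symmetric. -/
lemma quadDiff_gauss (α β : Measure ℂ) [IsFiniteMeasure α] [IsFiniteMeasure β] {t : ℝ}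
    (ht : 0 < t) :
    4 * π * t * quadDiff (fun p : ℂ × ℂ => exp (-(t * ‖p.1 - p.2‖ ^ 2))) α β =
      ∫ ξ : ℂ, exp (-((4 * t)⁻¹ * ‖ξ‖ ^ 2)) * ‖charFun α ξ - charFun β ξ‖ ^ 2 := by
  have hsymm : ∫ p, exp (-(t * ‖p.1 - p.2‖ ^ 2)) ∂(β.prod α) =
      ∫ p, exp (-(t * ‖p.1 - p.2‖ ^ 2)) ∂(α.prod β) := by
    rw [← integral_prod_swap]
    congr 1 with p
    simp [norm_sub_rev]
  have h := gauss_energy β α ht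
  rw [hsymm] at h
  rw [← Complex.ofReal_inj, ← integral_complex_ofReal, quadDiff]
  have e : ∀ ξ : ℂ, ((exp (-((4 * t)⁻¹ * ‖ξ‖ ^ 2)) * ‖charFun α ξ - charFun β ξ‖ ^ 2 : ℝ) : ℂ) =
     ((exp (-((4 * t)⁻¹ * ‖ξ‖ ^ 2)) : ℝ) : ℂ) * (charFun α ξ * (starRingEnd ℂ) (charFun α ξ)) -
     ((exp (-((4 * t)⁻¹ * ‖ξ‖ ^ 2)) : ℝ) : ℂ) * (charFun α ξ * (starRingEnd ℂ) (charFun β ξ)) -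
     ((exp (-((4 * t)⁻¹ * ‖ξ‖ ^ 2)) : ℝ) : ℂ) * (charFun β ξ * (starRingEnd ℂ) (charFun α ξ)) +
     ((exp (-((4 * t)⁻¹ * ‖ξ‖ ^ 2)) : ℝ) : ℂ) * (charFun β ξ * (starRingEnd ℂ) (charFun β ξ)) := by
    intro ξ
    rw [Complex.ofReal_mul, Complex.ofReal_pow, ← Complex.mul_conj', map_sub]
    ring
  simp_rw [e]
  rw [integral_add, integral_sub, integral_sub, ← gauss_energy α α ht, ← gauss_energy α β ht,
    ← gauss_energy β β ht, ← h]
  · push_cast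
    ring
  all_goals first
    | exact integrable_gauss_charFun _ _ ht
    | exact (integrable_gauss_charFun _ _ ht).sub (integrable_gauss_charFun _ _ ht)
    | exact ((integrable_gauss_charFun _ _ ht).sub (integrable_gauss_charFun _ _ ht)).sub
        (integrable_gauss_charFun _ _ ht)

end CurveGas
end

/-! ### Truncated logarithmic energies in the plane and their Fourier form -/

noncomputable section
namespace CurveGas
open Filter Topology Real

/-- The logarithmic kernel of the plane. -/
def planeLog (p : ℂ × ℂ) : ℝ := -log ‖p.1 - p.2‖

lemma measurable_planeLog : Measurable planeLog := by
  unfold planeLog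
  fun_prop

lemma integrable_truncLog_prod (α β : Measure ℂ) [IsFiniteMeasure α] [IsFiniteMeasure β] (n : ℕ) :
    Integrable (fun q : (ℂ × ℂ) × ℝ =>
      q.2⁻¹ * (exp (-(q.2 * ‖q.1.1 - q.1.2‖ ^ 2)) - exp (-q.2)))
      ((α.prod β).prod (volume.restrict (Ioc ((n : ℝ) + 1)⁻¹ ((n : ℝ) + 1)))) := by
  refine (integrable_const ((n : ℝ) + 1)).mono' ?_ ?_
  · apply Measurable.aestronglyMeasurable
    fun_prop
  · have : ∀ᵐ q ∂((α.prod β).prod (volume.restrict (Ioc ((n : ℝ) + 1)⁻¹ ((n : ℝ) + 1)))),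
        q.2 ∈ Ioc ((n : ℝ) + 1)⁻¹ ((n : ℝ) + 1) :=
      Measure.quasiMeasurePreserving_snd.ae (ae_restrict_mem measurableSet_Ioc)
    filter_upwards [this] with q hq
    have hpos : 0 < q.2 := lt_trans (by positivity) hq.1
    rw [norm_mul, norm_inv, Real.norm_eq_abs, Real.norm_eq_abs, abs_of_pos hpos]
    have h1 : q.2⁻¹ ≤ (n : ℝ) + 1 := inv_le_of_inv_le₀ (by positivity) hq.1.le
    have h2 : |exp (-(q.2 * ‖q.1.1 - q.1.2‖ ^ 2)) - exp (-q.2)| ≤ 1 := by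
      have a1 : exp (-(q.2 * ‖q.1.1 - q.1.2‖ ^ 2)) ≤ 1 := exp_le_one_iff.2 (by
        have : 0 ≤ q.2 * ‖q.1.1 - q.1.2‖ ^ 2 := by positivity
        linarith)
      have a2 : exp (-q.2) ≤ 1 := exp_le_one_iff.2 (by linarith)
      rw [abs_le]
      constructor <;> linarith [exp_pos (-(q.2 * ‖q.1.1 - q.1.2‖ ^ 2)), exp_pos (-q.2)]
    calc _ ≤ ((n : ℝ) + 1) * 1 := by gcongr
      _ = _ := mul_one _

lemma inv_le_add_one (n : ℕ) : ((n : ℝ) + 1)⁻¹ ≤ (n : ℝ) + 1 := by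
  have : (1 : ℝ) ≤ n + 1 := by simp
  exact (inv_le_one_of_one_le₀ this).trans this

lemma truncLog_eq (n : ℕ) (a : ℝ) : truncLog n a =
    2⁻¹ * ∫ t in Ioc ((n : ℝ) + 1)⁻¹ ((n : ℝ) + 1), t⁻¹ * (exp (-(t * a)) - exp (-t)) := by
  rw [truncLog, intervalIntegral.integral_of_le (inv_le_add_one n)]

lemma integrable_truncLog (α β : Measure ℂ) [IsFiniteMeasure α] [IsFiniteMeasure β] (n : ℕ) :
    Integrable (fun p : ℂ × ℂ => truncLog n (‖p.1 - p.2‖ ^ 2)) (α.prod β) := by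
  simp_rw [truncLog_eq]
  exact (integrable_truncLog_prod α β n).integral_prod_left.const_mul _

lemma integrable_gaussKernel (α β : Measure ℂ) [IsFiniteMeasure α] [IsFiniteMeasure β] {t : ℝ}
    (ht : 0 < t) : Integrable (fun p : ℂ × ℂ => exp (-(t * ‖p.1 - p.2‖ ^ 2))) (α.prod β) := by
  refine (integrable_const (1 : ℝ)).mono' (Measurable.aestronglyMeasurable (by fun_prop)) ?_
  refine .of_forall fun p => ?_
  rw [Real.norm_eq_abs, abs_exp, exp_le_one_iff]
  have : 0 ≤ t * ‖p.1 - p.2‖ ^ 2 := by positivity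
  linarith

lemma integral_truncLog (α β : Measure ℂ) [IsFiniteMeasure α] [IsFiniteMeasure β] (n : ℕ) :
    Integrable (fun t => t⁻¹ * ((∫ p, exp (-(t * ‖p.1 - p.2‖ ^ 2)) ∂(α.prod β)) -
        exp (-t) * (α.real univ * β.real univ)))
        (volume.restrict (Ioc ((n : ℝ) + 1)⁻¹ ((n : ℝ) + 1))) ∧
    ∫ p : ℂ × ℂ, truncLog n (‖p.1 - p.2‖ ^ 2) ∂(α.prod β) =
      2⁻¹ * ∫ t in Ioc ((n : ℝ) + 1)⁻¹ ((n : ℝ) + 1),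
        t⁻¹ * ((∫ p, exp (-(t * ‖p.1 - p.2‖ ^ 2)) ∂(α.prod β)) -
          exp (-t) * (α.real univ * β.real univ)) := by
  have key : ∀ t ∈ Ioc ((n : ℝ) + 1)⁻¹ ((n : ℝ) + 1),
      ∫ p : ℂ × ℂ, t⁻¹ * (exp (-(t * ‖p.1 - p.2‖ ^ 2)) - exp (-t)) ∂(α.prod β) =
       t⁻¹ * ((∫ p, exp (-(t * ‖p.1 - p.2‖ ^ 2)) ∂(α.prod β)) -
          exp (-t) * (α.real univ * β.real univ)) := by
    intro t ht
    have hpos : 0 < t := lt_trans (by positivity) ht.1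
    rw [integral_const_mul, integral_sub (integrable_gaussKernel α β hpos) (integrable_const _),
      integral_const, ← univ_prod_univ, measureReal_prod_prod, smul_eq_mul]
    ring
  constructor
  · refine (integrable_truncLog_prod α β n).integral_prod_right.congr ?_
    filter_upwards [ae_restrict_mem measurableSet_Ioc] with t ht using key t ht
  · simp_rw [truncLog_eq]
    rw [integral_const_mul, integral_integral_swap (integrable_truncLog_prod α β n)]
    congr 1
    exact setIntegral_congr_fun measurableSet_Ioc key

/-- For equal masses `m` the contributions of `exp (-t)` cancel, being multiples of `m² - 2 m² +
m²`; what remains is a superposition of Gaussian energies. -/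
lemma quadDiff_truncLog (α β : Measure ℂ) [IsFiniteMeasure α] [IsFiniteMeasure β]
    (hαβ : α univ = β univ) (n : ℕ) :
    Integrable (fun t => t⁻¹ * quadDiff (fun p : ℂ × ℂ => exp (-(t * ‖p.1 - p.2‖ ^ 2))) α β)
      (volume.restrict (Ioc ((n : ℝ) + 1)⁻¹ ((n : ℝ) + 1))) ∧
    quadDiff (fun p : ℂ × ℂ => truncLog n (‖p.1 - p.2‖ ^ 2)) α β =
      2⁻¹ * ∫ t in Ioc ((n : ℝ) + 1)⁻¹ ((n : ℝ) + 1),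
        t⁻¹ * quadDiff (fun p : ℂ × ℂ => exp (-(t * ‖p.1 - p.2‖ ^ 2))) α β := by
  have hm : β.real univ = α.real univ := by simp [Measure.real, hαβ]
  obtain ⟨i1, e1⟩ := integral_truncLog α α n
  obtain ⟨i2, e2⟩ := integral_truncLog α β n
  obtain ⟨i3, e3⟩ := integral_truncLog β β n
  have e : ∀ t : ℝ, t⁻¹ * quadDiff (fun p : ℂ × ℂ => exp (-(t * ‖p.1 - p.2‖ ^ 2))) α β =
      t⁻¹ * ((∫ p, exp (-(t * ‖p.1 - p.2‖ ^ 2)) ∂(α.prod α)) -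
          exp (-t) * (α.real univ * α.real univ)) -
      2 * (t⁻¹ * ((∫ p, exp (-(t * ‖p.1 - p.2‖ ^ 2)) ∂(α.prod β)) -
          exp (-t) * (α.real univ * β.real univ))) +
      t⁻¹ * ((∫ p, exp (-(t * ‖p.1 - p.2‖ ^ 2)) ∂(β.prod β)) -
          exp (-t) * (β.real univ * β.real univ)) := by
    intro t
    rw [quadDiff, hm]
    ring
  simp_rw [e]
  refine ⟨(i1.sub (i2.const_mul 2)).add i3, ?_⟩
  rw [integral_add (by exact i1.sub (i2.const_mul 2)) (by exact i3),
    integral_sub (by exact i1) (by exact i2.const_mul 2),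
    integral_const_mul, quadDiff, e1, e2, e3]
  ring

lemma quadDiff_gauss_nonneg (α β : Measure ℂ) [IsFiniteMeasure α] [IsFiniteMeasure β] {t : ℝ}
    (ht : 0 < t) : 0 ≤ quadDiff (fun p : ℂ × ℂ => exp (-(t * ‖p.1 - p.2‖ ^ 2))) α β := by
  have h := quadDiff_gauss α β ht
  have h2 : 0 ≤ ∫ ξ : ℂ, exp (-((4 * t)⁻¹ * ‖ξ‖ ^ 2)) * ‖charFun α ξ - charFun β ξ‖ ^ 2 :=
    integral_nonneg fun ξ => by positivity
  rw [← h] at h2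
  exact nonneg_of_mul_nonneg_right h2 (by positivity)

lemma quadDiff_truncLog_nonneg (α β : Measure ℂ) [IsFiniteMeasure α] [IsFiniteMeasure β]
    (hαβ : α univ = β univ) (n : ℕ) :
    0 ≤ quadDiff (fun p : ℂ × ℂ => truncLog n (‖p.1 - p.2‖ ^ 2)) α β := by
  rw [(quadDiff_truncLog α β hαβ n).2]
  refine mul_nonneg (by norm_num) (setIntegral_nonneg measurableSet_Ioc fun t ht => ?_)
  have hpos : 0 < t := lt_trans (by positivity) ht.1
  exact mul_nonneg (by positivity) (quadDiff_gauss_nonneg α β hpos)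

/-- The primitive is `A⁻¹ exp (-A / t)`. With `A = ‖ξ‖² / 4` the value tends to `4 / ‖ξ‖²` as `n`
grows, which is where the homogeneous Sobolev weight comes from. -/
lemma integral_heat (n : ℕ) {A : ℝ} (hA : 0 < A) :
    IntegrableOn (fun t : ℝ => t⁻¹ ^ 2 * exp (-(A * t⁻¹))) (Ioc ((n : ℝ) + 1)⁻¹ ((n : ℝ) + 1)) ∧
    ∫ t in Ioc ((n : ℝ) + 1)⁻¹ ((n : ℝ) + 1), t⁻¹ ^ 2 * exp (-(A * t⁻¹)) =
      A⁻¹ * (exp (-(A * ((n : ℝ) + 1)⁻¹)) - exp (-(A * ((n : ℝ) + 1)))) := by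
  have hpos : ∀ t ∈ uIcc ((n : ℝ) + 1)⁻¹ ((n : ℝ) + 1), 0 < t := by
    intro t ht
    rw [uIcc_of_le (inv_le_add_one n)] at ht
    exact lt_of_lt_of_le (by positivity) ht.1
  have hi : IntervalIntegrable (fun t : ℝ => t⁻¹ ^ 2 * exp (-(A * t⁻¹))) volume
      ((n : ℝ) + 1)⁻¹ ((n : ℝ) + 1) := by
    apply ContinuousOn.intervalIntegrable
    have : ContinuousOn (fun t : ℝ => t⁻¹) (uIcc ((n : ℝ) + 1)⁻¹ ((n : ℝ) + 1)) :=
      continuousOn_inv₀.mono fun t ht => (hpos t ht).ne'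
    fun_prop
  refine ⟨(intervalIntegrable_iff_integrableOn_Ioc_of_le (inv_le_add_one n)).1 hi, ?_⟩
  rw [← intervalIntegral.integral_of_le (inv_le_add_one n),
    intervalIntegral.integral_eq_sub_of_hasDerivAt
      (f := fun t => A⁻¹ * exp (-(A * t⁻¹))) _ hi]
  · rw [inv_inv]
    ring
  · intro t ht
    have ht0 := (hpos t ht).ne'
    have := ((((hasDerivAt_inv ht0).const_mul A).neg).exp.const_mul A⁻¹)
    refine this.congr_deriv ?_
    simp only [Pi.neg_apply]
    field_simp

/-- Tonelli in `(t, ξ)`; in this form the exchange needs no integrability and Fatou's lemma applies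
directly. The constant `8 π` is `2 · 4 π`, and `t⁻²` combines `t⁻¹` with the prefactor of the
Gaussian. -/
lemma quadDiff_truncLog_lintegral (α β : Measure ℂ) [IsFiniteMeasure α] [IsFiniteMeasure β]
    (hαβ : α univ = β univ) (n : ℕ) :
    ENNReal.ofReal (quadDiff (fun p : ℂ × ℂ => truncLog n (‖p.1 - p.2‖ ^ 2)) α β) =
    ∫⁻ ξ : ℂ, ENNReal.ofReal (‖charFun α ξ - charFun β ξ‖ ^ 2 * ((8 * π)⁻¹ *
      ∫ t in Ioc ((n : ℝ) + 1)⁻¹ ((n : ℝ) + 1), t⁻¹ ^ 2 * exp (-(4⁻¹ * ‖ξ‖ ^ 2 * t⁻¹)))) := by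
  obtain ⟨hi, he⟩ := quadDiff_truncLog α β hαβ n
  have hm : Measurable fun ξ : ℂ => ‖charFun α ξ - charFun β ξ‖ ^ 2 :=
    (((stronglyMeasurable_charFun.measurable).sub
      (stronglyMeasurable_charFun.measurable)).norm).pow_const 2
  have hpos : ∀ t ∈ Ioc ((n : ℝ) + 1)⁻¹ ((n : ℝ) + 1), 0 < t := fun t ht =>
    lt_trans (by positivity) ht.1
  rw [he, ← integral_const_mul, ofReal_integral_eq_lintegral_ofReal (hi.const_mul _)]
  · have e1 : ∀ t ∈ Ioc ((n : ℝ) + 1)⁻¹ ((n : ℝ) + 1),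
        ENNReal.ofReal (2⁻¹ * (t⁻¹ *
          quadDiff (fun p : ℂ × ℂ => exp (-(t * ‖p.1 - p.2‖ ^ 2))) α β)) =
        ∫⁻ ξ : ℂ, ENNReal.ofReal (‖charFun α ξ - charFun β ξ‖ ^ 2 * ((8 * π)⁻¹ *
          (t⁻¹ ^ 2 * exp (-(4⁻¹ * ‖ξ‖ ^ 2 * t⁻¹))))) := by
      intro t ht
      have ht0 := hpos t ht
      rw [← ofReal_integral_eq_lintegral_ofReal]
      · congr 1
        have h := quadDiff_gauss α β ht0
        have : quadDiff (fun p : ℂ × ℂ => exp (-(t * ‖p.1 - p.2‖ ^ 2))) α β =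
          (4 * π * t)⁻¹ *
          ∫ ξ : ℂ, exp (-((4 * t)⁻¹ * ‖ξ‖ ^ 2)) * ‖charFun α ξ - charFun β ξ‖ ^ 2 := by
          rw [← h]
          field_simp
        rw [this, ← integral_const_mul, ← integral_const_mul, ← integral_const_mul]
        congr 1 with ξ
        have : -((4 * t)⁻¹ * ‖ξ‖ ^ 2) = -(4⁻¹ * ‖ξ‖ ^ 2 * t⁻¹) := by
          rw [mul_inv]
          ring
        rw [this]
        field_simp
        ring
      · have := ((integrable_gauss ht0).mul_const
          (((α.real univ + β.real univ) ^ 2) * ((8 * π)⁻¹ * t⁻¹ ^ 2)))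
        refine this.mono' ?_ ?_
        · exact (hm.mul (by fun_prop)).aestronglyMeasurable
        · refine .of_forall fun ξ => ?_
          have h1 : ‖charFun α ξ - charFun β ξ‖ ≤ α.real univ + β.real univ :=
            (norm_sub_le _ _).trans (add_le_add (norm_charFun_le ξ) (norm_charFun_le ξ))
          rw [Real.norm_eq_abs, abs_of_nonneg (by positivity)]
          have : -((4 * t)⁻¹ * ‖ξ‖ ^ 2) = -(4⁻¹ * ‖ξ‖ ^ 2 * t⁻¹) := by
            rw [mul_inv]
            ring
          rw [this]
          calc _ ≤ (α.real univ + β.real univ) ^ 2 * ((8 * π)⁻¹ *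
              (t⁻¹ ^ 2 * exp (-(4⁻¹ * ‖ξ‖ ^ 2 * t⁻¹)))) := by gcongr
            _ = _ := by ring
      · exact .of_forall fun ξ => by positivity
    rw [setLIntegral_congr_fun measurableSet_Ioc e1, lintegral_lintegral_swap]
    · apply lintegral_congr_ae
      have : ∀ᵐ ξ : ℂ, ξ ≠ 0 := by
        have := measure_singleton (μ := (volume : Measure ℂ)) 0
        exact compl_mem_ae_iff.2 this
      filter_upwards [this] with ξ hξ
      rw [← integral_const_mul, ← integral_const_mul, ofReal_integral_eq_lintegral_ofReal]
      · have : 0 < 4⁻¹ * ‖ξ‖ ^ 2 := by positivity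
        exact ((integral_heat n this).1.const_mul _).const_mul _
      · exact .of_forall fun t => by positivity
    · apply Measurable.aemeasurable
      apply ENNReal.measurable_ofReal.comp
      exact (hm.comp measurable_snd).mul (by fun_prop)
  · filter_upwards [ae_restrict_mem measurableSet_Ioc] with t ht
    have ht0 := hpos t ht
    have := quadDiff_gauss_nonneg α β ht0
    positivity

end CurveGas
end

/-! ### Logarithmic energy in the plane: finiteness, positivity, Fourier lower bound -/

noncomputable section
namespace CurveGas
open Filter Topology Real

/-- The sections of the diagonal are singletons, so one atomless factor is enough. Since `log 0 =
0`, the real-valued kernel has the wrong value on the diagonal; this lemma makes that harmless. -/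
lemma ae_ne_of_noAtoms {X : Type*} [MeasurableSpace X] [MeasurableEq X]
    (α β : Measure X) [SFinite α] [SFinite β] [NullSingletonClass β] : ∀ᵐ p ∂(α.prod β), p.1 ≠ p.2 := by
  have hd : MeasurableSet {p : X × X | p.1 = p.2} := measurableSet_diagonal
  rw [ae_iff]
  simp only [ne_eq, not_not]
  rw [Measure.measure_prod_null hd]
  refine .of_forall fun x => ?_
  have : (Prod.mk x ⁻¹' {p : X × X | p.1 = p.2}) = {x} := by
    ext y
    simp [eq_comm]
  simp [this]

lemma ae_norm_sub_le {α β : Measure ℂ} [SFinite α] [SFinite β] {R : ℝ}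
    (hα : ∀ᵐ x ∂α, ‖x‖ ≤ R) (hβ : ∀ᵐ x ∂β, ‖x‖ ≤ R) :
    ∀ᵐ p ∂(α.prod β), ‖p.1 - p.2‖ ≤ 2 * R := by
  filter_upwards [Measure.quasiMeasurePreserving_fst.ae hα,
    Measure.quasiMeasurePreserving_snd.ae hβ] with p h1 h2
  exact (norm_sub_le _ _).trans (by linarith)

lemma tendsto_integral_truncLog {α β : Measure ℂ} [IsFiniteMeasure α] [IsFiniteMeasure β]
    [NullSingletonClass β] (h : Integrable planeLog (α.prod β)) :
    Tendsto (fun n => ∫ p : ℂ × ℂ, truncLog n (‖p.1 - p.2‖ ^ 2) ∂(α.prod β)) atTop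
      (𝓝 (∫ p, planeLog p ∂(α.prod β))) := by
  apply tendsto_integral_of_dominated_convergence (fun p => |planeLog p|)
    (fun n => (integrable_truncLog α β n).aestronglyMeasurable) h.abs
  · intro n
    filter_upwards [ae_ne_of_noAtoms α β] with p hp
    have : 0 < ‖p.1 - p.2‖ := norm_pos_iff.2 (sub_ne_zero.2 hp)
    refine (abs_truncLog_le n (by positivity)).trans (le_of_eq ?_)
    rw [planeLog, log_pow, abs_neg, abs_mul]
    norm_num
    ring
  · filter_upwards [ae_ne_of_noAtoms α β] with p hp
    have : 0 < ‖p.1 - p.2‖ := norm_pos_iff.2 (sub_ne_zero.2 hp)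
    have h2 := tendsto_truncLog (a := ‖p.1 - p.2‖ ^ 2) (by positivity)
    convert h2 using 2
    rw [planeLog, log_pow]
    push_cast
    ring

lemma integral_truncLog_le {α : Measure ℂ} [IsFiniteMeasure α]
    [NullSingletonClass α] (h : Integrable planeLog (α.prod α)) (n : ℕ) :
    ∫ p : ℂ × ℂ, truncLog n (‖p.1 - p.2‖ ^ 2) ∂(α.prod α) ≤ ∫ p, |planeLog p| ∂(α.prod α) := by
  apply integral_mono_ae (integrable_truncLog α α n) h.abs
  filter_upwards [ae_ne_of_noAtoms α α] with p hp
  have : 0 < ‖p.1 - p.2‖ := norm_pos_iff.2 (sub_ne_zero.2 hp)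
  refine (le_abs_self _).trans ((abs_truncLog_le n (by positivity)).trans (le_of_eq ?_))
  rw [planeLog, log_pow, abs_neg, abs_mul]
  norm_num
  ring

/-- Two measures of finite logarithmic energy have finite mutual energy. -/
lemma integrable_planeLog_cross {α β : Measure ℂ} [IsFiniteMeasure α] [IsFiniteMeasure β]
    [NullSingletonClass α] [NullSingletonClass β] (hαβ : α univ = β univ) {R : ℝ}
    (hαR : ∀ᵐ x ∂α, ‖x‖ ≤ R) (hβR : ∀ᵐ x ∂β, ‖x‖ ≤ R)
    (hα : Integrable planeLog (α.prod α)) (hβ : Integrable planeLog (β.prod β)) :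
    Integrable planeLog (α.prod β) := by
  -- `S` bounds all distances and is at least `1`, so that `c = log S` is nonnegative and shifts all
  -- truncated kernels to nonnegative ones.
  set S : ℝ := max 1 (2 * R) with hS
  have hS1 : 1 ≤ S := le_max_left _ _
  set c : ℝ := log S
  have hc : 0 ≤ c := log_nonneg hS1
  have hle : ∀ᵐ p ∂(α.prod β), p.1 ≠ p.2 ∧ ‖p.1 - p.2‖ ≤ S := by
    filter_upwards [ae_ne_of_noAtoms α β, ae_norm_sub_le hαR hβR] with p h1 h2
    exact ⟨h1, h2.trans (le_max_right _ _)⟩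
  set B : ℝ := ((∫ p, |planeLog p| ∂(α.prod α)) + ∫ p, |planeLog p| ∂(β.prod β)) / 2
  have hlow : ∀ n, ∀ᵐ p ∂(α.prod β), 0 ≤ truncLog n (‖p.1 - p.2‖ ^ 2) + c := by
    intro n
    filter_upwards [hle] with p hp
    have := truncLog_lower n (a := ‖p.1 - p.2‖ ^ 2) (R := S ^ 2) (one_le_pow₀ hS1)
      (by gcongr; exact hp.2)
    rw [log_pow] at this
    push_cast at this
    linarith
  -- Positivity of the truncated energies bounds the mutual energy by the mean of the self-energies,
  -- uniformly in `n`; Fatou's lemma then passes to the full kernel.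
  have hbound : ∀ n, ∫⁻ p, ENNReal.ofReal (truncLog n (‖p.1 - p.2‖ ^ 2) + c) ∂(α.prod β) ≤
      ENNReal.ofReal (B + c * (α.prod β).real univ) := by
    intro n
    rw [← ofReal_integral_eq_lintegral_ofReal
      (by exact (integrable_truncLog α β n).add (integrable_const c)) (hlow n)]
    apply ENNReal.ofReal_le_ofReal
    rw [integral_add (integrable_truncLog α β n) (integrable_const c), integral_const,
      smul_eq_mul]
    have h0 := quadDiff_truncLog_nonneg α β hαβ n
    rw [quadDiff] at h0
    have h1 := integral_truncLog_le hα n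
    have h2 := integral_truncLog_le hβ n
    have : ∫ p : ℂ × ℂ, truncLog n (‖p.1 - p.2‖ ^ 2) ∂(α.prod β) ≤ B := by
      simp only [B]
      linarith
    linarith
  have hfat : ∫⁻ p, ENNReal.ofReal (planeLog p + c) ∂(α.prod β) < ⊤ := by
    calc ∫⁻ p, ENNReal.ofReal (planeLog p + c) ∂(α.prod β)
        ≤ ∫⁻ p, liminf (fun n => ENNReal.ofReal (truncLog n (‖p.1 - p.2‖ ^ 2) + c)) atTop
            ∂(α.prod β) := by
          apply lintegral_mono_ae
          filter_upwards [hle] with p hp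
          have hpos : 0 < ‖p.1 - p.2‖ := norm_pos_iff.2 (sub_ne_zero.2 hp.1)
          have h2 := tendsto_truncLog (a := ‖p.1 - p.2‖ ^ 2) (by positivity)
          have h3 := (ENNReal.continuous_ofReal.tendsto _).comp (h2.add_const c)
          refine le_of_eq ?_
          symm
          have e : planeLog p + c = -(2⁻¹ * log (‖p.1 - p.2‖ ^ 2)) + c := by
            rw [planeLog, log_pow]
            push_cast
            ring
          rw [e]
          exact h3.liminf_eq
      _ ≤ liminf (fun n => ∫⁻ p, ENNReal.ofReal (truncLog n (‖p.1 - p.2‖ ^ 2) + c)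
            ∂(α.prod β)) atTop := by
          apply lintegral_liminf_le'
          intro n
          exact ((integrable_truncLog α β n).aestronglyMeasurable.aemeasurable.add_const
            c).ennreal_ofReal
      _ ≤ ENNReal.ofReal (B + c * (α.prod β).real univ) := by
          refine liminf_le_of_le (by isBoundedDefault) fun b hb => ?_
          obtain ⟨n, hn⟩ := hb.exists
          exact hn.trans (hbound n)
      _ < ⊤ := ENNReal.ofReal_lt_top
  have hint : Integrable (fun p => planeLog p + c) (α.prod β) := by
    refine ⟨(measurable_planeLog.add_const c).aestronglyMeasurable, ?_⟩
    rw [hasFiniteIntegral_iff_ofReal]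
    · exact hfat
    · filter_upwards [hle] with p hp
      have hpos : 0 < ‖p.1 - p.2‖ := norm_pos_iff.2 (sub_ne_zero.2 hp.1)
      have := log_le_log hpos hp.2
      simp only [planeLog, Pi.zero_apply, c]
      linarith
  exact (hint.sub (integrable_const c)).congr (.of_forall fun p => by simp)

lemma tendsto_quadDiff_truncLog {α β : Measure ℂ} [IsFiniteMeasure α] [IsFiniteMeasure β]
    [NullSingletonClass α] [NullSingletonClass β] (hα : Integrable planeLog (α.prod α))
    (hαβ : Integrable planeLog (α.prod β)) (hβ : Integrable planeLog (β.prod β)) :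
    Tendsto (fun n => quadDiff (fun p : ℂ × ℂ => truncLog n (‖p.1 - p.2‖ ^ 2)) α β) atTop
      (𝓝 (quadDiff planeLog α β)) :=
  ((tendsto_integral_truncLog hα).sub ((tendsto_integral_truncLog hαβ).const_mul 2)).add
    (tendsto_integral_truncLog hβ)

/-- The logarithmic energy of a neutral signed measure is nonnegative. -/
lemma quadDiff_planeLog_nonneg {α β : Measure ℂ} [IsFiniteMeasure α] [IsFiniteMeasure β]
    [NullSingletonClass α] [NullSingletonClass β] (hm : α univ = β univ) (hα : Integrable planeLog (α.prod α))
    (hαβ : Integrable planeLog (α.prod β)) (hβ : Integrable planeLog (β.prod β)) :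
    0 ≤ quadDiff planeLog α β :=
  ge_of_tendsto' (tendsto_quadDiff_truncLog hα hαβ hβ) (quadDiff_truncLog_nonneg α β hm)

/-- The logarithmic energy controls a homogeneous Sobolev norm of negative order. -/
lemma lintegral_charFun_le {α β : Measure ℂ} [IsFiniteMeasure α] [IsFiniteMeasure β]
    [NullSingletonClass α] [NullSingletonClass β] (hm : α univ = β univ) (hα : Integrable planeLog (α.prod α))
    (hαβ : Integrable planeLog (α.prod β)) (hβ : Integrable planeLog (β.prod β)) :
    ∫⁻ ξ : ℂ, ENNReal.ofReal (‖charFun α ξ - charFun β ξ‖ ^ 2 * (2 * π * ‖ξ‖ ^ 2)⁻¹) ≤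
      ENNReal.ofReal (quadDiff planeLog α β) := by
  have hmeas : Measurable fun ξ : ℂ => ‖charFun α ξ - charFun β ξ‖ ^ 2 :=
    (((stronglyMeasurable_charFun.measurable).sub
      (stronglyMeasurable_charFun.measurable)).norm).pow_const 2
  set m : ℕ → ℂ → ℝ := fun n ξ => ‖charFun α ξ - charFun β ξ‖ ^ 2 * ((8 * π)⁻¹ *
    ((4⁻¹ * ‖ξ‖ ^ 2)⁻¹ * (exp (-(4⁻¹ * ‖ξ‖ ^ 2 * ((n : ℝ) + 1)⁻¹)) -
      exp (-(4⁻¹ * ‖ξ‖ ^ 2 * ((n : ℝ) + 1)))))) with hmdef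
  have hne : ∀ᵐ ξ : ℂ, ξ ≠ 0 :=
    compl_mem_ae_iff.2 (measure_singleton (μ := (volume : Measure ℂ)) 0)
  have h1 : ∀ n, ∫⁻ ξ : ℂ, ENNReal.ofReal (m n ξ) =
      ENNReal.ofReal (quadDiff (fun p : ℂ × ℂ => truncLog n (‖p.1 - p.2‖ ^ 2)) α β) := by
    intro n
    rw [quadDiff_truncLog_lintegral α β hm n]
    apply lintegral_congr_ae
    filter_upwards [hne] with ξ hξ
    rw [(integral_heat n (A := 4⁻¹ * ‖ξ‖ ^ 2) (by positivity)).2]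
  have hT : Tendsto (fun n : ℕ => (n : ℝ) + 1) atTop atTop :=
    tendsto_atTop_add_const_right _ _ tendsto_natCast_atTop_atTop
  -- The truncated weights converge pointwise to `(2 π ‖ξ‖²)⁻¹` for `ξ ≠ 0`. Only the inequality of
  -- Fatou's lemma is needed.
  calc _ ≤ ∫⁻ ξ : ℂ, liminf (fun n => ENNReal.ofReal (m n ξ)) atTop := by
        apply lintegral_mono_ae
        filter_upwards [hne] with ξ hξ
        have hA : 0 < 4⁻¹ * ‖ξ‖ ^ 2 := by positivity
        have t1 : Tendsto (fun n : ℕ => exp (-(4⁻¹ * ‖ξ‖ ^ 2 * ((n : ℝ) + 1)⁻¹))) atTop (𝓝 1) := by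
          have := ((tendsto_inv_atTop_zero.comp hT).const_mul (4⁻¹ * ‖ξ‖ ^ 2)).neg
          simpa [Function.comp_def] using (continuous_exp.tendsto _).comp this
        have t2 : Tendsto (fun n : ℕ => exp (-(4⁻¹ * ‖ξ‖ ^ 2 * ((n : ℝ) + 1)))) atTop (𝓝 0) :=
          tendsto_exp_neg_atTop_nhds_zero.comp (hT.const_mul_atTop hA)
        have t3 : Tendsto (fun n => m n ξ) atTop
            (𝓝 (‖charFun α ξ - charFun β ξ‖ ^ 2 * (2 * π * ‖ξ‖ ^ 2)⁻¹)) := by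
          convert (((t1.sub t2).const_mul ((4⁻¹ * ‖ξ‖ ^ 2)⁻¹)).const_mul ((8 * π)⁻¹)).const_mul
            (‖charFun α ξ - charFun β ξ‖ ^ 2) using 2
          have : ‖ξ‖ ≠ 0 := norm_ne_zero_iff.2 hξ
          field_simp
          ring
        exact ((ENNReal.continuous_ofReal.tendsto _).comp t3).liminf_eq.ge
    _ ≤ liminf (fun n => ∫⁻ ξ : ℂ, ENNReal.ofReal (m n ξ)) atTop := by
        apply lintegral_liminf_le
        intro n
        exact (hmeas.mul (by fun_prop)).ennreal_ofReal
    _ = ENNReal.ofReal (quadDiff planeLog α β) := by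
        simp_rw [h1]
        exact ((ENNReal.continuous_ofReal.tendsto _).comp
          (tendsto_quadDiff_truncLog hα hαβ hβ)).liminf_eq

end CurveGas
end

/-! ### Duality between logarithmic energy and Dirichlet integral -/

noncomputable section
namespace CurveGas
open Filter Topology Real
open scoped FourierTransform LineDeriv

/-- Fourier inversion followed by Fubini. The dilation by `2 π` reconciles the normalisation of `𝓕`
with that of `charFun`. -/
lemma integral_eq_fourier (f : SchwartzMap ℂ ℂ) (α : Measure ℂ) [IsFiniteMeasure α] :
    Integrable (fun w => 𝓕 f w * charFun α ((2 * π) • w)) ∧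
    ∫ z, f z ∂α = ∫ w, 𝓕 f w * charFun α ((2 * π) • w) := by
  have hint : Integrable (fun q : ℂ × ℂ => Complex.exp ((2 * π * inner ℝ q.2 q.1 : ℝ) * Complex.I) *
      𝓕 f q.2) (α.prod volume) := by
    have h1 : Integrable (fun q : ℂ × ℂ => 𝓕 f q.2) (α.prod volume) :=
      ((𝓕 f).integrable (μ := volume)).comp_snd α
    refine h1.norm.mono' ?_ ?_
    · have : Continuous fun q : ℂ × ℂ => 𝓕 f q.2 := (𝓕 f).continuous.comp continuous_snd
      exact Continuous.aestronglyMeasurable (by fun_prop)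
    · refine .of_forall fun q => ?_
      rw [norm_mul, Complex.norm_exp_ofReal_mul_I, one_mul]
  have e1 : ∀ z, f z = ∫ w, Complex.exp ((2 * π * inner ℝ w z : ℝ) * Complex.I) * 𝓕 f w := by
    intro z
    have : f z = 𝓕⁻ (𝓕 f) z := by rw [FourierTransform.fourierInv_fourier_eq]
    rw [this, SchwartzMap.fourierInv_coe, Real.fourierInv_eq']
    simp only [smul_eq_mul]
  have e2 : ∀ w, ∫ z, Complex.exp ((2 * π * inner ℝ w z : ℝ) * Complex.I) * 𝓕 f w ∂α =
      𝓕 f w * charFun α ((2 * π) • w) := by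
    intro w
    rw [integral_mul_const, charFun_apply, mul_comm]
    congr 2 with z
    rw [real_inner_smul_right, real_inner_comm]
  constructor
  · refine hint.integral_prod_right.congr (.of_forall fun w => e2 w)
  · simp_rw [e1]
    rw [integral_integral_swap hint]
    simp_rw [e2]

/-- Plancherel's identity for the derivative of `f` in the direction `m`, whose transform is `2 π i
⟨w, m⟩` times that of `f`. -/
lemma integral_sq_mul_fourier (f : SchwartzMap ℂ ℂ) (m : ℂ) :
    Integrable (fun w => (inner ℝ w m) ^ 2 * ‖𝓕 f w‖ ^ 2) ∧
    4 * π ^ 2 * ∫ w, (inner ℝ w m) ^ 2 * ‖𝓕 f w‖ ^ 2 = ∫ z, ‖fderiv ℝ f z m‖ ^ 2 := by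
  have h := SchwartzMap.integral_norm_sq_fourier (∂_{m} f)
  have hg : (fun w : ℂ => (inner ℝ w m : ℝ)).HasTemperateGrowth :=
    ((innerSL ℝ).flip m).hasTemperateGrowth
  have e : ∀ w, ‖𝓕 (∂_{m} f) w‖ ^ 2 = 4 * π ^ 2 * ((inner ℝ w m) ^ 2 * ‖𝓕 f w‖ ^ 2) := by
    intro w
    rw [SchwartzMap.fourier_lineDerivOp_eq, smul_apply,
      SchwartzMap.smulLeftCLM_apply_apply hg, norm_smul, norm_smul]
    simp only [norm_mul, Complex.norm_I, Complex.norm_real, RCLike.norm_ofNat, norm_eq_abs,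
      abs_of_pos pi_pos, mul_pow, sq_abs]
    ring
  have hi : Integrable (fun w => ‖𝓕 (∂_{m} f) w‖ ^ 2) :=
    (((𝓕 (∂_{m} f)).memLp 2).integrable_norm_pow (by norm_num))
  constructor
  · have := hi.const_mul (4 * π ^ 2)⁻¹
    refine this.congr (.of_forall fun w => ?_)
    simp only [e w]
    field_simp
  · rw [← integral_const_mul]
    simp_rw [← e]
    rw [h]
    simp_rw [SchwartzMap.lineDerivOp_apply_eq_fderiv]

lemma lintegral_charFun_comp_smul (G : ℂ → ℝ≥0∞) :
    ∫⁻ w, G ((2 * π) • w) = ENNReal.ofReal ((2 * π) ^ 2)⁻¹ * ∫⁻ w, G w := by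
  have hne : (2 * π : ℝ) ≠ 0 := by positivity
  have hme : MeasurableEmbedding fun w : ℂ => (2 * π : ℝ) • w :=
    (Homeomorph.smulOfNeZero (2 * π : ℝ) hne).measurableEmbedding
  rw [← hme.lintegral_map (μ := volume) (fun w => G w), Measure.map_addHaar_smul _ hne]
  simp only [Complex.finrank_real_complex, lintegral_smul_measure, smul_eq_mul]
  rw [abs_of_nonneg (by positivity)]

/-- The logarithmic energy of `α - β` bounds its action on smooth test functions by their
Dirichlet integral. -/
theorem sq_integral_sub_le {α β : Measure ℂ} [IsFiniteMeasure α] [IsFiniteMeasure β]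
    [NullSingletonClass α] [NullSingletonClass β] (hm : α univ = β univ)
    (hα : Integrable planeLog (α.prod α))
    (hαβ : Integrable planeLog (α.prod β)) (hβ : Integrable planeLog (β.prod β))
    {F : ℂ → ℝ} (hF : ContDiff ℝ ∞ F) (hFc : HasCompactSupport F) :
    ((∫ z, F z ∂α) - ∫ z, F z ∂β) ^ 2 ≤
      ((∫ z, (fderiv ℝ F z 1) ^ 2) + ∫ z, (fderiv ℝ F z Complex.I) ^ 2) *
        quadDiff planeLog α β := by
  have hs : ContDiff ℝ ∞ (fun z => (F z : ℂ)) := Complex.ofRealCLM.contDiff.comp hF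
  have hc : HasCompactSupport (fun z => (F z : ℂ)) := hFc.comp_left (g := Complex.ofReal) rfl
  set f : SchwartzMap ℂ ℂ := hc.toSchwartzMap hs with hf
  have hfz : ∀ z, f z = (F z : ℂ) := fun z => rfl
  have hfd : ∀ z m, ‖fderiv ℝ f z m‖ ^ 2 = (fderiv ℝ F z m) ^ 2 := by
    intro z m
    have : HasFDerivAt f (Complex.ofRealCLM.comp (fderiv ℝ F z)) z :=
      Complex.ofRealCLM.hasFDerivAt.comp z
        ((hF.differentiable (by norm_num)) z).hasFDerivAt
    rw [this.fderiv]
    simp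
  obtain ⟨i1, e1⟩ := integral_sq_mul_fourier f 1
  obtain ⟨i2, e2⟩ := integral_sq_mul_fourier f Complex.I
  simp_rw [hfd] at e1 e2
  set E := (∫ z, (fderiv ℝ F z 1) ^ 2) + ∫ z, (fderiv ℝ F z Complex.I) ^ 2 with hE
  have hnorm : ∀ w : ℂ, (inner ℝ w 1) ^ 2 * ‖𝓕 f w‖ ^ 2 +
      (inner ℝ w Complex.I) ^ 2 * ‖𝓕 f w‖ ^ 2 = (‖w‖ * ‖𝓕 f w‖) ^ 2 := by
    intro w
    rw [mul_pow, ← Complex.normSq_eq_norm_sq w, Complex.normSq_apply]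
    simp [Complex.inner]
    ring
  have hA : ∫⁻ w, ENNReal.ofReal ((‖w‖ * ‖𝓕 f w‖) ^ 2) = ENNReal.ofReal ((4 * π ^ 2)⁻¹ * E) := by
    simp_rw [← hnorm]
    rw [← ofReal_integral_eq_lintegral_ofReal (by exact i1.add i2)
      (.of_forall fun w => by positivity), integral_add i1 i2, hE, ← e1, ← e2]
    congr 1
    field_simp
  have hB : ∫⁻ w, ENNReal.ofReal ((‖charFun α ((2 * π) • w) - charFun β ((2 * π) • w)‖ *
      ‖w‖⁻¹) ^ 2) ≤ ENNReal.ofReal (2 * π * quadDiff planeLog α β) := by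
    have h := lintegral_charFun_le hm hα hαβ hβ
    have h2 := lintegral_charFun_comp_smul fun ξ : ℂ =>
      ENNReal.ofReal (‖charFun α ξ - charFun β ξ‖ ^ 2 * (2 * π * ‖ξ‖ ^ 2)⁻¹)
    have e3 : ∀ w : ℂ, ENNReal.ofReal ((‖charFun α ((2 * π) • w) - charFun β ((2 * π) • w)‖ *
        ‖w‖⁻¹) ^ 2) = ENNReal.ofReal (8 * π ^ 3) * ENNReal.ofReal
        (‖charFun α ((2 * π) • w) - charFun β ((2 * π) • w)‖ ^ 2 *
          (2 * π * ‖(2 * π) • w‖ ^ 2)⁻¹) := by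
      intro w
      rw [← ENNReal.ofReal_mul (by positivity)]
      congr 1
      rw [norm_smul, Real.norm_eq_abs, abs_of_pos (by positivity : 0 < 2 * π)]
      rcases eq_or_ne w 0 with rfl | hw
      · simp
      · have : ‖w‖ ≠ 0 := norm_ne_zero_iff.2 hw
        field_simp
        ring
    simp_rw [e3]
    rw [lintegral_const_mul' _ _ ENNReal.ofReal_ne_top, h2, ← mul_assoc,
      ← ENNReal.ofReal_mul (by positivity)]
    refine (mul_le_mul_right h _).trans ?_
    rw [← ENNReal.ofReal_mul (by positivity)]
    apply ENNReal.ofReal_le_ofReal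
    apply le_of_eq
    field_simp
    ring
  obtain ⟨j1, g1⟩ := integral_eq_fourier f α
  obtain ⟨j2, g2⟩ := integral_eq_fourier f β
  have hdiff : (((∫ z, F z ∂α) - ∫ z, F z ∂β : ℝ) : ℂ) =
      ∫ w, 𝓕 f w * (charFun α ((2 * π) • w) - charFun β ((2 * π) • w)) := by
    simp_rw [mul_sub]
    rw [integral_sub j1 j2, ← g1, ← g2]
    simp_rw [hfz]
    rw [integral_complex_ofReal, integral_complex_ofReal]
    push_cast
    ring
  have hmeas : Measurable fun w : ℂ => ‖charFun α ((2 * π) • w) - charFun β ((2 * π) • w)‖ :=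
    (((stronglyMeasurable_charFun.measurable.comp (measurable_const_smul (2 * π)))).sub
      (stronglyMeasurable_charFun.measurable.comp (measurable_const_smul (2 * π)))).norm
  -- Cauchy–Schwarz after splitting `1 = ‖w‖ · ‖w‖⁻¹`: one factor becomes the Dirichlet integral of
  -- `F`, the other the Fourier form of the energy.
  have hcs : ENNReal.ofReal |(∫ z, F z ∂α) - ∫ z, F z ∂β| ≤
      (ENNReal.ofReal ((4 * π ^ 2)⁻¹ * E)) ^ (1 / 2 : ℝ) *
      (ENNReal.ofReal (2 * π * quadDiff planeLog α β)) ^ (1 / 2 : ℝ) := by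
    have : ENNReal.ofReal |(∫ z, F z ∂α) - ∫ z, F z ∂β| =
        ‖∫ w, 𝓕 f w * (charFun α ((2 * π) • w) - charFun β ((2 * π) • w))‖ₑ := by
      rw [← hdiff, ← ofReal_norm, Complex.norm_real, Real.norm_eq_abs]
    rw [this]
    refine (enorm_integral_le_lintegral_enorm _).trans ?_
    calc _ = ∫⁻ w, ((fun w : ℂ => ENNReal.ofReal (‖w‖ * ‖𝓕 f w‖)) * fun w =>
          ENNReal.ofReal (‖charFun α ((2 * π) • w) - charFun β ((2 * π) • w)‖ * ‖w‖⁻¹)) w := by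
          apply lintegral_congr_ae
          have hne : ∀ᵐ ξ : ℂ, ξ ≠ 0 :=
            compl_mem_ae_iff.2 (measure_singleton (μ := (volume : Measure ℂ)) 0)
          filter_upwards [hne] with w hw
          have : ‖w‖ ≠ 0 := norm_ne_zero_iff.2 hw
          rw [Pi.mul_apply, ← ENNReal.ofReal_mul (by positivity), ← ofReal_norm, norm_mul]
          congr 1
          field_simp
      _ ≤ _ := ENNReal.lintegral_mul_le_Lp_mul_Lq _ Real.HolderConjugate.two_two
          (((continuous_norm.mul (𝓕 f).continuous.norm).measurable).ennreal_ofReal.aemeasurable)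
          ((hmeas.mul (by fun_prop)).ennreal_ofReal.aemeasurable)
      _ ≤ _ := by
          have c1 : ∀ w : ℂ, ENNReal.ofReal (‖w‖ * ‖𝓕 f w‖) ^ (2 : ℝ) =
              ENNReal.ofReal ((‖w‖ * ‖𝓕 f w‖) ^ 2) := by
            intro w
            rw [ENNReal.ofReal_pow (by positivity)]
            norm_cast
          have c2 : ∀ w : ℂ, ENNReal.ofReal (‖charFun α ((2 * π) • w) -
              charFun β ((2 * π) • w)‖ * ‖w‖⁻¹) ^ (2 : ℝ) =
              ENNReal.ofReal ((‖charFun α ((2 * π) • w) -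
              charFun β ((2 * π) • w)‖ * ‖w‖⁻¹) ^ 2) := by
            intro w
            rw [ENNReal.ofReal_pow (by positivity)]
            norm_cast
          simp_rw [c1, c2, hA]
          gcongr
  have hE0 : 0 ≤ E := by positivity
  have hQ0 := quadDiff_planeLog_nonneg hm hα hαβ hβ
  rw [ENNReal.ofReal_rpow_of_nonneg (by positivity) (by norm_num),
    ENNReal.ofReal_rpow_of_nonneg (by positivity) (by norm_num),
    ← ENNReal.ofReal_mul (by positivity),
    ENNReal.ofReal_le_ofReal_iff (by positivity), ← Real.mul_rpow (by positivity) (by positivity),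
    ← Real.sqrt_eq_rpow] at hcs
  have h3 := (pow_le_pow_left₀ (abs_nonneg _) hcs 2).trans_eq (Real.sq_sqrt (by positivity))
  rw [sq_abs] at h3
  refine h3.trans ?_
  have : (4 * π ^ 2)⁻¹ * E * (2 * π * quadDiff planeLog α β) =
      (2 * π)⁻¹ * (E * quadDiff planeLog α β) := by
    field_simp
    ring
  rw [this]
  -- The argument yields the constant `1 / (2 π)`; it is rounded up to `1`.
  have h4 : (2 * π)⁻¹ ≤ 1 := inv_le_one_of_one_le₀ (by linarith [Real.pi_gt_three])
  exact mul_le_of_le_one_left (by positivity) h4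

end CurveGas
end

noncomputable section
namespace CurveGas
open Filter Topology Real
open scoped NNReal Convolution

/-! ### Smoothing of Lipschitz functions on the plane -/

/-- Convolution with a bump of radius `ε ≤ 1` averages translates of `F`: the Lipschitz constant is
kept, values move by at most `L ε`, and the support grows by at most `1`. -/
lemma exists_smooth_approx {F : ℂ → ℝ} {L : ℝ≥0} (hF : LipschitzWith L F) {ρ : ℝ}
    (hρ : ∀ z, ρ ≤ ‖z‖ → F z = 0) {ε : ℝ} (hε : 0 < ε) (hε1 : ε ≤ 1) :
    ∃ G : ℂ → ℝ, ContDiff ℝ ∞ G ∧ HasCompactSupport G ∧ (∀ z, ρ + 1 ≤ ‖z‖ → G z = 0) ∧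
      LipschitzWith L G ∧ ∀ z, |G z - F z| ≤ L * ε := by
  let φ : ContDiffBump (0 : ℂ) := ⟨ε / 2, ε, by positivity, by linarith⟩
  have hzero : ∀ z, ρ + 1 ≤ ‖z‖ →
      (φ.normed volume ⋆[ContinuousLinearMap.lsmul ℝ ℝ, volume] F) z = 0 := by
    intro z hz
    rw [φ.normed_convolution_eq_right, hρ z (by linarith)]
    intro x hx
    rw [hρ z (by linarith), hρ x]
    have h1 : ‖z‖ ≤ ‖x‖ + ‖z - x‖ := by
      calc ‖z‖ = ‖x + (z - x)‖ := by ring_nf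
        _ ≤ _ := norm_add_le _ _
    rw [Metric.mem_ball, dist_eq_norm, norm_sub_rev] at hx
    have : φ.rOut = ε := rfl
    linarith
  have hcs : HasCompactSupport F := by
    refine HasCompactSupport.intro (isCompact_closedBall (0 : ℂ) ρ) fun z hz => hρ z ?_
    simp only [Metric.mem_closedBall, dist_zero_right, not_le] at hz
    exact hz.le
  have hex : ∀ z, Integrable (fun t => φ.normed volume t * F (z - t)) := by
    intro z
    have hc : Continuous fun t => φ.normed volume t * F (z - t) :=
      φ.continuous_normed.mul (hF.continuous.comp (by fun_prop))
    exact hc.integrable_of_hasCompactSupport φ.hasCompactSupport_normed.mul_right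
  refine ⟨φ.normed volume ⋆[ContinuousLinearMap.lsmul ℝ ℝ, volume] F, ?_, ?_, hzero, ?_, ?_⟩
  · exact φ.hasCompactSupport_normed.contDiff_convolution_left _ φ.contDiff_normed
      hF.continuous.locallyIntegrable
  · exact φ.hasCompactSupport_normed.convolution _ hcs
  · refine LipschitzWith.of_dist_le_mul fun z w => ?_
    rw [dist_eq_norm, convolution_def, convolution_def]
    simp only [ContinuousLinearMap.lsmul_apply, smul_eq_mul]
    rw [← integral_sub (hex z) (hex w)]
    calc _ ≤ ∫ t, φ.normed volume t * (L * dist z w) := by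
          apply norm_integral_le_of_norm_le (φ.integrable_normed.mul_const _)
          refine .of_forall fun t => ?_
          rw [← mul_sub, norm_mul, Real.norm_of_nonneg (φ.nonneg_normed t)]
          gcongr
          · exact φ.nonneg_normed t
          · have := hF.dist_le_mul (z - t) (w - t)
            rwa [dist_sub_right, dist_eq_norm] at this
      _ = L * dist z w := by rw [integral_mul_const, φ.integral_normed, one_mul]
  · intro z
    have := φ.dist_normed_convolution_le (μ := volume) (g := F) (x₀ := z) (ε := L * ε)
      hF.continuous.aestronglyMeasurable (by
        intro x hx
        refine (hF.dist_le_mul x z).trans ?_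
        have : φ.rOut = ε := rfl
        rw [Metric.mem_ball] at hx
        gcongr)
    rwa [Real.dist_eq] at this

lemma integral_fderiv_sq_le {G : ℂ → ℝ} {L : ℝ≥0} (hG : LipschitzWith L G) {ρ : ℝ}
    (hρ : ∀ z, ρ ≤ ‖z‖ → G z = 0) {m : ℂ} (hm : ‖m‖ = 1) :
    ∫ z, (fderiv ℝ G z m) ^ 2 ≤ (L : ℝ) ^ 2 * volume.real (Metric.closedBall (0 : ℂ) ρ) := by
  have h1 : ∀ z, (fderiv ℝ G z m) ^ 2 ≤
      (Metric.closedBall (0 : ℂ) ρ).indicator (fun _ => (L : ℝ) ^ 2) z := by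
    intro z
    by_cases hz : z ∈ Metric.closedBall (0 : ℂ) ρ
    · rw [indicator_of_mem hz, ← sq_abs]
      have : |fderiv ℝ G z m| ≤ L := by
        calc |fderiv ℝ G z m| ≤ ‖fderiv ℝ G z‖ * ‖m‖ := (fderiv ℝ G z).le_opNorm m
          _ ≤ L * 1 := by
            rw [hm]
            gcongr
            exact norm_fderiv_le_of_lipschitz ℝ hG
          _ = L := mul_one _
      gcongr
    · rw [indicator_of_notMem hz]
      have hz' : ρ < ‖z‖ := by simpa using hz
      have : G =ᶠ[𝓝 z] fun _ => 0 := by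
        filter_upwards [continuous_norm.continuousAt.eventually (lt_mem_nhds hz')] with w hw
        exact hρ w hw.le
      rw [this.fderiv_eq]
      simp
  calc _ ≤ ∫ z, (Metric.closedBall (0 : ℂ) ρ).indicator (fun _ => (L : ℝ) ^ 2) z := by
        apply integral_mono_of_nonneg (.of_forall fun z => by positivity) _ (.of_forall h1)
        rw [integrable_indicator_iff Metric.isClosed_closedBall.measurableSet]
        exact integrableOn_const (isCompact_closedBall (0 : ℂ) ρ).measure_lt_top.ne
    _ = _ := by
        rw [integral_indicator Metric.isClosed_closedBall.measurableSet, setIntegral_const,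
          smul_eq_mul, mul_comm]

/-- The smooth case applied to mollifications, with `ε → 0`. The factor `2` counts the two
coordinate directions, and the radius `ρ + 1` holds the support of every mollification. -/
lemma abs_integral_sub_le_of_lipschitz {α β : Measure ℂ} [IsProbabilityMeasure α]
    [IsProbabilityMeasure β] [NullSingletonClass α] [NullSingletonClass β]
    (hα : Integrable planeLog (α.prod α))
    (hαβ : Integrable planeLog (α.prod β)) (hβ : Integrable planeLog (β.prod β))
    {F : ℂ → ℝ} {L : ℝ≥0} (hF : LipschitzWith L F) {ρ : ℝ} (hρ : ∀ z, ρ ≤ ‖z‖ → F z = 0) :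
    |(∫ z, F z ∂α) - ∫ z, F z ∂β| ≤
      √(2 * L ^ 2 * volume.real (Metric.closedBall (0 : ℂ) (ρ + 1)) *
        quadDiff planeLog α β) := by
  have hQ0 := quadDiff_planeLog_nonneg (by simp) hα hαβ hβ
  have key : ∀ ε : ℝ, 0 < ε → ε ≤ 1 → |(∫ z, F z ∂α) - ∫ z, F z ∂β| ≤
      √(2 * L ^ 2 * volume.real (Metric.closedBall (0 : ℂ) (ρ + 1)) *
        quadDiff planeLog α β) + 2 * L * ε := by
    intro ε hε hε1
    obtain ⟨G, hGs, hGc, hG0, hGL, hGF⟩ := exists_smooth_approx hF hρ hε hε1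
    have hFc : HasCompactSupport F := by
      refine HasCompactSupport.intro (isCompact_closedBall (0 : ℂ) ρ) fun z hz => hρ z ?_
      simp only [Metric.mem_closedBall, dist_zero_right, not_le] at hz
      exact hz.le
    have hd : ∀ (ν : Measure ℂ) [IsProbabilityMeasure ν],
        |(∫ z, F z ∂ν) - ∫ z, G z ∂ν| ≤ L * ε := by
      intro ν _
      rw [← integral_sub (hF.continuous.integrable_of_hasCompactSupport hFc)
        (hGL.continuous.integrable_of_hasCompactSupport hGc)]
      have := norm_integral_le_of_norm_le_const (μ := ν) (f := fun z => F z - G z) (C := L * ε)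
        (.of_forall fun z => by rw [Real.norm_eq_abs, abs_sub_comm]; exact hGF z)
      simpa using this
    have h1 := sq_integral_sub_le (by simp) hα hαβ hβ hGs hGc
    have h2 : |(∫ z, G z ∂α) - ∫ z, G z ∂β| ≤
        √(2 * L ^ 2 * volume.real (Metric.closedBall (0 : ℂ) (ρ + 1)) *
        quadDiff planeLog α β) := by
      apply Real.abs_le_sqrt
      refine h1.trans ?_
      have a1 := integral_fderiv_sq_le hGL hG0 (m := 1) (by simp)
      have a2 := integral_fderiv_sq_le hGL hG0 (m := Complex.I) (by simp)
      apply mul_le_mul_of_nonneg_right _ hQ0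
      linarith
    have h3 := hd α
    have h4 := hd β
    have : (∫ z, F z ∂α) - ∫ z, F z ∂β = ((∫ z, F z ∂α) - ∫ z, G z ∂α) +
      ((∫ z, G z ∂α) - ∫ z, G z ∂β) - ((∫ z, F z ∂β) - ∫ z, G z ∂β) := by ring
    rw [this]
    refine (abs_sub _ _).trans ?_
    refine (add_le_add_left (abs_add_le _ _) _).trans ?_
    linarith
  have hlim : Tendsto (fun n : ℕ => √(2 * L ^ 2 *
      volume.real (Metric.closedBall (0 : ℂ) (ρ + 1)) *
        quadDiff planeLog α β) + 2 * L * (1 / ((n : ℝ) + 1))) atTop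
      (𝓝 (√(2 * L ^ 2 * volume.real (Metric.closedBall (0 : ℂ) (ρ + 1)) *
        quadDiff planeLog α β) + 2 * L * 0)) :=
    (tendsto_one_div_add_atTop_nhds_zero_nat.const_mul _).const_add _
  rw [mul_zero, add_zero] at hlim
  refine ge_of_tendsto' hlim fun n => key _ (by positivity) ?_
  rw [div_le_one (by positivity)]
  simp

/-! ### Transfer to curves -/

/-- The logarithmic kernel of a curve, with real values. -/
def curveLog (γ : ℝ → ℂ) (p : ℝ × ℝ) : ℝ := -log ‖γ p.1 - γ p.2‖

lemma measurable_curveLog {γ : ℝ → ℂ} (hγ : Measurable γ) : Measurable (curveLog γ) := by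
  unfold curveLog
  fun_prop

lemma integrable_planeLog_map {γ : ℝ → ℂ} (hγ : Measurable γ) (α β : Measure ℝ)
    [IsFiniteMeasure α] [IsFiniteMeasure β] :
    Integrable planeLog ((α.map γ).prod (β.map γ)) ↔ Integrable (curveLog γ) (α.prod β) := by
  rw [Measure.map_prod_map α β hγ hγ, integrable_map_measure
    measurable_planeLog.aestronglyMeasurable (by fun_prop)]
  rfl

lemma quadDiff_planeLog_map {γ : ℝ → ℂ} (hγ : Measurable γ) (α β : Measure ℝ)
    [IsFiniteMeasure α] [IsFiniteMeasure β] :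
    quadDiff planeLog (α.map γ) (β.map γ) = quadDiff (curveLog γ) α β := by
  have : ∀ (α β : Measure ℝ) [IsFiniteMeasure α] [IsFiniteMeasure β],
      ∫ p, planeLog p ∂((α.map γ).prod (β.map γ)) = ∫ p, curveLog γ p ∂(α.prod β) := by
    intro α β _ _
    rw [Measure.map_prod_map α β hγ hγ, integral_map (by fun_prop)
      measurable_planeLog.aestronglyMeasurable]
    rfl
  rw [quadDiff, quadDiff, this, this, this]

lemma nullSingletonClass_map {γ : ℝ → ℂ} (hγ : Measurable γ) {s : Set ℝ} (hinj : InjOn γ s)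
    {α : Measure ℝ} [NullSingletonClass α] (hs : ∀ᵐ x ∂α, x ∈ s) :
    NullSingletonClass (α.map γ) := by
  refine ⟨fun z => ?_⟩
  rw [Measure.map_apply hγ (measurableSet_singleton z)]
  have hsub : (γ ⁻¹' {z} ∩ s).Subsingleton := by
    intro x hx y hy
    exact hinj hx.2 hy.2 (hx.1.trans hy.1.symm)
  have h0 : α (γ ⁻¹' {z} ∩ s) = 0 := hsub.measure_zero α
  rw [← h0]
  exact measure_congr (by
    filter_upwards [hs] with x hx
    simp only [eq_iff_iff]
    exact ⟨fun h => ⟨h, hx⟩, fun h => h.1⟩)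

lemma integrable_curveLog_cross {γ : ℝ → ℂ} (hγ : Measurable γ) {s : Set ℝ} (hinj : InjOn γ s)
    {R : ℝ} (hR : ∀ x ∈ s, ‖γ x‖ ≤ R) {α β : Measure ℝ} [IsProbabilityMeasure α]
    [IsProbabilityMeasure β] [NullSingletonClass α] [NullSingletonClass β]
    (hsα : ∀ᵐ x ∂α, x ∈ s) (hsβ : ∀ᵐ x ∂β, x ∈ s)
    (hα : Integrable (curveLog γ) (α.prod α)) (hβ : Integrable (curveLog γ) (β.prod β)) :
    Integrable (curveLog γ) (α.prod β) := by
  have := nullSingletonClass_map hγ hinj hsα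
  have := nullSingletonClass_map hγ hinj hsβ
  have := Measure.isProbabilityMeasure_map (μ := α) hγ.aemeasurable
  have := Measure.isProbabilityMeasure_map (μ := β) hγ.aemeasurable
  have hm : MeasurableSet {z : ℂ | ‖z‖ ≤ R} := measurableSet_le (by fun_prop) (by fun_prop)
  rw [← integrable_planeLog_map hγ] at hα hβ ⊢
  refine integrable_planeLog_cross (R := R) (by simp) ?_ ?_ hα hβ
  · rw [ae_map_iff hγ.aemeasurable hm]
    filter_upwards [hsα] with x hx using hR x hx
  · rw [ae_map_iff hγ.aemeasurable hm]
    filter_upwards [hsβ] with x hx using hR x hx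

lemma quadDiff_curveLog_nonneg {γ : ℝ → ℂ} (hγ : Measurable γ) {s : Set ℝ} (hinj : InjOn γ s)
    {α β : Measure ℝ} [IsProbabilityMeasure α]
    [IsProbabilityMeasure β] [NullSingletonClass α] [NullSingletonClass β]
    (hsα : ∀ᵐ x ∂α, x ∈ s) (hsβ : ∀ᵐ x ∂β, x ∈ s)
    (hα : Integrable (curveLog γ) (α.prod α)) (hαβ : Integrable (curveLog γ) (α.prod β))
    (hβ : Integrable (curveLog γ) (β.prod β)) :
    0 ≤ quadDiff (curveLog γ) α β := by
  have := nullSingletonClass_map hγ hinj hsα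
  have := nullSingletonClass_map hγ hinj hsβ
  have := Measure.isProbabilityMeasure_map (μ := α) hγ.aemeasurable
  have := Measure.isProbabilityMeasure_map (μ := β) hγ.aemeasurable
  rw [← integrable_planeLog_map hγ] at hα hβ hαβ
  rw [← quadDiff_planeLog_map hγ]
  exact quadDiff_planeLog_nonneg (by simp) hα hαβ hβ

/-- Lipschitz functions of the parameter of a curve are controlled by the logarithmic distance,
with a constant depending only on the lower Lipschitz constant and the diameter of the curve. -/
theorem exists_abs_integral_sub_le (a b : ℝ) {c R : ℝ} (hc : 0 < c) :
    ∃ C : ℝ, 0 < C ∧ ∀ γ : ℝ → ℂ, Measurable γ → (∀ x ∈ Icc a b, ‖γ x‖ ≤ R) →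
      (∀ x ∈ Icc a b, ∀ y ∈ Icc a b, c * |x - y| ≤ ‖γ x - γ y‖) →
      ∀ (α β : Measure ℝ) [IsProbabilityMeasure α] [IsProbabilityMeasure β]
        [NullSingletonClass α] [NullSingletonClass β],
      (∀ᵐ x ∂α, x ∈ Icc a b) → (∀ᵐ x ∂β, x ∈ Icc a b) →
      Integrable (curveLog γ) (α.prod α) → Integrable (curveLog γ) (α.prod β) →
      Integrable (curveLog γ) (β.prod β) →
      ∀ (f : ℝ → ℝ) (M : ℝ), 0 ≤ M → (∀ x ∈ Icc a b, |f x| ≤ M) →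
        (∀ x ∈ Icc a b, ∀ y ∈ Icc a b, |f x - f y| ≤ M * |x - y|) →
        |(∫ x, f x ∂α) - ∫ x, f x ∂β| ≤ C * M * √(quadDiff (curveLog γ) α β) := by
  set V := volume.real (Metric.closedBall (0 : ℂ) (R + 1 + 1)) with hV
  refine ⟨√(2 * V) * (c⁻¹ + 1) + 1, by positivity, ?_⟩
  intro γ hγ hR hlow α β _ _ _ _ hsα hsβ hα hαβ hβ f M hM hfM hfL
  have hinj : InjOn γ (Icc a b) := by
    intro x hx y hy hxy
    have := hlow x hx y hy
    rw [hxy, sub_self, norm_zero] at this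
    have h2 : |x - y| ≤ 0 := by
      by_contra h
      push Not at h
      have := mul_pos hc h
      linarith
    have := abs_nonpos_iff.1 h2
    linarith
  have hQ0 := quadDiff_curveLog_nonneg hγ hinj hsα hsβ hα hαβ hβ
  have := nullSingletonClass_map hγ hinj hsα
  have := nullSingletonClass_map hγ hinj hsβ
  have := Measure.isProbabilityMeasure_map (μ := α) hγ.aemeasurable
  have := Measure.isProbabilityMeasure_map (μ := β) hγ.aemeasurable
  set S := γ '' Icc a b
  -- `f` is transplanted to the curve, where the lower chord bound makes it Lipschitz. It is then
  -- extended to the plane, clipped to `[-M, M]` (`F1`) and multiplied by a cutoff equal to `1` on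
  -- the disc of radius `R` (`F`).
  set f0 : ℂ → ℝ := fun z => f (Function.invFunOn γ (Icc a b) z)
  have hf0 : ∀ x ∈ Icc a b, f0 (γ x) = f x := fun x hx => by
    simp only [f0, hinj.leftInvOn_invFunOn hx]
  have hf0L : LipschitzOnWith (Real.toNNReal (M * c⁻¹)) f0 S := by
    apply LipschitzOnWith.of_dist_le_mul
    rintro _ ⟨x, hx, rfl⟩ _ ⟨y, hy, rfl⟩
    rw [hf0 x hx, hf0 y hy, Real.dist_eq, dist_eq_norm, Real.coe_toNNReal _ (by positivity)]
    refine (hfL x hx y hy).trans ?_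
    rw [mul_assoc]
    gcongr
    rw [← div_eq_inv_mul, le_div_iff₀ hc, mul_comm]
    exact hlow x hx y hy
  obtain ⟨F0, hF0L, hF0⟩ := hf0L.extend_real
  set F1 : ℂ → ℝ := fun z => max (-M) (min M (F0 z))
  have hF1b : ∀ z, |F1 z| ≤ M := fun z => by
    rw [abs_le]
    exact ⟨le_max_left _ _, max_le (by linarith) (min_le_left _ _)⟩
  have hF1L : LipschitzWith (Real.toNNReal (M * c⁻¹)) F1 := (hF0L.const_min M).const_max (-M)
  set χ : ℂ → ℝ := fun z => max 0 (min 1 (R + 1 - ‖z‖))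
  have hχL : LipschitzWith 1 χ := by
    have : LipschitzWith 1 fun z : ℂ => R + 1 - ‖z‖ := by
      apply LipschitzWith.of_dist_le_mul
      intro z w
      rw [Real.dist_eq, dist_eq_norm, NNReal.coe_one, one_mul]
      have e : R + 1 - ‖z‖ - (R + 1 - ‖w‖) = -(‖z‖ - ‖w‖) := by ring
      rw [e, abs_neg]
      exact abs_norm_sub_norm_le z w
    exact (this.const_min 1).const_max 0
  have hχ0 : ∀ z, 0 ≤ χ z := fun z => le_max_left _ _
  have hχ1 : ∀ z, χ z ≤ 1 := fun z => max_le (by norm_num) (min_le_left _ _)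
  set F : ℂ → ℝ := fun z => χ z * F1 z
  have hFL : LipschitzWith (Real.toNNReal (M * c⁻¹ + M)) F := by
    apply LipschitzWith.of_dist_le_mul
    intro z w
    rw [Real.coe_toNNReal _ (by positivity), Real.dist_eq]
    have e : F z - F w = χ z * (F1 z - F1 w) + (χ z - χ w) * F1 w := by
      simp only [F]
      ring
    have h1 := hF1L.dist_le_mul z w
    have h2 := hχL.dist_le_mul z w
    rw [Real.coe_toNNReal _ (by positivity), Real.dist_eq] at h1
    rw [NNReal.coe_one, one_mul, Real.dist_eq] at h2
    rw [e]
    refine (abs_add_le _ _).trans ?_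
    rw [abs_mul, abs_mul, abs_of_nonneg (hχ0 z)]
    have h3 : χ z * |F1 z - F1 w| ≤ 1 * (M * c⁻¹ * dist z w) := by
      gcongr
      exact hχ1 z
    have h4 : |χ z - χ w| * |F1 w| ≤ dist z w * M := by
      gcongr
      exact hF1b w
    linarith
  have hFz : ∀ z, R + 1 ≤ ‖z‖ → F z = 0 := by
    intro z hz
    have : χ z = 0 := max_eq_left ((min_le_right _ _).trans (by linarith))
    simp [F, this]
  have hFf : ∀ x ∈ Icc a b, F (γ x) = f x := by
    intro x hx
    have h1 : χ (γ x) = 1 := by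
      have : min 1 (R + 1 - ‖γ x‖) = 1 := min_eq_left (by linarith [hR x hx])
      simp [χ, this]
    have h2 : F0 (γ x) = f x := by rw [← hF0 ⟨x, hx, rfl⟩, hf0 x hx]
    have h3 := abs_le.1 (hfM x hx)
    simp only [F, F1, h1, h2, one_mul]
    rw [min_eq_right h3.2, max_eq_right h3.1]
  have hmain := abs_integral_sub_le_of_lipschitz (α := α.map γ) (β := β.map γ)
    ((integrable_planeLog_map hγ _ _).2 hα) ((integrable_planeLog_map hγ _ _).2 hαβ)
    ((integrable_planeLog_map hγ _ _).2 hβ) hFL hFz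
  rw [quadDiff_planeLog_map hγ, integral_map hγ.aemeasurable
    hFL.continuous.aestronglyMeasurable, integral_map hγ.aemeasurable
    hFL.continuous.aestronglyMeasurable] at hmain
  have e1 : ∫ x, F (γ x) ∂α = ∫ x, f x ∂α :=
    integral_congr_ae (by filter_upwards [hsα] with x hx using hFf x hx)
  have e2 : ∫ x, F (γ x) ∂β = ∫ x, f x ∂β :=
    integral_congr_ae (by filter_upwards [hsβ] with x hx using hFf x hx)
  rw [e1, e2, Real.coe_toNNReal _ (by positivity), ← hV] at hmain
  refine hmain.trans ?_
  have e3 : 2 * (M * c⁻¹ + M) ^ 2 * V = (2 * V) * ((c⁻¹ + 1) * M) ^ 2 := by ring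
  rw [e3, Real.sqrt_mul (by positivity), Real.sqrt_mul (by positivity), Real.sqrt_sq (by positivity)]
  apply mul_le_mul_of_nonneg_right _ (Real.sqrt_nonneg _)
  linarith

end CurveGas
end

noncomputable section
namespace CurveGas
open Filter Topology Real

/-! ### Chords of a curve -/

/-- The logarithmic kernel of the line. -/
def lineLog (p : ℝ × ℝ) : ℝ := -log |p.1 - p.2|

/-- The logarithm of the ratio between chord and parameter increment. -/
def chordLog (γ : ℝ → ℂ) (p : ℝ × ℝ) : ℝ := log ‖γ p.1 - γ p.2‖ - log |p.1 - p.2|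

lemma curveLog_eq (γ : ℝ → ℂ) (p : ℝ × ℝ) : curveLog γ p = lineLog p - chordLog γ p := by
  simp only [curveLog, lineLog, chordLog]
  ring

/-- Quantitative regularity of a curve on `[a, b]`: bounds on the curve, on its chords and on the
oscillation of the chords. -/
structure IsRegularCurve (a b c Λ R : ℝ) (γ : ℝ → ℂ) : Prop where
  continuous : Continuous γ
  bound : ∀ x ∈ Icc a b, ‖γ x‖ ≤ R
  lower : ∀ x ∈ Icc a b, ∀ y ∈ Icc a b, c * |x - y| ≤ ‖γ x - γ y‖
  upper : ∀ x ∈ Icc a b, ∀ y ∈ Icc a b, ‖γ x - γ y‖ ≤ c⁻¹ * |x - y|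
  chord : ∀ x ∈ Icc a b, ∀ y ∈ Icc a b, ∀ x' ∈ Icc a b, ∀ y' ∈ Icc a b, x ≠ y → x' ≠ y' →
    |chordLog γ (x, y) - chordLog γ (x', y')| ≤ Λ * (|x - x'| + |y - y'|)

lemma chordLog_eq_log {γ : ℝ → ℂ} {x y : ℝ} (hxy : x ≠ y) (hγ : γ x ≠ γ y) :
    chordLog γ (x, y) = log ‖(γ x - γ y) / ((x - y : ℝ) : ℂ)‖ := by
  rw [chordLog, norm_div, log_div, Complex.norm_real, Real.norm_eq_abs]
  · exact norm_ne_zero_iff.2 (sub_ne_zero.2 hγ)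
  · exact norm_ne_zero_iff.2 (by exact_mod_cast sub_ne_zero.2 hxy)

lemma abs_log_sub_log_le {u v c : ℝ} (hc : 0 < c) (hu : c ≤ u) (hv : c ≤ v) :
    |log u - log v| ≤ c⁻¹ * |u - v| := by
  have key : ∀ u v : ℝ, c ≤ u → c ≤ v → log u - log v ≤ c⁻¹ * |u - v| := by
    intro u v hu hv
    have hu0 : 0 < u := hc.trans_le hu
    have hv0 : 0 < v := hc.trans_le hv
    rw [← log_div hu0.ne' hv0.ne']
    calc log (u / v) ≤ u / v - 1 := log_le_sub_one_of_pos (by positivity)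
      _ = v⁻¹ * (u - v) := by field_simp
      _ ≤ v⁻¹ * |u - v| := by
          gcongr
          exact le_abs_self _
      _ ≤ c⁻¹ * |u - v| := by gcongr
  rw [abs_le]
  constructor
  · have := key v u hv hu
    rw [abs_sub_comm] at this
    linarith
  · exact key u v hu hv

section Chords

variable {a b : ℝ} {γ γ₁ : ℝ → ℂ}

/-- The slope `(γ x - γ y) / (x - y)` is the increment of this function of `θ` over `[0, 1]`. The
denominator cancels in the derivative, so the mean value inequality carries bounds on `γ₁` over to
slopes with no loss near the diagonal. -/
lemma hasDerivWithinAt_segment (hγ : ∀ x ∈ Icc a b, HasDerivWithinAt γ (γ₁ x) (Icc a b) x)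
    {x y : ℝ} (hx : x ∈ Icc a b) (hy : y ∈ Icc a b) (hxy : x ≠ y) {θ : ℝ}
    (hθ : θ ∈ Icc (0 : ℝ) 1) :
    HasDerivWithinAt (fun θ : ℝ => γ (y + θ * (x - y)) / ((x - y : ℝ) : ℂ))
      (γ₁ (y + θ * (x - y))) (Icc 0 1) θ := by
  have hmem : ∀ θ ∈ Icc (0 : ℝ) 1, y + θ * (x - y) ∈ Icc a b := by
    intro θ hθ
    have := (convex_Icc a b).add_smul_sub_mem hy hx hθ
    simpa using this
  have h1 : HasDerivWithinAt (fun θ : ℝ => y + θ * (x - y)) (x - y) (Icc 0 1) θ := by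
    simpa using (((hasDerivWithinAt_id θ (Icc 0 1)).mul_const (x - y)).const_add y)
  have h2 := (hγ _ (hmem θ hθ)).scomp θ h1 hmem
  have h3 := h2.div_const ((x - y : ℝ) : ℂ)
  refine h3.congr_deriv ?_
  have : ((x - y : ℝ) : ℂ) ≠ 0 := by exact_mod_cast sub_ne_zero.2 hxy
  rw [Complex.real_smul]
  field_simp

lemma segment_mem {x y θ : ℝ} (hx : x ∈ Icc a b) (hy : y ∈ Icc a b) (hθ : θ ∈ Icc (0 : ℝ) 1) :
    y + θ * (x - y) ∈ Icc a b := by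
  simpa using (convex_Icc a b).add_smul_sub_mem hy hx hθ

/-- Difference quotients are as Lipschitz as the derivative. -/
lemma norm_slope_sub_slope_le (hγ : ∀ x ∈ Icc a b, HasDerivWithinAt γ (γ₁ x) (Icc a b) x) {M : ℝ}
    (hM0 : 0 ≤ M) (hM : ∀ x ∈ Icc a b, ∀ y ∈ Icc a b, ‖γ₁ x - γ₁ y‖ ≤ M * |x - y|)
    {x y x' y' : ℝ} (hx : x ∈ Icc a b) (hy : y ∈ Icc a b) (hx' : x' ∈ Icc a b)
    (hy' : y' ∈ Icc a b) (hxy : x ≠ y) (hxy' : x' ≠ y') :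
    ‖(γ x - γ y) / ((x - y : ℝ) : ℂ) - (γ x' - γ y') / ((x' - y' : ℝ) : ℂ)‖ ≤
      M * (|x - x'| + |y - y'|) := by
  have h := (convex_Icc (0 : ℝ) 1).norm_image_sub_le_of_norm_hasDerivWithin_le
    (f := fun θ : ℝ => γ (y + θ * (x - y)) / ((x - y : ℝ) : ℂ) -
      γ (y' + θ * (x' - y')) / ((x' - y' : ℝ) : ℂ))
    (f' := fun θ => γ₁ (y + θ * (x - y)) - γ₁ (y' + θ * (x' - y')))
    (C := M * (|x - x'| + |y - y'|)) (x := 0) (y := 1)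
    (fun θ hθ => (hasDerivWithinAt_segment hγ hx hy hxy hθ).sub
      (hasDerivWithinAt_segment hγ hx' hy' hxy' hθ))
    (fun θ hθ => by
      refine (hM _ (segment_mem hx hy hθ) _ (segment_mem hx' hy' hθ)).trans ?_
      gcongr
      have e : y + θ * (x - y) - (y' + θ * (x' - y')) = θ * (x - x') + (1 - θ) * (y - y') := by
        ring
      rw [e]
      refine (abs_add_le _ _).trans ?_
      rw [abs_mul, abs_mul, abs_of_nonneg hθ.1, abs_of_nonneg (by linarith [hθ.2] : 0 ≤ 1 - θ)]
      have := abs_nonneg (x - x')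
      have := abs_nonneg (y - y')
      nlinarith [hθ.1, hθ.2])
    (by simp) (by simp)
  convert! h using 1
  · congr 1
    simp
    ring
  · simp

/-- With `y` fixed, the segment points ending at `x + h`, `x - h` and `x` form at time `θ` a second
difference of `γ₁` with step `θ h`, and `|θ h| ≤ |h|`. -/
lemma norm_slope_second_difference_le
    (hγ : ∀ x ∈ Icc a b, HasDerivWithinAt γ (γ₁ x) (Icc a b) x) {M : ℝ} (hM0 : 0 ≤ M)
    (hM : ∀ x h : ℝ, x ∈ Icc a b → x + h ∈ Icc a b → x - h ∈ Icc a b →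
      ‖γ₁ (x + h) + γ₁ (x - h) - 2 * γ₁ x‖ ≤ M * h ^ 2)
    {x y h : ℝ} (hx : x ∈ Icc a b) (hxp : x + h ∈ Icc a b) (hxm : x - h ∈ Icc a b)
    (hy : y ∈ Icc a b) (hxy : x ≠ y) (hxyp : x + h ≠ y) (hxym : x - h ≠ y) :
    ‖(γ (x + h) - γ y) / ((x + h - y : ℝ) : ℂ) + (γ (x - h) - γ y) / ((x - h - y : ℝ) : ℂ) -
      2 * ((γ x - γ y) / ((x - y : ℝ) : ℂ))‖ ≤ M * h ^ 2 := by
  have hh := (convex_Icc (0 : ℝ) 1).norm_image_sub_le_of_norm_hasDerivWithin_le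
    (f := fun θ : ℝ => γ (y + θ * (x + h - y)) / ((x + h - y : ℝ) : ℂ) +
      γ (y + θ * (x - h - y)) / ((x - h - y : ℝ) : ℂ) -
      2 * (γ (y + θ * (x - y)) / ((x - y : ℝ) : ℂ)))
    (f' := fun θ => γ₁ (y + θ * (x + h - y)) + γ₁ (y + θ * (x - h - y)) -
      2 * γ₁ (y + θ * (x - y)))
    (C := M * h ^ 2) (x := 0) (y := 1)
    (fun θ hθ => ((hasDerivWithinAt_segment hγ hxp hy hxyp hθ).add
      (hasDerivWithinAt_segment hγ hxm hy hxym hθ)).sub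
      ((hasDerivWithinAt_segment hγ hx hy hxy hθ).const_mul 2))
    (fun θ hθ => by
      have e1 : y + θ * (x + h - y) = (y + θ * (x - y)) + θ * h := by ring
      have e2 : y + θ * (x - h - y) = (y + θ * (x - y)) - θ * h := by ring
      have m1 := segment_mem hxp hy hθ
      have m2 := segment_mem hxm hy hθ
      rw [e1] at m1
      rw [e2] at m2
      rw [e1, e2]
      refine (hM _ _ (segment_mem hx hy hθ) m1 m2).trans ?_
      have : (θ * h) ^ 2 ≤ h ^ 2 := by
        rw [mul_pow]
        exact mul_le_of_le_one_left (sq_nonneg h) (pow_le_one₀ hθ.1 hθ.2)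
      exact mul_le_mul_of_nonneg_left this hM0)
    (by simp) (by simp)
  convert! hh using 1
  · congr 1
    simp
    ring
  · simp

end Chords

/-- Second differences of a function with Lipschitz derivative. -/
lemma norm_second_difference_le {E : Type*} [NormedAddCommGroup E] [NormedSpace ℝ E] {a b : ℝ}
    {f f₁ : ℝ → E} (hf : ∀ x ∈ Icc a b, HasDerivWithinAt f (f₁ x) (Icc a b) x) {M : ℝ}
    (hM0 : 0 ≤ M) (hM : ∀ x ∈ Icc a b, ∀ y ∈ Icc a b, ‖f₁ x - f₁ y‖ ≤ M * |x - y|)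
    {x h : ℝ} (hp : x + h ∈ Icc a b) (hm : x - h ∈ Icc a b) :
    ‖f (x + h) + f (x - h) - (2 : ℝ) • f x‖ ≤ 2 * M * h ^ 2 := by
  have m1 : ∀ θ ∈ Icc (0 : ℝ) 1, x + θ * h ∈ Icc a b := by
    intro θ hθ
    constructor
    · nlinarith [hp.1, hp.2, hm.1, hm.2, hθ.1, hθ.2, mul_nonneg hθ.1 (sub_nonneg.2 hp.1),
        mul_nonneg (sub_nonneg.2 hθ.2) (sub_nonneg.2 hp.1),
        mul_nonneg (sub_nonneg.2 hθ.2) (sub_nonneg.2 hm.1)]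
    · nlinarith [hp.1, hp.2, hm.1, hm.2, hθ.1, hθ.2, mul_nonneg hθ.1 (sub_nonneg.2 hp.2),
        mul_nonneg (sub_nonneg.2 hθ.2) (sub_nonneg.2 hp.2),
        mul_nonneg (sub_nonneg.2 hθ.2) (sub_nonneg.2 hm.2)]
  have m2 : ∀ θ ∈ Icc (0 : ℝ) 1, x - θ * h ∈ Icc a b := by
    intro θ hθ
    constructor
    · nlinarith [hp.1, hp.2, hm.1, hm.2, hθ.1, hθ.2, mul_nonneg hθ.1 (sub_nonneg.2 hm.1),
        mul_nonneg (sub_nonneg.2 hθ.2) (sub_nonneg.2 hp.1),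
        mul_nonneg (sub_nonneg.2 hθ.2) (sub_nonneg.2 hm.1)]
    · nlinarith [hp.1, hp.2, hm.1, hm.2, hθ.1, hθ.2, mul_nonneg hθ.1 (sub_nonneg.2 hm.2),
        mul_nonneg (sub_nonneg.2 hθ.2) (sub_nonneg.2 hp.2),
        mul_nonneg (sub_nonneg.2 hθ.2) (sub_nonneg.2 hm.2)]
  have hh := (convex_Icc (0 : ℝ) 1).norm_image_sub_le_of_norm_hasDerivWithin_le
    (f := fun θ : ℝ => f (x + θ * h) + f (x - θ * h))
    (f' := fun θ => h • f₁ (x + θ * h) + (-h) • f₁ (x - θ * h))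
    (C := 2 * M * h ^ 2) (x := 0) (y := 1)
    (fun θ hθ => by
      have d1 : HasDerivWithinAt (fun θ : ℝ => x + θ * h) h (Icc 0 1) θ := by
        simpa using (((hasDerivWithinAt_id θ (Icc 0 1)).mul_const h).const_add x)
      have d2 : HasDerivWithinAt (fun θ : ℝ => x - θ * h) (-h) (Icc 0 1) θ := by
        simpa using (((hasDerivWithinAt_id θ (Icc 0 1)).mul_const h).const_sub x)
      exact ((hf _ (m1 θ hθ)).scomp θ d1 m1).add ((hf _ (m2 θ hθ)).scomp θ d2 m2))
    (fun θ hθ => by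
      have e : h • f₁ (x + θ * h) + (-h) • f₁ (x - θ * h) =
        h • (f₁ (x + θ * h) - f₁ (x - θ * h)) := by
        rw [neg_smul, smul_sub, ← sub_eq_add_neg]
      rw [e, norm_smul, Real.norm_eq_abs]
      have h1 := hM _ (m1 θ hθ) _ (m2 θ hθ)
      have e2 : x + θ * h - (x - θ * h) = 2 * θ * h := by ring
      rw [e2, abs_mul, abs_mul, abs_of_nonneg hθ.1, abs_two] at h1
      calc |h| * ‖f₁ (x + θ * h) - f₁ (x - θ * h)‖ ≤ |h| * (M * (2 * θ * |h|)) := by gcongr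
        _ ≤ |h| * (M * (2 * 1 * |h|)) := by
            gcongr
            exact hθ.2
        _ = 2 * M * |h| ^ 2 := by ring
        _ = 2 * M * h ^ 2 := by rw [sq_abs])
    (by simp) (by simp)
  convert! hh using 1
  · congr 1
    simp [two_smul]
  · simp

/-- The logarithm of the chords is semiconvex in each variable. -/
lemma chordLog_second_difference {u v w : ℂ} {c M₂ M₃ h : ℝ} (hc : 0 < c) (hu : c ≤ ‖u‖)
    (hv : c ≤ ‖v‖) (hw : c ≤ ‖w‖) (hw' : ‖w‖ ≤ c⁻¹) (h1 : ‖u - w‖ ≤ M₂ * |h|)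
    (h2 : ‖v - w‖ ≤ M₂ * |h|) (h3 : ‖u + v - 2 * w‖ ≤ M₃ * h ^ 2) :
    2 * log ‖w‖ - log ‖u‖ - log ‖v‖ ≤ (c⁻¹ * M₃ + M₂ ^ 2) * c⁻¹ ^ 2 * h ^ 2 := by
  have hu0 : 0 < ‖u‖ := hc.trans_le hu
  have hv0 : 0 < ‖v‖ := hc.trans_le hv
  have hw0 : 0 < ‖w‖ := hc.trans_le hw
  have hz : ‖w ^ 2 - u * v‖ ≤ (c⁻¹ * M₃ + M₂ ^ 2) * h ^ 2 := by
    -- This identity isolates the second difference and a product of two first differences, both of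
    -- order `h²`.
    have e : w ^ 2 - u * v = -(w * (u + v - 2 * w)) - (u - w) * (v - w) := by ring
    rw [e]
    refine (norm_sub_le _ _).trans ?_
    rw [norm_neg, norm_mul, norm_mul]
    have a1 : ‖w‖ * ‖u + v - 2 * w‖ ≤ c⁻¹ * (M₃ * h ^ 2) := by gcongr
    have a2 : ‖u - w‖ * ‖v - w‖ ≤ (M₂ * |h|) * (M₂ * |h|) :=
      mul_le_mul h1 h2 (norm_nonneg _) ((norm_nonneg _).trans h1)
    have a3 : (M₂ * |h|) * (M₂ * |h|) = M₂ ^ 2 * h ^ 2 := by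
      rw [← sq_abs h]
      ring
    linarith
  have e : 2 * log ‖w‖ - log ‖u‖ - log ‖v‖ = log (‖w‖ ^ 2 / (‖u‖ * ‖v‖)) := by
    rw [log_div (by positivity) (by positivity), log_mul hu0.ne' hv0.ne', log_pow]
    push_cast
    ring
  rw [e]
  have hle : ‖w‖ ^ 2 ≤ ‖u‖ * ‖v‖ + ‖w ^ 2 - u * v‖ := by
    rw [← norm_pow, ← norm_mul]
    calc ‖w ^ 2‖ = ‖u * v + (w ^ 2 - u * v)‖ := by ring_nf
      _ ≤ _ := norm_add_le _ _
  calc log (‖w‖ ^ 2 / (‖u‖ * ‖v‖)) ≤ ‖w‖ ^ 2 / (‖u‖ * ‖v‖) - 1 :=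
        log_le_sub_one_of_pos (by positivity)
    _ = (‖w‖ ^ 2 - ‖u‖ * ‖v‖) / (‖u‖ * ‖v‖) := by field_simp
    _ ≤ ‖w ^ 2 - u * v‖ / (‖u‖ * ‖v‖) := by
        gcongr
        linarith
    _ ≤ ‖w ^ 2 - u * v‖ / (c * c) := by gcongr
    _ = ‖w ^ 2 - u * v‖ * c⁻¹ ^ 2 := by
        field_simp
    _ ≤ (c⁻¹ * M₃ + M₂ ^ 2) * h ^ 2 * c⁻¹ ^ 2 := by gcongr
    _ = _ := by ring

end CurveGas
end

/-! ### Uniform regularity of the curves and of the field -/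

noncomputable section
namespace CurveGas
open Filter Topology Real

/-- Extension of a function from `[a, b]` to the line by its values at the end points. -/
def clamp {E : Type*} (a b : ℝ) (hab : a ≤ b) (f : ℝ → E) : ℝ → E :=
  IccExtend hab ((Icc a b).domRestrict f)

lemma clamp_of_mem {E : Type*} {a b : ℝ} (hab : a ≤ b) (f : ℝ → E) {x : ℝ} (hx : x ∈ Icc a b) :
    clamp a b hab f x = f x := by
  rw [clamp, IccExtend_of_mem hab _ hx]
  rfl

lemma continuous_clamp {E : Type*} [TopologicalSpace E] {a b : ℝ} (hab : a ≤ b) {f : ℝ → E}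
    (hf : ContinuousOn f (Icc a b)) : Continuous (clamp a b hab f) :=
  hf.domRestrict.Icc_extend'

section Family

variable {a b : ℝ} {η : ℝ → ℝ → ℂ}

lemma IsCurveFamily.contDiffOn (hη : IsCurveFamily a b η) {t : ℝ} (ht : t ∈ Icc (0 : ℝ) 1) :
    ContDiffOn ℝ ∞ (η t) (Icc a b) := by
  have h : ContDiffOn ℝ ∞ (fun x : ℝ => (t, x)) (Icc a b) := by fun_prop
  exact hη.smooth.comp h fun x hx => ⟨ht, hx⟩

lemma hasDerivWithinAt_of_contDiffOn {E : Type*} [NormedAddCommGroup E] [NormedSpace ℝ E]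
    {f : ℝ → E} (hf : ContDiffOn ℝ ∞ f (Icc a b)) {x : ℝ} (hx : x ∈ Icc a b) :
    HasDerivWithinAt f (derivWithin f (Icc a b) x) (Icc a b) x :=
  (hf.differentiableOn (by norm_num) x hx).hasDerivWithinAt

lemma contDiffOn_derivWithin {E : Type*} [NormedAddCommGroup E] [NormedSpace ℝ E] (hab : a < b)
    {f : ℝ → E} (hf : ContDiffOn ℝ ∞ f (Icc a b)) :
    ContDiffOn ℝ ∞ (derivWithin f (Icc a b)) (Icc a b) :=
  hf.derivWithin (uniqueDiffOn_Icc hab) (by norm_num)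

lemma exists_lipschitz_bound {E : Type*} [NormedAddCommGroup E] [NormedSpace ℝ E] (hab : a < b)
    {f : ℝ → E} (hf : ContDiffOn ℝ ∞ f (Icc a b)) :
    ∃ M : ℝ, 0 ≤ M ∧ ∀ x ∈ Icc a b, ∀ y ∈ Icc a b, ‖f x - f y‖ ≤ M * |x - y| := by
  obtain ⟨M, hM⟩ := isCompact_Icc.exists_bound_of_continuousOn
    (contDiffOn_derivWithin hab hf).continuousOn
  refine ⟨M, (norm_nonneg _).trans (hM a ⟨le_rfl, hab.le⟩), fun x hx y hy => ?_⟩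
  exact (convex_Icc a b).norm_image_sub_le_of_norm_derivWithin_le
    (hf.differentiableOn (by norm_num)) hM hy hx

/-- Uniform bi-Lipschitz constant of the family. -/
lemma IsCurveFamily.exists_bilipschitz (hη : IsCurveFamily a b η) :
    ∃ c : ℝ, 0 < c ∧ ∀ t ∈ Icc (0 : ℝ) 1, ∀ x ∈ Icc a b, ∀ y ∈ Icc a b,
      c * |x - y| ≤ ‖η t x - η t y‖ ∧ ‖η t x - η t y‖ ≤ c⁻¹ * |x - y| := by
  obtain ⟨c, hc, h⟩ := hη.bilipschitz
  refine ⟨c, hc, fun t ht x hx y hy => ?_⟩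
  rcases eq_or_ne x y with rfl | hxy
  · simp
  · obtain ⟨h1, h2⟩ := h t ht x hx y hy hxy
    have hpos : 0 < |x - y| := abs_pos.2 (sub_ne_zero.2 hxy)
    rw [norm_div, Complex.norm_real, Real.norm_eq_abs] at h1 h2
    rw [lt_div_iff₀ hpos] at h1
    rw [div_lt_iff₀ hpos] at h2
    exact ⟨h1.le, h2.le⟩

lemma norm_slope_ge {γ : ℝ → ℂ} {c x y : ℝ} (hxy : x ≠ y) (h : c * |x - y| ≤ ‖γ x - γ y‖) :
    c ≤ ‖(γ x - γ y) / ((x - y : ℝ) : ℂ)‖ := by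
  have hpos : 0 < |x - y| := abs_pos.2 (sub_ne_zero.2 hxy)
  rwa [norm_div, Complex.norm_real, Real.norm_eq_abs, le_div_iff₀ hpos]

lemma norm_slope_le {γ : ℝ → ℂ} {c x y : ℝ} (hxy : x ≠ y) (h : ‖γ x - γ y‖ ≤ c * |x - y|) :
    ‖(γ x - γ y) / ((x - y : ℝ) : ℂ)‖ ≤ c := by
  have hpos : 0 < |x - y| := abs_pos.2 (sub_ne_zero.2 hxy)
  rwa [norm_div, Complex.norm_real, Real.norm_eq_abs, div_le_iff₀ hpos]

lemma ne_of_lower {γ : ℝ → ℂ} {c x y : ℝ} (hc : 0 < c) (hxy : x ≠ y)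
    (h : c * |x - y| ≤ ‖γ x - γ y‖) : γ x ≠ γ y := by
  intro he
  rw [he, sub_self, norm_zero] at h
  have := mul_pos hc (abs_pos.2 (sub_ne_zero.2 hxy))
  linarith

/-- The curves of a family are uniformly regular. -/
theorem IsCurveFamily.exists_isRegularCurve (hη : IsCurveFamily a b η) (hab : a < b) {c : ℝ}
    (hc : 0 < c) (hbil : ∀ t ∈ Icc (0 : ℝ) 1, ∀ x ∈ Icc a b, ∀ y ∈ Icc a b,
      c * |x - y| ≤ ‖η t x - η t y‖ ∧ ‖η t x - η t y‖ ≤ c⁻¹ * |x - y|) :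
    ∃ Λ R : ℝ, 0 ≤ Λ ∧ ∀ t ∈ Icc (0 : ℝ) 1,
      IsRegularCurve a b c Λ R (clamp a b hab.le (η t)) := by
  obtain ⟨R, hR⟩ := hη.deriv_bound 0
  obtain ⟨M, hM⟩ := hη.deriv_bound 2
  have hM0 : 0 ≤ M := (norm_nonneg _).trans (hM 0 (by simp) a ⟨le_rfl, hab.le⟩)
  -- `M` bounds the second derivatives, hence the variation of slopes; the slopes have modulus at
  -- least `c`, where `log` is `c⁻¹`-Lipschitz.
  refine ⟨c⁻¹ * M, R, by positivity, fun t ht => ?_⟩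
  have hγ := hη.contDiffOn ht
  have hlip : ∀ x ∈ Icc a b, ∀ y ∈ Icc a b,
      ‖derivWithin (η t) (Icc a b) x - derivWithin (η t) (Icc a b) y‖ ≤ M * |x - y| := by
    intro x hx y hy
    refine (convex_Icc a b).norm_image_sub_le_of_norm_derivWithin_le
      ((contDiffOn_derivWithin hab hγ).differentiableOn (by norm_num)) ?_ hy hx
    intro z hz
    have := hM t ht z hz
    rw [show (2 : ℕ) = 1 + 1 from rfl, iteratedDerivWithin_succ] at this
    have he : iteratedDerivWithin 1 (η t) (Icc a b) = derivWithin (η t) (Icc a b) :=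
      iteratedDerivWithin_one
    rwa [he] at this
  constructor
  · exact continuous_clamp hab.le hγ.continuousOn
  · intro x hx
    rw [clamp_of_mem hab.le _ hx]
    simpa using hR t ht x hx
  · intro x hx y hy
    rw [clamp_of_mem hab.le _ hx, clamp_of_mem hab.le _ hy]
    exact (hbil t ht x hx y hy).1
  · intro x hx y hy
    rw [clamp_of_mem hab.le _ hx, clamp_of_mem hab.le _ hy]
    exact (hbil t ht x hx y hy).2
  · intro x hx y hy x' hx' y' hy' hxy hxy'
    have b1 := (hbil t ht x hx y hy).1
    have b2 := (hbil t ht x' hx' y' hy').1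
    have e : ∀ x ∈ Icc a b, ∀ y ∈ Icc a b, chordLog (clamp a b hab.le (η t)) (x, y) =
        chordLog (η t) (x, y) := by
      intro x hx y hy
      simp only [chordLog]
      rw [clamp_of_mem hab.le _ hx, clamp_of_mem hab.le _ hy]
    rw [e x hx y hy, e x' hx' y' hy', chordLog_eq_log hxy (ne_of_lower hc hxy b1),
      chordLog_eq_log hxy' (ne_of_lower hc hxy' b2)]
    refine (abs_log_sub_log_le hc (norm_slope_ge hxy b1) (norm_slope_ge hxy' b2)).trans ?_
    rw [mul_assoc]
    gcongr
    refine (abs_norm_sub_norm_le _ _).trans ?_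
    exact norm_slope_sub_slope_le (fun x hx => hasDerivWithinAt_of_contDiffOn hγ hx) hM0 hlip
      hx hy hx' hy' hxy hxy'

/-- Second differences of the chord kernel of a fixed curve are quadratically small from below. -/
lemma exists_chordLog_second_difference (hab : a < b) {γ : ℝ → ℂ}
    (hγ : ContDiffOn ℝ ∞ γ (Icc a b)) {c : ℝ} (hc : 0 < c)
    (hbil : ∀ x ∈ Icc a b, ∀ y ∈ Icc a b,
      c * |x - y| ≤ ‖γ x - γ y‖ ∧ ‖γ x - γ y‖ ≤ c⁻¹ * |x - y|) :
    ∃ C : ℝ, 0 ≤ C ∧ ∀ x y h : ℝ, x ∈ Icc a b → x + h ∈ Icc a b → x - h ∈ Icc a b → y ∈ Icc a b →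
      x ≠ y → x + h ≠ y → x - h ≠ y →
      2 * chordLog γ (x, y) - chordLog γ (x + h, y) - chordLog γ (x - h, y) ≤ C * h ^ 2 := by
  have h1 := contDiffOn_derivWithin hab hγ
  obtain ⟨M₂, hM₂0, hM₂⟩ := exists_lipschitz_bound hab h1
  obtain ⟨M₃, hM₃0, hM₃⟩ := exists_lipschitz_bound hab (contDiffOn_derivWithin hab h1)
  have hd : ∀ x ∈ Icc a b, HasDerivWithinAt γ (derivWithin γ (Icc a b) x) (Icc a b) x :=
    fun x hx => hasDerivWithinAt_of_contDiffOn hγ hx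
  refine ⟨(c⁻¹ * (2 * M₃) + M₂ ^ 2) * c⁻¹ ^ 2, by positivity, ?_⟩
  intro x y h hx hp hm hy hxy hpy hmy
  have b1 := hbil x hx y hy
  have b2 := hbil _ hp y hy
  have b3 := hbil _ hm y hy
  rw [chordLog_eq_log hxy (ne_of_lower hc hxy b1.1), chordLog_eq_log hpy (ne_of_lower hc hpy b2.1),
    chordLog_eq_log hmy (ne_of_lower hc hmy b3.1)]
  refine chordLog_second_difference hc (norm_slope_ge hpy b2.1) (norm_slope_ge hmy b3.1)
    (norm_slope_ge hxy b1.1) (norm_slope_le hxy b1.2) ?_ ?_ ?_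
  · have := norm_slope_sub_slope_le hd hM₂0 hM₂ hp hy hx hy hpy hxy
    simpa using this
  · have := norm_slope_sub_slope_le hd hM₂0 hM₂ hm hy hx hy hmy hxy
    simpa using this
  · refine norm_slope_second_difference_le hd (by positivity) ?_ hx hp hm hy hxy hpy hmy
    intro x h hx hp hm
    have := norm_second_difference_le (fun x hx => hasDerivWithinAt_of_contDiffOn h1 hx) hM₃0 hM₃
      hp hm
    simpa using this

/-- On the interior the speed of a bi-Lipschitz curve is bounded above and below. -/
lemma norm_deriv_bounds {γ : ℝ → ℂ}
    (hγ : ContDiffOn ℝ ∞ γ (Icc a b)) {c : ℝ}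
    (hbil : ∀ x ∈ Icc a b, ∀ y ∈ Icc a b,
      c * |x - y| ≤ ‖γ x - γ y‖ ∧ ‖γ x - γ y‖ ≤ c⁻¹ * |x - y|) {x : ℝ} (hx : x ∈ Ioo a b) :
    c ≤ ‖deriv γ x‖ ∧ ‖deriv γ x‖ ≤ c⁻¹ := by
  have hd : HasDerivAt γ (deriv γ x) x :=
    ((hγ.contDiffAt (Icc_mem_nhds hx.1 hx.2)).differentiableAt (by norm_num)).hasDerivAt
  have ht := (hasDerivAt_iff_tendsto_slope.1 hd).norm
  have hev : ∀ᶠ y in 𝓝[≠] x, y ∈ Icc a b ∧ y ≠ x :=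
    Filter.Eventually.and (nhdsWithin_le_nhds (Icc_mem_nhds hx.1 hx.2)) self_mem_nhdsWithin
  have hn : ∀ y, y ≠ x → ‖slope γ x y‖ = ‖γ y - γ x‖ / |y - x| := by
    intro y hy
    rw [slope_def_module, norm_smul, norm_inv, Real.norm_eq_abs]
    field_simp
  constructor
  · refine ge_of_tendsto ht ?_
    filter_upwards [hev] with y hy
    rw [hn y hy.2, le_div_iff₀ (abs_pos.2 (sub_ne_zero.2 hy.2))]
    exact (hbil y hy.1 x ⟨hx.1.le, hx.2.le⟩).1
  · refine le_of_tendsto ht ?_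
    filter_upwards [hev] with y hy
    rw [hn y hy.2, div_le_iff₀ (abs_pos.2 (sub_ne_zero.2 hy.2))]
    exact (hbil y hy.1 x ⟨hx.1.le, hx.2.le⟩).2

end Family

section Field

variable {a b a' b' : ℝ} {η : ℝ → ℝ → ℂ} {W : ℝ → ℂ → ℂ}

lemma contDiffOn_field {γ : ℝ → ℂ} {w : ℂ → ℂ} (hγ : ContDiffOn ℝ ∞ γ (Icc a b))
    (hw : AnalyticOnNhd ℂ w (γ '' Icc a b)) : ContDiffOn ℝ ∞ (field γ w) (Icc a b) := by
  intro x hx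
  have h1 : ContDiffAt ℝ ∞ w (γ x) := ((hw (γ x) ⟨x, hx, rfl⟩).contDiffAt).restrict_scalars ℝ
  exact Complex.reCLM.contDiff.contDiffAt.comp_contDiffWithinAt x
    (h1.comp_contDiffWithinAt x (hγ x hx))

/-- Chain rule: the first derivative of `W t` is bounded on the curve and the speed is at most
`c⁻¹`. Since `[a, b]` is interior to `[a', b']`, the curve has genuine two-sided derivatives there.
-/
lemma exists_field_lipschitz (haa : a' < a) (hab : a < b) (hbb : b < b')
    (hη : IsCurveFamily a' b' η) (hW : IsPotentialFamily a b η W)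
    {c : ℝ} (hbil : ∀ t ∈ Icc (0 : ℝ) 1, ∀ x ∈ Icc a' b', ∀ y ∈ Icc a' b',
      c * |x - y| ≤ ‖η t x - η t y‖ ∧ ‖η t x - η t y‖ ≤ c⁻¹ * |x - y|) :
    ∃ M : ℝ, 0 ≤ M ∧ ∀ t ∈ Icc (0 : ℝ) 1, ∀ x ∈ Icc a b, ∀ y ∈ Icc a b,
      |field (η t) (W t) x - field (η t) (W t) y| ≤ M * |x - y| := by
  obtain ⟨M, hM⟩ := hW.deriv_bound 1
  have hM0 : 0 ≤ M := (norm_nonneg _).trans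
    (hM 0 (by simp) (η 0 a) ⟨a, ⟨le_rfl, hab.le⟩, rfl⟩)
  have hsub : Icc a b ⊆ Ioo a' b' := fun x hx => ⟨haa.trans_le hx.1, hx.2.trans_lt hbb⟩
  refine ⟨M * |c⁻¹|, by positivity, fun t ht x hx y hy => ?_⟩
  have hγ := hη.contDiffOn ht
  have hd : ∀ z ∈ Icc a b, HasDerivWithinAt (fun z => W t (η t z))
      (deriv (η t) z • deriv (W t) (η t z)) (Icc a b) z := by
    intro z hz
    have h1 : HasDerivAt (η t) (deriv (η t) z) z :=
      ((hγ.contDiffAt (Icc_mem_nhds (hsub hz).1 (hsub hz).2)).differentiableAt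
        (by norm_num)).hasDerivAt
    have h2 : HasDerivAt (W t) (deriv (W t) (η t z)) (η t z) :=
      (hW.analytic t ht (η t z) ⟨z, hz, rfl⟩).differentiableAt.hasDerivAt
    exact (h2.scomp z h1).hasDerivWithinAt
  have hmv := (convex_Icc a b).norm_image_sub_le_of_norm_hasDerivWithin_le
    (C := M * |c⁻¹|) hd (fun z hz => by
      rw [norm_smul, mul_comm]
      have h1 := hM t ht (η t z) ⟨z, hz, rfl⟩
      rw [iteratedDeriv_one] at h1
      have h2 := (norm_deriv_bounds hγ (hbil t ht) (hsub hz)).2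
      have h3 := h2.trans (le_abs_self _)
      gcongr) hy hx
  refine le_trans ?_ hmv
  rw [field, field, ← Complex.sub_re]
  exact Complex.abs_re_le_norm _

lemma exists_field_second_difference (hab : a < b) {f : ℝ → ℝ}
    (hf : ContDiffOn ℝ ∞ f (Icc a b)) :
    ∃ C : ℝ, 0 ≤ C ∧ ∀ x h : ℝ, x + h ∈ Icc a b → x - h ∈ Icc a b →
      f (x + h) + f (x - h) - 2 * f x ≤ C * h ^ 2 := by
  obtain ⟨M, hM0, hM⟩ := exists_lipschitz_bound hab (contDiffOn_derivWithin hab hf)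
  refine ⟨2 * M, by positivity, fun x h hp hm => ?_⟩
  exact (le_abs_self _).trans (norm_second_difference_le
    (fun x hx => hasDerivWithinAt_of_contDiffOn hf hx) hM0 hM hp hm)

end Field

end CurveGas
end

noncomputable section
namespace CurveGas
open Filter Topology Real

/-! ### Finite logarithmic energy -/

/-- Atomless probability measures on `[a, b]` of finite logarithmic energy along `γ`. -/
structure IsAdmissible (a b : ℝ) (γ : ℝ → ℂ) (ν : Measure ℝ) : Prop where
  prob : IsProbabilityMeasure ν
  carried : ∀ᵐ x ∂ν, x ∈ Icc a b
  atomless : NullSingletonClass ν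
  integrable : Integrable (curveLog γ) (ν.prod ν)

/-- The energy as a real number. -/
def realEnergy (γ : ℝ → ℂ) (φ : ℝ → ℝ) (ν : Measure ℝ) : ℝ :=
  (∫ p, curveLog γ p ∂(ν.prod ν)) + 2 * ∫ x, φ x ∂ν

lemma logKernel_of_ne {γ : ℝ → ℂ} {p : ℝ × ℝ} (h : γ p.1 ≠ γ p.2) :
    logKernel γ p = (curveLog γ p : ℝ) := by
  rw [logKernel, curveLog, ← ofReal_norm,
    ENNReal.log_ofReal_of_pos (norm_pos_iff.2 (sub_ne_zero.2 h)), ← EReal.coe_neg]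

lemma logKernel_of_eq {γ : ℝ → ℂ} {p : ℝ × ℝ} (h : γ p.1 = γ p.2) : logKernel γ p = ⊤ := by
  simp [logKernel, h]

lemma eintegral_coe {α : Type*} [MeasurableSpace α] {μ : Measure α} {f : α → EReal} {g : α → ℝ}
    (hg : Integrable g μ) (h : ∀ᵐ x ∂μ, f x = (g x : ℝ)) :
    eintegral μ f = ((∫ x, g x ∂μ : ℝ) : EReal) := by
  have e1 : ∫⁻ x, (f x).toENNReal ∂μ = ∫⁻ x, ENNReal.ofReal (g x) ∂μ :=
    lintegral_congr_ae (by
      filter_upwards [h] with x hx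
      rw [hx, EReal.real_coe_toENNReal])
  have e2 : ∫⁻ x, (-f x).toENNReal ∂μ = ∫⁻ x, ENNReal.ofReal (-g x) ∂μ :=
    lintegral_congr_ae (by
      filter_upwards [h] with x hx
      rw [hx, ← EReal.coe_neg, EReal.real_coe_toENNReal])
  have f1 : ∫⁻ x, ENNReal.ofReal (g x) ∂μ ≠ ⊤ := hg.lintegral_lt_top.ne
  have f2 : ∫⁻ x, ENNReal.ofReal (-g x) ∂μ ≠ ⊤ := hg.neg.lintegral_lt_top.ne
  rw [eintegral, e1, e2, integral_eq_lintegral_pos_part_sub_lintegral_neg_part hg, EReal.coe_sub,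
    EReal.coe_ennreal_toReal f1, EReal.coe_ennreal_toReal f2]

lemma ae_prod_mem {a b : ℝ} {α β : Measure ℝ} [SFinite α] [SFinite β]
    (hα : ∀ᵐ x ∂α, x ∈ Icc a b) (hβ : ∀ᵐ x ∂β, x ∈ Icc a b) :
    ∀ᵐ p ∂(α.prod β), p.1 ∈ Icc a b ∧ p.2 ∈ Icc a b :=
  (Measure.quasiMeasurePreserving_fst.ae hα).and (Measure.quasiMeasurePreserving_snd.ae hβ)

lemma IsRegularCurve.injOn {a b c Λ R : ℝ} {γ : ℝ → ℂ} (hγ : IsRegularCurve a b c Λ R γ)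
    (hc : 0 < c) : InjOn γ (Icc a b) := by
  intro x hx y hy hxy
  by_contra h
  exact ne_of_lower hc h (hγ.lower x hx y hy) hxy

lemma integrable_of_continuous {a b : ℝ} {ν : Measure ℝ} [IsFiniteMeasure ν]
    (hν : ∀ᵐ x ∂ν, x ∈ Icc a b) {f : ℝ → ℝ} (hf : Continuous f) : Integrable f ν := by
  obtain ⟨M, hM⟩ := isCompact_Icc.exists_bound_of_continuousOn hf.continuousOn (s := Icc a b)
  exact (integrable_const M).mono' hf.aestronglyMeasurable (by
    filter_upwards [hν] with x hx using hM x hx)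

/-- Chords have length at most `c⁻¹ (b - a)`. On the diagonal the convention `log 0 = 0` gives the
value `0`, which the absolute value in the bound covers. -/
lemma curveLog_ge {a b c Λ R : ℝ} {γ : ℝ → ℂ} (hγ : IsRegularCurve a b c Λ R γ) (hc : 0 < c)
    {x y : ℝ} (hx : x ∈ Icc a b) (hy : y ∈ Icc a b) :
    -|log (c⁻¹ * (b - a))| ≤ curveLog γ (x, y) := by
  rcases eq_or_ne x y with rfl | hxy
  · simp [curveLog]
  · have h1 := hγ.upper x hx y hy
    have h2 := norm_pos_iff.2 (sub_ne_zero.2 (ne_of_lower hc hxy (hγ.lower x hx y hy)))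
    have h3 : |x - y| ≤ b - a := abs_sub_le_iff.2
      ⟨by linarith [hx.2, hy.1], by linarith [hy.2, hx.1]⟩
    have h4 : ‖γ x - γ y‖ ≤ c⁻¹ * (b - a) := h1.trans (by gcongr)
    have h5 := log_le_log h2 h4
    rw [curveLog]
    linarith [le_abs_self (log (c⁻¹ * (b - a)))]

section Energy

variable {a b a' b' c Λ R : ℝ} {γ : ℝ → ℂ}

/-- Measures of finite mutual energy on a regular curve. -/
lemma IsAdmissible.cross (hγ : IsRegularCurve a' b' c Λ R γ) (hc : 0 < c)
    {α β : Measure ℝ} (hα : IsAdmissible a' b' γ α) (hβ : IsAdmissible a' b' γ β) :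
    Integrable (curveLog γ) (α.prod β) := by
  have := hα.prob
  have := hβ.prob
  have := hα.atomless
  have := hβ.atomless
  exact integrable_curveLog_cross hγ.continuous.measurable (hγ.injOn hc) hγ.bound hα.carried
    hβ.carried hα.integrable hβ.integrable

lemma IsAdmissible.quadDiff_nonneg (hγ : IsRegularCurve a' b' c Λ R γ) (hc : 0 < c)
    {α β : Measure ℝ} (hα : IsAdmissible a' b' γ α) (hβ : IsAdmissible a' b' γ β) :
    0 ≤ quadDiff (curveLog γ) α β := by
  have := hα.prob
  have := hβ.prob
  have := hα.atomless
  have := hβ.atomless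
  exact quadDiff_curveLog_nonneg hγ.continuous.measurable (hγ.injOn hc) hα.carried
    hβ.carried hα.integrable (hα.cross hγ hc hβ) hβ.integrable

lemma IsAdmissible.mono {α : Measure ℝ} (h : IsAdmissible a b γ α) (ha : a' ≤ a) (hb : b ≤ b') :
    IsAdmissible a' b' γ α :=
  ⟨h.prob, h.carried.mono fun _ hx => ⟨ha.trans hx.1, hx.2.trans hb⟩, h.atomless, h.integrable⟩

lemma IsAdmissible.isProbOn {α : Measure ℝ} (h : IsAdmissible a b γ α) : IsProbOn a b α :=
  ⟨h.prob, ae_iff.1 h.carried⟩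

/-- The extended energy of an admissible measure is its real energy. -/
lemma energy_eq_realEnergy {γ₀ : ℝ → ℂ} {w : ℂ → ℂ} {φ : ℝ → ℝ} {ν : Measure ℝ}
    (hγ₀ : ∀ x ∈ Icc a b, γ₀ x = γ x) (hinj : InjOn γ (Icc a b)) (hφ : Continuous φ)
    (hφ₀ : ∀ x ∈ Icc a b, field γ₀ w x = φ x) (hν : IsAdmissible a b γ ν) :
    energy γ₀ w ν = ((realEnergy γ φ ν : ℝ) : EReal) := by
  have := hν.prob
  have := hν.atomless
  have hi : Integrable φ ν := integrable_of_continuous hν.carried hφ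
  have i1 : Integrable (fun p : ℝ × ℝ => φ p.1) (ν.prod ν) := hi.comp_fst ν
  have i2 : Integrable (fun p : ℝ × ℝ => φ p.2) (ν.prod ν) := hi.comp_snd ν
  rw [energy, eintegral_coe (g := fun p => curveLog γ p + (φ p.1 + φ p.2))
    (hν.integrable.add (i1.add i2))]
  · rw [integral_add hν.integrable (by exact i1.add i2), integral_add i1 i2, integral_fun_fst,
      integral_fun_snd, realEnergy]
    simp [two_mul]
  · filter_upwards [ae_prod_mem hν.carried hν.carried, ae_ne_of_noAtoms ν ν] with p hp hne
    have hneq : γ₀ p.1 ≠ γ₀ p.2 := by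
      rw [hγ₀ _ hp.1, hγ₀ _ hp.2]
      exact fun h => hne (hinj hp.1 hp.2 h)
    rw [logKernel_of_ne hneq, hφ₀ _ hp.1, hφ₀ _ hp.2, ← EReal.coe_add]
    simp only [curveLog, hγ₀ _ hp.1, hγ₀ _ hp.2]

/-- Measures of finite extended energy are admissible. -/
lemma isAdmissible_of_energy_lt_top (hγ : IsRegularCurve a b c Λ R γ) (hc : 0 < c)
    {γ₀ : ℝ → ℂ} {w : ℂ → ℂ} {φ : ℝ → ℝ} {ν : Measure ℝ}
    (hγ₀ : ∀ x ∈ Icc a b, γ₀ x = γ x) (hφ : Continuous φ)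
    (hφ₀ : ∀ x ∈ Icc a b, field γ₀ w x = φ x) (hν : IsProbOn a b ν) (hfin : energy γ₀ w ν < ⊤) :
    IsAdmissible a b γ ν := by
  have := hν.prob
  have hcar : ∀ᵐ x ∂ν, x ∈ Icc a b := ae_iff.2 hν.carried
  set f : ℝ × ℝ → EReal := fun p =>
    logKernel γ p + ((φ p.1 + φ p.2 : ℝ) : EReal) with hf
  have hfm : Measurable f := by
    have h1 : Measurable (logKernel γ) := by
      unfold logKernel
      have : Measurable fun p : ℝ × ℝ => ‖γ p.1 - γ p.2‖ₑ :=
        (((hγ.continuous.comp continuous_fst).sub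
          (hγ.continuous.comp continuous_snd)).enorm).measurable
      exact (ENNReal.measurable_log.comp this).neg
    have h2 : Measurable fun p : ℝ × ℝ => ((φ p.1 + φ p.2 : ℝ) : EReal) :=
      ((hφ.comp continuous_fst).add (hφ.comp continuous_snd)).measurable.coe_real_ereal
    exact h1.add h2
  have hae : ∀ᵐ p ∂(ν.prod ν), logKernel γ₀ p +
      ((field γ₀ w p.1 + field γ₀ w p.2 : ℝ) : EReal) = f p := by
    filter_upwards [ae_prod_mem hcar hcar] with p hp
    simp only [hf, logKernel, hγ₀ _ hp.1, hγ₀ _ hp.2, hφ₀ _ hp.1, hφ₀ _ hp.2]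
  set g : ℝ × ℝ → ℝ := fun p => curveLog γ p + (φ p.1 + φ p.2) with hg
  obtain ⟨Mφ, hMφ⟩ := isCompact_Icc.exists_bound_of_continuousOn hφ.continuousOn (s := Icc a b)
  set K : ℝ := |log (c⁻¹ * (b - a))| + 2 * Mφ with hK
  have hglow : ∀ᵐ p ∂(ν.prod ν), -K ≤ g p := by
    filter_upwards [ae_prod_mem hcar hcar] with p hp
    have h1 := curveLog_ge hγ hc hp.1 hp.2
    have h2 := abs_le.1 (hMφ _ hp.1)
    have h3 := abs_le.1 (hMφ _ hp.2)
    simp only [hg, hK]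
    have : curveLog γ (p.1, p.2) = curveLog γ p := rfl
    linarith [h2.1, h3.1]
  have hfg : ∀ p, γ p.1 ≠ γ p.2 → f p = (g p : ℝ) := by
    intro p hp
    simp only [hf, hg]
    rw [logKernel_of_ne hp, ← EReal.coe_add]
  have hftop : ∀ p, γ p.1 = γ p.2 → f p = ⊤ := by
    intro p hp
    simp only [hf]
    rw [logKernel_of_eq hp]
    exact EReal.top_add_coe _
  -- A bounded negative part means that the extended energy can be below `⊤` only if the positive
  -- part has finite integral.
  have hneg : ∫⁻ p, (-f p).toENNReal ∂(ν.prod ν) ≤ ENNReal.ofReal K := by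
    calc _ ≤ ∫⁻ p, ENNReal.ofReal K ∂(ν.prod ν) := by
          apply lintegral_mono_ae
          filter_upwards [hglow] with p hp
          by_cases h : γ p.1 = γ p.2
          · rw [hftop p h]
            simp
          · rw [hfg p h, ← EReal.coe_neg, EReal.real_coe_toENNReal]
            exact ENNReal.ofReal_le_ofReal (by linarith)
      _ = _ := by simp
  have hpos : ∫⁻ p, (f p).toENNReal ∂(ν.prod ν) ≠ ⊤ := by
    intro htop
    rw [energy, eintegral] at hfin
    rw [lintegral_congr_ae (g := fun p => (f p).toENNReal)
      (by filter_upwards [hae] with p hp; rw [hp]), htop,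
      lintegral_congr_ae (g := fun p => (-f p).toENNReal)
      (by filter_upwards [hae] with p hp; rw [hp])] at hfin
    have hne : ∫⁻ p, (-f p).toENNReal ∂(ν.prod ν) ≠ ⊤ :=
      (hneg.trans_lt ENNReal.ofReal_lt_top).ne
    rw [← EReal.coe_ennreal_toReal hne, EReal.coe_ennreal_top, EReal.top_sub_coe] at hfin
    exact lt_irrefl _ hfin
  -- The kernel is infinite on the diagonal, so finiteness makes the diagonal null; an atom at `x`
  -- would give the point `(x, x)` the positive mass `ν {x} ²`.
  have hlt : ∀ᵐ p ∂(ν.prod ν), (f p).toENNReal < ⊤ :=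
    ae_lt_top hfm.ereal_toENNReal hpos
  have hdiag : ∀ᵐ p ∂(ν.prod ν), γ p.1 ≠ γ p.2 := by
    filter_upwards [hlt] with p hp h
    rw [hftop p h] at hp
    simp at hp
  have hatom : NullSingletonClass ν := by
    refine ⟨fun x => ?_⟩
    have h1 : (ν.prod ν) ({x} ×ˢ {x}) = 0 := by
      refine measure_mono_null ?_ (ae_iff.1 hdiag)
      rintro ⟨u, v⟩ ⟨hu, hv⟩
      simp only [mem_singleton_iff] at hu hv
      simp [hu, hv]
    rw [Measure.prod_prod] at h1
    simpa using h1
  refine ⟨hν.prob, hcar, hatom, ?_⟩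
  have hgm : Measurable g :=
    (measurable_curveLog hγ.continuous.measurable).add
      (((hφ.comp continuous_fst).add (hφ.comp continuous_snd)).measurable)
  have hgi : Integrable (fun p => g p + K) (ν.prod ν) := by
    refine ⟨(hgm.add_const K).aestronglyMeasurable, ?_⟩
    rw [hasFiniteIntegral_iff_ofReal (by
      filter_upwards [hglow] with p hp
      simp only [Pi.zero_apply]
      linarith)]
    calc ∫⁻ p, ENNReal.ofReal (g p + K) ∂(ν.prod ν)
        ≤ ∫⁻ p, ((f p).toENNReal + ENNReal.ofReal K) ∂(ν.prod ν) := by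
          apply lintegral_mono_ae
          filter_upwards [hdiag] with p hp
          rw [hfg p hp, EReal.real_coe_toENNReal]
          exact ENNReal.ofReal_add_le
      _ = ∫⁻ p, (f p).toENNReal ∂(ν.prod ν) + ENNReal.ofReal K := by
          rw [lintegral_add_right _ measurable_const]
          simp
      _ < ⊤ := ENNReal.add_lt_top.2 ⟨hpos.lt_top, ENNReal.ofReal_lt_top⟩
  have hi : Integrable φ ν := integrable_of_continuous hcar hφ
  refine ((hgi.sub ((hi.comp_fst ν).add (hi.comp_snd ν))).sub (integrable_const K)).congr
    (.of_forall fun p => ?_)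
  simp only [Pi.sub_apply, Pi.add_apply, hg]
  ring

/-! ### The logarithmic distance as a quadratic form -/

/-- On each piece of a Hahn decomposition both sides equal the larger of the two measures. The
identity lets `α` and `β` replace the Jordan parts in bilinear expressions. -/
lemma sub_add_eq_sub_add (α β : Measure ℝ) [IsFiniteMeasure α] [IsFiniteMeasure β] :
    (α - β) + β = (β - α) + α := by
  obtain ⟨s, hs⟩ := exists_isHahnDecomposition α β
  have key : ∀ (α β : Measure ℝ) [IsFiniteMeasure α] [IsFiniteMeasure β] (s : Set ℝ),
      MeasurableSet s → α.restrict s ≤ β.restrict s →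
      ((α - β) + β).restrict s = ((β - α) + α).restrict s := by
    intro α β _ _ s hs hle
    rw [Measure.restrict_add, Measure.restrict_add,
      Measure.restrict_sub_eq_restrict_sub_restrict hs,
      Measure.restrict_sub_eq_restrict_sub_restrict hs, Measure.sub_eq_zero_of_le hle, zero_add,
      Measure.sub_add_cancel_of_le hle]
  have h1 := key α β s hs.measurableSet hs.le_on
  have h2 := key β α sᶜ hs.measurableSet.compl hs.ge_on_compl
  rw [← Measure.restrict_add_restrict_compl (μ := (α - β) + β) hs.measurableSet, h1, ← h2,
    Measure.restrict_add_restrict_compl hs.measurableSet]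

lemma curveLog_swap (γ : ℝ → ℂ) (p : ℝ × ℝ) : curveLog γ p.swap = curveLog γ p := by
  simp [curveLog, norm_sub_rev]

lemma integral_curveLog_swap (γ : ℝ → ℂ) (α β : Measure ℝ) [SFinite α] [SFinite β] :
    ∫ p, curveLog γ p ∂(β.prod α) = ∫ p, curveLog γ p ∂(α.prod β) := by
  rw [← integral_prod_swap]
  simp_rw [curveLog_swap]

lemma integrable_curveLog_swap {α β : Measure ℝ} [SFinite α] [SFinite β]
    (h : Integrable (curveLog γ) (α.prod β)) : Integrable (curveLog γ) (β.prod α) :=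
  h.swap.congr (.of_forall fun p => curveLog_swap γ p)

/-- The Jordan parts are dominated by `α` and `β`, so all mutual energies are finite. Testing `P + β
= Q + α` against `P`, `Q`, `α` and `β` leaves a linear computation. -/
lemma integral_diffSq {α β : Measure ℝ} [IsFiniteMeasure α] [IsFiniteMeasure β]
    (hα : Integrable (curveLog γ) (α.prod α)) (hαβ : Integrable (curveLog γ) (α.prod β))
    (hβ : Integrable (curveLog γ) (β.prod β)) :
    Integrable (curveLog γ) (diffSqPos α β + diffSqNeg α β) ∧
    (∫ p, curveLog γ p ∂(diffSqPos α β)) - ∫ p, curveLog γ p ∂(diffSqNeg α β) =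
      quadDiff (curveLog γ) α β := by
  have hβα := integrable_curveLog_swap hαβ
  have hP : α - β ≤ α := Measure.sub_le
  have hQ : β - α ≤ β := Measure.sub_le
  have mono : ∀ {μ₁ μ₂ ν₁ ν₂ : Measure ℝ} [IsFiniteMeasure μ₁] [IsFiniteMeasure μ₂]
      [IsFiniteMeasure ν₁] [IsFiniteMeasure ν₂], μ₁ ≤ ν₁ → μ₂ ≤ ν₂ →
      Integrable (curveLog γ) (ν₁.prod ν₂) → Integrable (curveLog γ) (μ₁.prod μ₂) :=
    fun h1 h2 h => h.mono_measure (Measure.prod_mono h1 h2)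
  set P := α - β
  set Q := β - α
  have iPP := mono hP hP hα
  have iQQ := mono hQ hQ hβ
  have iPQ := mono hP hQ hαβ
  have iQP := mono hQ hP hβα
  have iPα := mono hP le_rfl hα
  have iPβ := mono hP le_rfl hαβ
  have iQα := mono hQ le_rfl hβα
  have iQβ := mono hQ le_rfl hβ
  have hadd : P + β = Q + α := sub_add_eq_sub_add α β
  refine ⟨(iPP.add_measure iQQ).add_measure (iPQ.add_measure iQP), ?_⟩
  rw [diffSqPos, diffSqNeg, integral_add_measure iPP iQQ, integral_add_measure iPQ iQP, quadDiff]
  have e : ∀ (ν : Measure ℝ) [IsFiniteMeasure ν], Integrable (curveLog γ) (ν.prod P) →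
      Integrable (curveLog γ) (ν.prod Q) → Integrable (curveLog γ) (ν.prod α) →
      Integrable (curveLog γ) (ν.prod β) →
      (∫ p, curveLog γ p ∂(ν.prod P)) + ∫ p, curveLog γ p ∂(ν.prod β) =
      (∫ p, curveLog γ p ∂(ν.prod Q)) + ∫ p, curveLog γ p ∂(ν.prod α) := by
    intro ν _ h1 h2 h3 h4
    rw [← integral_add_measure h1 h4, ← integral_add_measure h2 h3, ← Measure.prod_add,
      ← Measure.prod_add, hadd]
  have e1 := e P iPP iPQ iPα iPβ
  have e2 := e Q iQP iQQ iQα iQβ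
  have e3 := e α (integrable_curveLog_swap iPα) (integrable_curveLog_swap iQα) hα hαβ
  have e4 := e β (integrable_curveLog_swap iPβ) (integrable_curveLog_swap iQβ) hβα hβ
  have s1 := integral_curveLog_swap γ α P
  have s2 := integral_curveLog_swap γ α Q
  have s3 := integral_curveLog_swap γ β P
  have s4 := integral_curveLog_swap γ β Q
  have s5 := integral_curveLog_swap γ α β
  linarith

/-- For admissible measures the infinite branch of the definition is excluded and the kernel may be
taken real-valued, since the diagonal is null. -/
lemma logDist_eq {γ₀ : ℝ → ℂ} (hγ : IsRegularCurve a b c Λ R γ) (hc : 0 < c)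
    (hγ₀ : ∀ x ∈ Icc a b, γ₀ x = γ x) {α β : Measure ℝ}
    (hα : IsAdmissible a b γ α) (hβ : IsAdmissible a b γ β) :
    logDist γ₀ α β = ENNReal.ofReal (√(quadDiff (curveLog γ) α β)) := by
  have := hα.prob
  have := hβ.prob
  have := hα.atomless
  have := hβ.atomless
  obtain ⟨hi, he⟩ := integral_diffSq hα.integrable (hα.cross hγ hc hβ) hβ.integrable
  have hP : α - β ≤ α := Measure.sub_le
  have hQ : β - α ≤ β := Measure.sub_le
  have good : ∀ (μ ν : Measure ℝ) [IsFiniteMeasure μ] [IsFiniteMeasure ν] [NullSingletonClass ν],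
      (∀ᵐ x ∂μ, x ∈ Icc a b) → (∀ᵐ x ∂ν, x ∈ Icc a b) → ∀ᵐ p ∂(μ.prod ν),
      p.1 ∈ Icc a b ∧ p.2 ∈ Icc a b ∧ p.1 ≠ p.2 := by
    intro μ ν _ _ _ h1 h2
    filter_upwards [ae_prod_mem h1 h2, ae_ne_of_noAtoms μ ν] with p hp hne
    exact ⟨hp.1, hp.2, hne⟩
  have hgood : ∀ᵐ p ∂(diffSqPos α β + diffSqNeg α β),
      p.1 ∈ Icc a b ∧ p.2 ∈ Icc a b ∧ p.1 ≠ p.2 := by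
    simp only [diffSqPos, diffSqNeg, ae_add_measure_iff]
    refine ⟨⟨?_, ?_⟩, ?_, ?_⟩
    · exact ae_mono (Measure.prod_mono hP hP) (good α α hα.carried hα.carried)
    · exact ae_mono (Measure.prod_mono hQ hQ) (good β β hβ.carried hβ.carried)
    · exact ae_mono (Measure.prod_mono hP hQ) (good α β hα.carried hβ.carried)
    · exact ae_mono (Measure.prod_mono hQ hP) (good β α hβ.carried hα.carried)
  have hinj := hγ.injOn hc
  have hae : ∀ᵐ p ∂(diffSqPos α β + diffSqNeg α β), logKernel γ₀ p = (curveLog γ p : ℝ) := by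
    filter_upwards [hgood] with p hp
    have : γ₀ p.1 ≠ γ₀ p.2 := by
      rw [hγ₀ _ hp.1, hγ₀ _ hp.2.1]
      exact fun h => hp.2.2 (hinj hp.1 hp.2.1 h)
    rw [logKernel_of_ne this]
    simp only [curveLog, hγ₀ _ hp.1, hγ₀ _ hp.2.1]
  have hfin : ∫⁻ p, (logKernel γ₀ p).abs ∂(diffSqPos α β + diffSqNeg α β) ≠ ⊤ := by
    rw [lintegral_congr_ae (g := fun p => ENNReal.ofReal |curveLog γ p|)
      (by filter_upwards [hae] with p hp; rw [hp, EReal.abs_def])]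
    exact hi.abs.lintegral_lt_top.ne
  obtain ⟨h1, h2⟩ := ae_add_measure_iff.1 hae
  rw [logDist, if_neg hfin, ← he]
  congr 3
  · refine integral_congr_ae ?_
    filter_upwards [h1] with p hp
    rw [hp, EReal.toReal_coe]
  · refine integral_congr_ae ?_
    filter_upwards [h2] with p hp
    rw [hp, EReal.toReal_coe]

end Energy

end CurveGas
end

/-! ### Mixtures of measures and the first variation of the energy -/

noncomputable section
namespace CurveGas
open Filter Topology Real

section Mixture

variable {a b a' b' c Λ R : ℝ} {γ : ℝ → ℂ}

/-- Convex combination of two measures. -/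
def mix (s : ℝ) (m n : Measure ℝ) : Measure ℝ := ENNReal.ofReal (1 - s) • m + ENNReal.ofReal s • n

lemma isProbabilityMeasure_mix {s : ℝ} (hs : s ∈ Icc (0 : ℝ) 1) (m n : Measure ℝ)
    [IsProbabilityMeasure m] [IsProbabilityMeasure n] : IsProbabilityMeasure (mix s m n) := by
  refine ⟨?_⟩
  simp only [mix, Measure.add_apply, Measure.smul_apply, measure_univ, smul_eq_mul, mul_one]
  rw [← ENNReal.ofReal_add (by linarith [hs.2]) hs.1]
  simp

lemma integral_mix {s : ℝ} (hs : s ∈ Icc (0 : ℝ) 1) {m n : Measure ℝ} {f : ℝ → ℝ}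
    (hm : Integrable f m) (hn : Integrable f n) :
    ∫ x, f x ∂(mix s m n) = (1 - s) * (∫ x, f x ∂m) + s * ∫ x, f x ∂n := by
  rw [mix, integral_add_measure (hm.smul_measure ENNReal.ofReal_ne_top)
    (hn.smul_measure ENNReal.ofReal_ne_top), integral_smul_measure, integral_smul_measure,
    ENNReal.toReal_ofReal (by linarith [hs.2]), ENNReal.toReal_ofReal hs.1]
  rfl

lemma mix_prod (s : ℝ) (m n : Measure ℝ) [IsFiniteMeasure m] [IsFiniteMeasure n] :
    (mix s m n).prod (mix s m n) =
      (ENNReal.ofReal (1 - s) * ENNReal.ofReal (1 - s)) • m.prod m +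
      (ENNReal.ofReal (1 - s) * ENNReal.ofReal s) • m.prod n +
      ((ENNReal.ofReal s * ENNReal.ofReal (1 - s)) • n.prod m +
      (ENNReal.ofReal s * ENNReal.ofReal s) • n.prod n) := by
  have : IsFiniteMeasure (ENNReal.ofReal (1 - s) • m) := m.smul_finite ENNReal.ofReal_ne_top
  have : IsFiniteMeasure (ENNReal.ofReal s • n) := n.smul_finite ENNReal.ofReal_ne_top
  rw [mix, Measure.prod_add, Measure.add_prod, Measure.add_prod]
  simp only [Measure.prod_smul_left, Measure.prod_smul_right, smul_smul]
  rw [mul_comm (ENNReal.ofReal s) (ENNReal.ofReal (1 - s))]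
  abel

lemma isAdmissible_mix (hγ : IsRegularCurve a' b' c Λ R γ) (hc : 0 < c) (ha : a' ≤ a) (hb : b ≤ b')
    {s : ℝ} (hs : s ∈ Icc (0 : ℝ) 1) {m n : Measure ℝ} (hm : IsAdmissible a b γ m)
    (hn : IsAdmissible a b γ n) : IsAdmissible a b γ (mix s m n) ∧
    ∫ p, curveLog γ p ∂((mix s m n).prod (mix s m n)) =
      (1 - s) ^ 2 * (∫ p, curveLog γ p ∂(m.prod m)) +
      2 * s * (1 - s) * (∫ p, curveLog γ p ∂(m.prod n)) + s ^ 2 * ∫ p, curveLog γ p ∂(n.prod n) := by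
  have := hm.prob
  have := hn.prob
  have := hm.atomless
  have := hn.atomless
  have i1 := hm.integrable
  have i2 := (hm.mono ha hb).cross hγ hc (hn.mono ha hb)
  have i3 := integrable_curveLog_swap i2
  have i4 := hn.integrable
  have t : ∀ x y : ℝ, ENNReal.ofReal x * ENNReal.ofReal y ≠ ⊤ :=
    fun x y => ENNReal.mul_ne_top ENNReal.ofReal_ne_top ENNReal.ofReal_ne_top
  have j1 := i1.smul_measure (t (1 - s) (1 - s))
  have j2 := i2.smul_measure (t (1 - s) s)
  have j3 := i3.smul_measure (t s (1 - s))
  have j4 := i4.smul_measure (t s s)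
  constructor
  · refine ⟨isProbabilityMeasure_mix hs m n, ?_, ?_, ?_⟩
    · rw [mix, ae_add_measure_iff]
      exact ⟨Measure.ae_smul_measure hm.carried _, Measure.ae_smul_measure hn.carried _⟩
    · refine ⟨fun x => ?_⟩
      simp [mix]
    · rw [mix_prod]
      exact (j1.add_measure j2).add_measure (j3.add_measure j4)
  · rw [mix_prod, integral_add_measure (j1.add_measure j2) (j3.add_measure j4),
      integral_add_measure j1 j2, integral_add_measure j3 j4]
    simp only [integral_smul_measure, ENNReal.toReal_mul, smul_eq_mul,
      ENNReal.toReal_ofReal hs.1, ENNReal.toReal_ofReal (by linarith [hs.2] : 0 ≤ 1 - s)]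
    rw [integral_curveLog_swap γ m n]
    ring

lemma realEnergy_mix (hγ : IsRegularCurve a' b' c Λ R γ) (hc : 0 < c) (ha : a' ≤ a) (hb : b ≤ b')
    {φ : ℝ → ℝ} (hφ : Continuous φ)
    {s : ℝ} (hs : s ∈ Icc (0 : ℝ) 1) {m n : Measure ℝ} (hm : IsAdmissible a b γ m)
    (hn : IsAdmissible a b γ n) : realEnergy γ φ (mix s m n) =
      (1 - s) ^ 2 * (∫ p, curveLog γ p ∂(m.prod m)) +
      2 * s * (1 - s) * (∫ p, curveLog γ p ∂(m.prod n)) + s ^ 2 * (∫ p, curveLog γ p ∂(n.prod n)) +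
      2 * ((1 - s) * (∫ x, φ x ∂m) + s * ∫ x, φ x ∂n) := by
  have := hm.prob
  have := hn.prob
  rw [realEnergy, (isAdmissible_mix hγ hc ha hb hs hm hn).2,
    integral_mix hs (integrable_of_continuous hm.carried hφ)
      (integrable_of_continuous hn.carried hφ)]

/-- Variational inequality for the minimiser. -/
lemma variational_inequality (hγ : IsRegularCurve a' b' c Λ R γ) (hc : 0 < c) (ha : a' ≤ a)
    (hb : b ≤ b') {φ : ℝ → ℝ} (hφ : Continuous φ) {μ : Measure ℝ} (hμ : IsAdmissible a b γ μ)
    (hmin : ∀ ρ, IsAdmissible a b γ ρ → realEnergy γ φ μ ≤ realEnergy γ φ ρ)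
    {n : Measure ℝ} (hn : IsAdmissible a b γ n) :
    (∫ p, curveLog γ p ∂(μ.prod μ)) + ∫ x, φ x ∂μ ≤
      (∫ p, curveLog γ p ∂(μ.prod n)) + ∫ x, φ x ∂n := by
  set A := ∫ p, curveLog γ p ∂(μ.prod μ)
  set B := ∫ p, curveLog γ p ∂(μ.prod n)
  set C := ∫ p, curveLog γ p ∂(n.prod n)
  set P := ∫ x, φ x ∂μ
  set Q := ∫ x, φ x ∂n
  have key : ∀ k : ℕ, -((A - 2 * B + C) / 2 * (1 / ((k : ℝ) + 1))) ≤ (B + Q) - (A + P) := by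
    intro k
    -- A mixture of weight `s` changes the energy by `2 s` times the first variation plus `O(s²)`;
    -- division by `s` and `k → ∞` isolate the first variation.
    set s : ℝ := 1 / ((k : ℝ) + 1) with hsdef
    have hs0 : 0 < s := by positivity
    have hs1 : s ≤ 1 := by
      rw [hsdef, div_le_one (by positivity)]
      simp
    have h := hmin _ (isAdmissible_mix hγ hc ha hb ⟨hs0.le, hs1⟩ hμ hn).1
    rw [realEnergy_mix hγ hc ha hb hφ ⟨hs0.le, hs1⟩ hμ hn, realEnergy] at h
    have h2 : 0 ≤ s * (2 * ((B + Q) - (A + P)) + s * (A - 2 * B + C)) := by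
      simp only [A, B, C, P, Q]
      linarith
    have h3 := nonneg_of_mul_nonneg_right h2 hs0
    linarith
  have hlim : Tendsto (fun k : ℕ => -((A - 2 * B + C) / 2 * (1 / ((k : ℝ) + 1)))) atTop
      (𝓝 (-((A - 2 * B + C) / 2 * 0))) :=
    (tendsto_one_div_add_atTop_nhds_zero_nat.const_mul _).neg
  have := le_of_tendsto' hlim key
  simp at this
  linarith

end Mixture

/-! ### Affine contractions and coercivity of the energy -/

section Affine

variable {a b a' b' c Λ R : ℝ} {γ : ℝ → ℂ}

/-- An affine map shifts the kernel of the line by exactly `-log κ`, without any loss at the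
singularity; the chord part is Lipschitz and moves by at most `2 Λ δ`. -/
lemma abs_curveLog_affine_sub_le (hγ : IsRegularCurve a' b' c Λ R γ) (hΛ : 0 ≤ Λ) {T : ℝ → ℝ}
    {κ δ : ℝ} (hκ : 0 < κ) (hT : ∀ x y, T x - T y = κ * (x - y)) {x y : ℝ}
    (hx : x ∈ Icc a' b') (hy : y ∈ Icc a' b') (hTx : T x ∈ Icc a' b') (hTy : T y ∈ Icc a' b')
    (hxy : x ≠ y) (dx : |T x - x| ≤ δ) (dy : |T y - y| ≤ δ) :
    |curveLog γ (T x, T y) - curveLog γ (x, y)| ≤ |log κ| + 2 * Λ * δ := by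
  have hne : T x ≠ T y := by
    intro h
    have h1 := hT x y
    rw [h, sub_self] at h1
    rcases mul_eq_zero.1 h1.symm with h2 | h2
    · exact hκ.ne' h2
    · exact hxy (sub_eq_zero.1 h2)
  have h1 := hγ.chord _ hTx _ hTy x hx y hy hne hxy
  rw [curveLog_eq, curveLog_eq]
  have h2 : lineLog (T x, T y) = lineLog (x, y) - log κ := by
    simp only [lineLog]
    rw [hT x y, abs_mul, log_mul (abs_ne_zero.2 hκ.ne') (abs_ne_zero.2 (sub_ne_zero.2 hxy)),
      abs_of_pos hκ]
    ring
  rw [h2]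
  have e : lineLog (x, y) - log κ - chordLog γ (T x, T y) - (lineLog (x, y) - chordLog γ (x, y)) =
    -log κ - (chordLog γ (T x, T y) - chordLog γ (x, y)) := by ring
  rw [e]
  refine (abs_sub _ _).trans ?_
  rw [abs_neg]
  have : Λ * (|T x - x| + |T y - y|) ≤ Λ * (δ + δ) := by gcongr
  linarith

lemma integral_curveLog_affine (hγ : IsRegularCurve a' b' c Λ R γ) (hc : 0 < c) (hΛ : 0 ≤ Λ)
    {T : ℝ → ℝ} {κ δ : ℝ} (hκ : 0 < κ) (hT : ∀ x y, T x - T y = κ * (x - y)) (hTm : Measurable T)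
    {α β : Measure ℝ} (hα : IsAdmissible a' b' γ α) (hβ : IsAdmissible a' b' γ β)
    (hTα : ∀ᵐ x ∂α, T x ∈ Icc a' b' ∧ |T x - x| ≤ δ)
    (hTβ : ∀ᵐ x ∂β, T x ∈ Icc a' b' ∧ |T x - x| ≤ δ) :
    Integrable (curveLog γ) ((α.map T).prod (β.map T)) ∧
    |(∫ p, curveLog γ p ∂((α.map T).prod (β.map T))) - ∫ p, curveLog γ p ∂(α.prod β)| ≤
      |log κ| + 2 * Λ * δ := by
  have := hα.prob
  have := hβ.prob
  have := hβ.atomless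
  have hm := measurable_curveLog hγ.continuous.measurable
  have hi := hα.cross hγ hc hβ
  have hae : ∀ᵐ p ∂(α.prod β), ‖curveLog γ (T p.1, T p.2) - curveLog γ p‖ ≤
      |log κ| + 2 * Λ * δ := by
    filter_upwards [ae_prod_mem hα.carried hβ.carried, ae_ne_of_noAtoms α β,
      Measure.quasiMeasurePreserving_fst.ae hTα, Measure.quasiMeasurePreserving_snd.ae hTβ]
      with p hp hne h1 h2
    exact abs_curveLog_affine_sub_le hγ hΛ hκ hT hp.1 hp.2 h1.1 h2.1 hne h1.2 h2.2
  have hm2 : Measurable fun p : ℝ × ℝ => curveLog γ (T p.1, T p.2) := by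
    apply hm.comp
    fun_prop
  have hd : Integrable (fun p : ℝ × ℝ => curveLog γ (T p.1, T p.2) - curveLog γ p) (α.prod β) :=
    (integrable_const (|log κ| + 2 * Λ * δ)).mono' (hm2.sub hm).aestronglyMeasurable hae
  have hi2 : Integrable (fun p : ℝ × ℝ => curveLog γ (T p.1, T p.2)) (α.prod β) :=
    (hd.add hi).congr (.of_forall fun p => by simp)
  rw [Measure.map_prod_map α β hTm hTm]
  constructor
  · rw [integrable_map_measure hm.aestronglyMeasurable (by fun_prop)]
    exact hi2
  · rw [integral_map (by fun_prop) hm.aestronglyMeasurable]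
    have e : (∫ p : ℝ × ℝ, curveLog γ (Prod.map T T p) ∂(α.prod β)) -
        ∫ p, curveLog γ p ∂(α.prod β) =
        ∫ p : ℝ × ℝ, (curveLog γ (T p.1, T p.2) - curveLog γ p) ∂(α.prod β) := by
      rw [integral_sub hi2 hi]
      rfl
    rw [e]
    have := norm_integral_le_of_norm_le_const hae
    simpa using this

lemma isAdmissible_map_affine (hγ : IsRegularCurve a' b' c Λ R γ) (hc : 0 < c) (hΛ : 0 ≤ Λ)
    (ha : a' ≤ a) (hb : b ≤ b')
    {T : ℝ → ℝ} {κ δ : ℝ} (hκ : 0 < κ) (hT : ∀ x y, T x - T y = κ * (x - y)) (hTm : Measurable T)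
    {α : Measure ℝ} (hα : IsAdmissible a' b' γ α)
    (hTα : ∀ᵐ x ∂α, T x ∈ Icc a b ∧ |T x - x| ≤ δ) : IsAdmissible a b γ (α.map T) := by
  have := hα.prob
  have := hα.atomless
  have h2 : ∀ᵐ x ∂α, T x ∈ Icc a' b' ∧ |T x - x| ≤ δ := by
    filter_upwards [hTα] with x hx
    exact ⟨⟨ha.trans hx.1.1, hx.1.2.trans hb⟩, hx.2⟩
  refine ⟨Measure.isProbabilityMeasure_map hTm.aemeasurable, ?_, ?_,
    (integral_curveLog_affine hγ hc hΛ hκ hT hTm hα hα h2 h2).1⟩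
  · exact (ae_map_iff hTm.aemeasurable (p := fun x => x ∈ Icc a b) measurableSet_Icc).2
      (hTα.mono fun x hx => hx.1)
  · refine ⟨fun z => ?_⟩
    rw [Measure.map_apply hTm (measurableSet_singleton z)]
    refine Set.Subsingleton.measure_zero ?_ α
    intro x hx y hy
    have h1 := hT x y
    rw [mem_preimage, mem_singleton_iff] at hx hy
    rw [hx, hy, sub_self] at h1
    rcases mul_eq_zero.1 h1.symm with h2 | h2
    · exact absurd h2 hκ.ne'
    · exact sub_eq_zero.1 h2

/-- Coercivity of the energy around the minimiser, for competitors that may leave `[a, b]` by a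
distance `ρ`. -/
theorem energy_coercive (hγ : IsRegularCurve a' b' c Λ R γ) (hc : 0 < c) (hΛ : 0 ≤ Λ)
    (ha : a' ≤ a) (hb : b ≤ b') (hab : a < b) {φ : ℝ → ℝ} (hφ : Continuous φ) {M : ℝ}
    (hφM : ∀ x ∈ Icc a b, ∀ y ∈ Icc a b, |φ x - φ y| ≤ M * |x - y|) (hM : 0 ≤ M)
    {μ : Measure ℝ} (hμ : IsAdmissible a b γ μ)
    (hmin : ∀ ρ, IsAdmissible a b γ ρ → realEnergy γ φ μ ≤ realEnergy γ φ ρ)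
    {L : Measure ℝ} (hL : IsAdmissible a' b' γ L) {ρ : ℝ} (hρ : 0 < ρ)
    (hLρ : ∀ᵐ x ∂L, x ∈ Icc (a - ρ) (b + ρ)) {r : ℝ}
    (hr : ∀ T : ℝ → ℝ, Measurable T → (∀ x ∈ Icc (a - ρ) (b + ρ), T x ∈ Icc a b ∧ |T x - x| ≤ ρ) →
      ∫ x, φ (T x) ∂L ≤ r + 4 * M * ρ) {s : ℝ} (hs0 : 0 < s) (hs1 : s ≤ 1) :
    realEnergy γ φ μ + (1 - s) * quadDiff (curveLog γ) L μ -
      ((2 / (b - a) + 2 * Λ + 8 * M) * ρ) / s ≤ (∫ p, curveLog γ p ∂(L.prod L)) + 2 * r := by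
  have := hμ.prob
  have := hL.prob
  have hμ' := hμ.mono ha hb
  set ℓ := (b - a) / 2 with hℓdef
  have hℓ : 0 < ℓ := by simp only [hℓdef]; linarith
  set m₀ := (a + b) / 2 with hm₀
  -- The contraction about the midpoint that maps `[a - ρ, b + ρ]` onto `[a, b]`.
  set κ := ℓ / (ℓ + ρ) with hκdef
  have hκ : 0 < κ := by positivity
  set T : ℝ → ℝ := fun x => m₀ + κ * (x - m₀) with hTdef
  have hT : ∀ x y, T x - T y = κ * (x - y) := fun x y => by simp only [hTdef]; ring
  have hTm : Measurable T := by simp only [hTdef]; fun_prop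
  have hTI : ∀ x ∈ Icc (a - ρ) (b + ρ), T x ∈ Icc a b ∧ |T x - x| ≤ ρ := by
    intro x hx
    have h1 : |x - m₀| ≤ ℓ + ρ := by
      rw [abs_le]
      simp only [hm₀, hℓdef]
      constructor <;> linarith [hx.1, hx.2]
    have h2 : |κ * (x - m₀)| ≤ ℓ := by
      rw [abs_mul, abs_of_pos hκ, hκdef]
      calc ℓ / (ℓ + ρ) * |x - m₀| ≤ ℓ / (ℓ + ρ) * (ℓ + ρ) := by gcongr
        _ = ℓ := by field_simp
    have h3 := abs_le.1 h2
    refine ⟨⟨?_, ?_⟩, ?_⟩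
    · simp only [hTdef]
      have : a = m₀ - ℓ := by simp only [hm₀, hℓdef]; ring
      linarith [h3.1]
    · simp only [hTdef]
      have : b = m₀ + ℓ := by simp only [hm₀, hℓdef]; ring
      linarith [h3.2]
    · have e : T x - x = -((ρ / (ℓ + ρ)) * (x - m₀)) := by
        simp only [hTdef, hκdef]
        field_simp
        ring
      rw [e, abs_neg, abs_mul, abs_of_pos (by positivity : 0 < ρ / (ℓ + ρ))]
      calc ρ / (ℓ + ρ) * |x - m₀| ≤ ρ / (ℓ + ρ) * (ℓ + ρ) := by gcongr
        _ = ρ := by field_simp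
  have hlogκ : |log κ| ≤ 2 / (b - a) * ρ := by
    have h1 : log κ = -log (1 + ρ / ℓ) := by
      rw [← log_inv]
      congr 1
      rw [hκdef]
      field_simp
    rw [h1, abs_neg, abs_of_nonneg (log_nonneg (by
      have : 0 < ρ / ℓ := by positivity
      linarith))]
    calc log (1 + ρ / ℓ) ≤ (1 + ρ / ℓ) - 1 := log_le_sub_one_of_pos (by positivity)
      _ = 2 / (b - a) * ρ := by
        have : b - a ≠ 0 := by linarith
        simp only [hℓdef]
        field_simp
        ring
  have hTL : ∀ᵐ x ∂L, T x ∈ Icc a b ∧ |T x - x| ≤ ρ := by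
    filter_upwards [hLρ] with x hx using hTI x hx
  have hTμ : ∀ᵐ x ∂μ, T x ∈ Icc a b ∧ |T x - x| ≤ ρ := by
    filter_upwards [hμ.carried] with x hx using
      hTI x ⟨by linarith [hx.1], by linarith [hx.2]⟩
  have big : ∀ {x : ℝ}, T x ∈ Icc a b ∧ |T x - x| ≤ ρ → T x ∈ Icc a' b' ∧ |T x - x| ≤ ρ :=
    fun hx => ⟨⟨ha.trans hx.1.1, hx.1.2.trans hb⟩, hx.2⟩
  have aL := isAdmissible_map_affine hγ hc hΛ ha hb hκ hT hTm hL hTL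
  have aμ := isAdmissible_map_affine hγ hc hΛ ha hb hκ hT hTm hμ' hTμ
  have hTL' := hTL.mono fun x hx => big hx
  have hTμ' := hTμ.mono fun x hx => big hx
  have c1 := (abs_le.1 (integral_curveLog_affine hγ hc hΛ hκ hT hTm hμ' hμ' hTμ' hTμ').2).2
  have c2 := (abs_le.1 (integral_curveLog_affine hγ hc hΛ hκ hT hTm hμ' hL hTμ' hTL').2).2
  have c3 := (abs_le.1 (integral_curveLog_affine hγ hc hΛ hκ hT hTm hL hL hTL' hTL').2).2
  have hiφ := integrable_of_continuous hμ.carried hφ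
  have c4 : ∫ x, φ x ∂(μ.map T) ≤ (∫ x, φ x ∂μ) + M * ρ := by
    rw [integral_map hTm.aemeasurable hφ.aestronglyMeasurable]
    have h1 : ∫ x, φ (T x) ∂μ ≤ ∫ x, (φ x + M * ρ) ∂μ := by
      apply integral_mono_ae _ (hiφ.add (integrable_const _))
      · filter_upwards [hTμ, hμ.carried] with x hx hx'
        have h2 := (le_abs_self _).trans (hφM _ hx.1 _ hx')
        have h3 : M * |T x - x| ≤ M * ρ := by gcongr; exact hx.2
        simp only [Pi.add_apply]
        linarith
      · refine (hiφ.norm.add (integrable_const (M * ρ))).mono'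
          (hφ.measurable.comp hTm).aestronglyMeasurable ?_
        filter_upwards [hTμ, hμ.carried] with x hx hx'
        have h2 := hφM _ hx.1 _ hx'
        have h3 : M * |T x - x| ≤ M * ρ := by gcongr; exact hx.2
        have h4 := norm_le_norm_add_norm_sub' (φ (T x)) (φ x)
        simp only [Pi.add_apply]
        have : ‖φ (T x) - φ x‖ = |φ (T x) - φ x| := rfl
        linarith
    rw [integral_add hiφ (integrable_const _)] at h1
    simpa using h1
  have c5 : ∫ x, φ x ∂(L.map T) ≤ r + 4 * M * ρ := by
    rw [integral_map hTm.aemeasurable hφ.aestronglyMeasurable]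
    exact hr T hTm hTI
  -- The competitor mixes the images of both `μ` and `L` under the same `T`, so that each of the
  -- three bilinear terms changes by at most `e`.
  have h := hmin _ (isAdmissible_mix hγ hc ha hb ⟨hs0.le, hs1⟩ aμ aL).1
  rw [realEnergy_mix hγ hc ha hb hφ ⟨hs0.le, hs1⟩ aμ aL] at h
  rw [quadDiff, integral_curveLog_swap γ μ L]
  rw [realEnergy] at h ⊢
  set A := ∫ p, curveLog γ p ∂(μ.prod μ)
  set B := ∫ p, curveLog γ p ∂(μ.prod L)
  set C := ∫ p, curveLog γ p ∂(L.prod L)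
  set P := ∫ x, φ x ∂μ
  set e := |log κ| + 2 * Λ * ρ with he
  have he0 : 0 ≤ e := by positivity
  have hs1' : 0 ≤ 1 - s := by linarith
  have d1 : (1 - s) ^ 2 * (∫ p, curveLog γ p ∂((μ.map T).prod (μ.map T))) ≤
      (1 - s) ^ 2 * (A + e) := by gcongr; linarith
  have d2 : 2 * s * (1 - s) * (∫ p, curveLog γ p ∂((μ.map T).prod (L.map T))) ≤
      2 * s * (1 - s) * (B + e) := by gcongr; linarith
  have d3 : s ^ 2 * (∫ p, curveLog γ p ∂((L.map T).prod (L.map T))) ≤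
      s ^ 2 * (C + e) := by gcongr; linarith
  have d4 : (1 - s) * (∫ x, φ x ∂(μ.map T)) ≤ (1 - s) * (P + M * ρ) := by gcongr
  have d5 : s * (∫ x, φ x ∂(L.map T)) ≤ s * (r + 4 * M * ρ) := by gcongr
  have hMρ : 0 ≤ M * ρ := by positivity
  have hsMρ : s * (M * ρ) ≤ M * ρ := mul_le_of_le_one_left hMρ hs1
  have key : 0 ≤ s * (2 * (B - A - P + r) + s * (C - 2 * B + A)) + (e + 8 * (M * ρ)) := by
    nlinarith
  have hE : e + 8 * (M * ρ) ≤ (2 / (b - a) + 2 * Λ + 8 * M) * ρ := by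
    rw [he]
    linarith
  -- Division by `s` turns the contraction error `O(ρ)` into `O(ρ) / s`, while the quadratic term
  -- gives up only the fraction `s` of the squared distance.
  have key2 : -(((2 / (b - a) + 2 * Λ + 8 * M) * ρ) / s) ≤
      2 * (B - A - P + r) + s * (C - 2 * B + A) := by
    rw [← neg_div, div_le_iff₀ hs0]
    linarith
  linarith

end Affine

end CurveGas
end

noncomputable section
namespace CurveGas
open Filter Topology Real

/-! ### Measures with bounded density -/

lemma measurable_lineLog : Measurable lineLog := by
  unfold lineLog
  fun_prop

/-- On the square the kernel is, up to sign, the integrand of the convolution of the indicator of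
`[p, q]` with `log` cut off to the possible differences; both are integrable. -/
lemma integrable_lineLog_restrict (p q : ℝ) :
    Integrable lineLog ((volume.restrict (Icc p q)).prod (volume.restrict (Icc p q))) := by
  have h1 : Integrable ((Icc p q).indicator fun _ => (1 : ℝ)) :=
    (integrable_indicator_iff measurableSet_Icc).2
      (integrableOn_const measure_Icc_lt_top.ne)
  have h2 : Integrable ((Icc (p - q) (q - p)).indicator log) := by
    rw [integrable_indicator_iff measurableSet_Icc]
    rcases le_total (p - q) (q - p) with h | h
    · exact (intervalIntegrable_iff_integrableOn_Icc_of_le h).1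
        intervalIntegral.intervalIntegrable_log'
    · exact (integrableOn_singleton (x := p - q) (f := log) (μ := volume) (by simp) (by simp)).mono_set
        fun x hx => le_antisymm (hx.2.trans h) hx.1
  have h3 := h1.convolution_integrand (ContinuousLinearMap.mul ℝ ℝ) h2
  rw [Measure.prod_restrict]
  refine (h3.neg.restrict (s := Icc p q ×ˢ Icc p q)).congr ?_
  filter_upwards [ae_restrict_mem (measurableSet_Icc.prod measurableSet_Icc)] with z hz
  have hz1 : z.1 - z.2 ∈ Icc (p - q) (q - p) :=
    ⟨by linarith [hz.1.1, hz.2.2], by linarith [hz.1.2, hz.2.1]⟩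
  simp [lineLog, hz1, hz.2, log_abs]

lemma integral_lineLog_le {p q : ℝ} (hpq : p < q) :
    ∫ z, lineLog z ∂((volume.restrict (Icc p q)).prod (volume.restrict (Icc p q))) ≤
      (q - p) ^ 2 * (2 - log (q - p)) := by
  -- Tangent line at `q - p` of the convex function `s log s`. Using it at `x - p` and `q - x`
  -- bounds the explicit inner integral uniformly in `x`.
  have young : ∀ A : ℝ, 0 ≤ A → A * log (q - p) + A - (q - p) ≤ A * log A := by
    intro A hA
    have hδ : 0 < q - p := sub_pos.2 hpq
    rcases hA.eq_or_lt with rfl | hA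
    · simp [hpq.le]
    · have h1 := log_le_sub_one_of_pos (div_pos hδ hA)
      rw [log_div hδ.ne' hA.ne'] at h1
      have h2 := mul_le_mul_of_nonneg_left h1 hA.le
      have h3 : A * ((q - p) / A - 1) = (q - p) - A := by field_simp
      linarith
  have inner : ∀ x ∈ Icc p q, ∫ y in Icc p q, lineLog (x, y) ≤ (q - p) * (2 - log (q - p)) := by
    intro x hx
    have e1 : ∫ y in Icc p q, lineLog (x, y) = -∫ y in p..q, log (x - y) := by
      rw [intervalIntegral.integral_of_le hpq.le, integral_Icc_eq_integral_Ioc, ← integral_neg]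
      simp [lineLog, log_abs]
    rw [e1, intervalIntegral.integral_comp_sub_left (fun u => log u), integral_log]
    have h1 := young (x - p) (sub_nonneg.2 hx.1)
    have h2 := young (q - x) (sub_nonneg.2 hx.2)
    have e2 : log (x - q) = log (q - x) := by rw [← log_neg_eq_log, neg_sub]
    rw [e2]
    nlinarith
  have hi := integrable_lineLog_restrict p q
  rw [integral_prod _ hi]
  calc ∫ x in Icc p q, ∫ y in Icc p q, lineLog (x, y)
      ≤ ∫ _ in Icc p q, (q - p) * (2 - log (q - p)) := by
        refine setIntegral_mono_on hi.integral_prod_left (integrableOn_const measure_Icc_lt_top.ne)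
          measurableSet_Icc inner
    _ = _ := by
        rw [setIntegral_const, Real.volume_real_Icc_of_le hpq.le, smul_eq_mul]
        ring

variable {a b a' b' c Λ R : ℝ} {γ : ℝ → ℂ}

lemma IsRegularCurve.abs_chordLog_le (hγ : IsRegularCurve a b c Λ R γ) (hc : 0 < c) {x y : ℝ}
    (hx : x ∈ Icc a b) (hy : y ∈ Icc a b) : |chordLog γ (x, y)| ≤ |log c| := by
  rcases eq_or_ne x y with rfl | hxy
  · simp [chordLog]
  · have h0 : 0 < |x - y| := abs_pos.2 (sub_ne_zero.2 hxy)
    have h1 := hγ.lower x hx y hy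
    have h2 := hγ.upper x hx y hy
    have h3 : 0 < ‖γ x - γ y‖ := (mul_pos hc h0).trans_le h1
    have h4 := log_le_log (mul_pos hc h0) h1
    have h5 := log_le_log h3 h2
    rw [log_mul hc.ne' h0.ne'] at h4
    rw [log_mul (inv_pos.2 hc).ne' h0.ne', log_inv] at h5
    rw [chordLog]
    refine abs_le.2 ⟨?_, ?_⟩
    · linarith [neg_abs_le (log c)]
    · linarith [neg_abs_le (log c)]

lemma IsRegularCurve.integrable_chordLog (hγ : IsRegularCurve a b c Λ R γ) (hc : 0 < c)
    {α β : Measure ℝ} [IsFiniteMeasure α] [IsFiniteMeasure β] (hα : ∀ᵐ x ∂α, x ∈ Icc a b)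
    (hβ : ∀ᵐ x ∂β, x ∈ Icc a b) : Integrable (chordLog γ) (α.prod β) := by
  have hm : Measurable (chordLog γ) := by
    have := hγ.continuous.measurable
    unfold chordLog
    fun_prop
  refine (integrable_const |log c|).mono' hm.aestronglyMeasurable ?_
  filter_upwards [ae_prod_mem hα hβ] with p hp using hγ.abs_chordLog_le hc hp.1 hp.2

lemma integrable_lineLog_of_le {m : Measure ℝ} {K : ℝ≥0∞} (hK : K ≠ ⊤) (h : m ≤ K • volume)
    (hm : ∀ᵐ x ∂m, x ∈ Icc a b) : Integrable lineLog (m.prod m) := by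
  have h1 : m ≤ K • volume.restrict (Icc a b) := by
    rw [← Measure.restrict_smul, ← Measure.restrict_eq_self_of_ae_mem hm]
    exact Measure.restrict_mono subset_rfl h
  have hK' : IsFiniteMeasure (K • volume.restrict (Icc a b)) := Measure.smul_finite _ hK
  have := isFiniteMeasure_of_le _ h1
  refine Integrable.mono_measure ?_ (Measure.prod_mono h1 h1)
  rw [Measure.prod_smul_left, Measure.prod_smul_right, smul_smul]
  exact (integrable_lineLog_restrict a b).smul_measure (ENNReal.mul_ne_top hK hK)

/-- Probability measures with bounded density are admissible. -/
lemma isAdmissible_of_le (hγ : IsRegularCurve a b c Λ R γ) (hc : 0 < c) {m : Measure ℝ}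
    [IsProbabilityMeasure m] {K : ℝ≥0∞} (hK : K ≠ ⊤) (h : m ≤ K • volume)
    (hm : ∀ᵐ x ∂m, x ∈ Icc a b) : IsAdmissible a b γ m := by
  refine ⟨inferInstance, hm, ⟨fun x => ?_⟩, ?_⟩
  · exact le_antisymm ((h {x}).trans (by simp)) zero_le
  · have e : curveLog γ = fun p => lineLog p - chordLog γ p := funext fun p => curveLog_eq γ p
    rw [e]
    exact (integrable_lineLog_of_le hK h hm).sub (hγ.integrable_chordLog hc hm hm)

/-- The uniform law on `[p, q]`. -/
def unif (p q : ℝ) : Measure ℝ := ENNReal.ofReal (q - p)⁻¹ • volume.restrict (Icc p q)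

lemma isProbabilityMeasure_unif {p q : ℝ} (h : p < q) : IsProbabilityMeasure (unif p q) := by
  refine ⟨?_⟩
  have h0 : 0 < q - p := sub_pos.2 h
  rw [unif, Measure.smul_apply, Measure.restrict_apply_univ, Real.volume_Icc, smul_eq_mul,
    ← ENNReal.ofReal_mul (inv_pos.2 h0).le, inv_mul_cancel₀ h0.ne', ENNReal.ofReal_one]

lemma unif_le (p q : ℝ) : unif p q ≤ ENNReal.ofReal (q - p)⁻¹ • volume := by
  rw [unif]
  gcongr
  exact Measure.restrict_le_self

lemma ae_unif_mem (p q : ℝ) : ∀ᵐ x ∂(unif p q), x ∈ Icc p q :=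
  Measure.ae_smul_measure (ae_restrict_mem measurableSet_Icc) _

lemma integral_lineLog_unif_le {p q : ℝ} (hpq : p < q) :
    ∫ z, lineLog z ∂((unif p q).prod (unif p q)) ≤ 2 - log (q - p) := by
  have h0 : 0 < q - p := sub_pos.2 hpq
  rw [unif, Measure.prod_smul_left, Measure.prod_smul_right, smul_smul, integral_smul_measure,
    ENNReal.toReal_mul, ENNReal.toReal_ofReal (inv_pos.2 h0).le, smul_eq_mul]
  calc _ ≤ (q - p)⁻¹ * (q - p)⁻¹ * ((q - p) ^ 2 * (2 - log (q - p))) := by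
        gcongr
        exact integral_lineLog_le hpq
    _ = _ := by field_simp

lemma isAdmissible_unif (hγ : IsRegularCurve a b c Λ R γ) (hc : 0 < c) {p q : ℝ} (hpq : p < q)
    (hm : ∀ᵐ x ∂(unif p q), x ∈ Icc a b) : IsAdmissible a b γ (unif p q) :=
  have := isProbabilityMeasure_unif hpq
  isAdmissible_of_le hγ hc ENNReal.ofReal_ne_top (unif_le p q) hm

lemma integral_curveLog_unif_le (hγ : IsRegularCurve a b c Λ R γ) (hc : 0 < c) {p q : ℝ}
    (hpq : p < q) (hm : ∀ᵐ x ∂(unif p q), x ∈ Icc a b) :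
    ∫ z, curveLog γ z ∂((unif p q).prod (unif p q)) ≤ 2 - log (q - p) + |log c| := by
  have := isProbabilityMeasure_unif hpq
  have h1 := integrable_lineLog_of_le ENNReal.ofReal_ne_top (unif_le p q) hm
  have h2 := hγ.integrable_chordLog hc hm hm
  simp_rw [curveLog_eq]
  rw [integral_sub h1 h2]
  have h3 := norm_integral_le_of_norm_le_const (μ := (unif p q).prod (unif p q))
    (f := chordLog γ) (C := |log c|) (by
      filter_upwards [ae_prod_mem hm hm] with z hz using hγ.abs_chordLog_le hc hz.1 hz.2)
  rw [probReal_univ, mul_one, Real.norm_eq_abs] at h3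
  linarith [integral_lineLog_unif_le hpq, neg_abs_le (∫ z, chordLog γ z ∂((unif p q).prod (unif p q)))]

/-! ### The minimiser -/

/-- An equilibrium measure is admissible and minimises the real energy. -/
theorem IsEquilibriumMeasure.isAdmissible (hγ : IsRegularCurve a b c Λ R γ) (hc : 0 < c)
    (hab : a < b) {γ₀ : ℝ → ℂ} {w : ℂ → ℂ} {φ : ℝ → ℝ} {μ : Measure ℝ}
    (hγ₀ : ∀ x ∈ Icc a b, γ₀ x = γ x) (hφ : Continuous φ)
    (hφ₀ : ∀ x ∈ Icc a b, field γ₀ w x = φ x) (hμ : IsEquilibriumMeasure a b γ₀ w μ) :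
    IsAdmissible a b γ μ ∧ ∀ ρ, IsAdmissible a b γ ρ → realEnergy γ φ μ ≤ realEnergy γ φ ρ := by
  have key : ∀ ρ, IsAdmissible a b γ ρ → energy γ₀ w μ ≤ ((realEnergy γ φ ρ : ℝ) : EReal) := by
    intro ρ hρ
    rw [← energy_eq_realEnergy hγ₀ (hγ.injOn hc) hφ hφ₀ hρ]
    exact hμ.minimal ρ hρ.isProbOn
  have hadm : IsAdmissible a b γ μ :=
    isAdmissible_of_energy_lt_top hγ hc hγ₀ hφ hφ₀ hμ.isProbOn
      -- The uniform law on `[a, b]` is a competitor of finite energy, so the minimiser has finite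
      -- energy and is admissible.
      ((key _ (isAdmissible_unif hγ hc hab (ae_unif_mem a b))).trans_lt (EReal.coe_lt_top _))
  refine ⟨hadm, fun ρ hρ => ?_⟩
  have h := key ρ hρ
  rwa [energy_eq_realEnergy hγ₀ (hγ.injOn hc) hφ hφ₀ hadm, EReal.coe_le_coe_iff] at h

lemma integral_curveLog_ge (hγ : IsRegularCurve a b c Λ R γ) (hc : 0 < c) {α β : Measure ℝ}
    (hα : IsAdmissible a b γ α) (hβ : IsAdmissible a b γ β) :
    -|log (c⁻¹ * (b - a))| ≤ ∫ p, curveLog γ p ∂(α.prod β) := by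
  have := hα.prob
  have := hβ.prob
  have h : ∫ _, -|log (c⁻¹ * (b - a))| ∂(α.prod β) ≤ ∫ p, curveLog γ p ∂(α.prod β) := by
    refine integral_mono_ae (integrable_const _) (hα.cross hγ hc hβ) ?_
    filter_upwards [ae_prod_mem hα.carried hβ.carried] with p hp using curveLog_ge hγ hc hp.1 hp.2
  simpa using h

/-- The logarithmic energy of the minimiser is bounded in terms of the geometry. -/
lemma integral_curveLog_minimiser_le (hγ : IsRegularCurve a b c Λ R γ) (hc : 0 < c) (hab : a < b)
    {φ : ℝ → ℝ} (hφ : Continuous φ) {M : ℝ} (hM : 0 ≤ M)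
    (hφM : ∀ x ∈ Icc a b, ∀ y ∈ Icc a b, |φ x - φ y| ≤ M * |x - y|)
    {μ : Measure ℝ} (hμ : IsAdmissible a b γ μ)
    (hmin : ∀ ρ, IsAdmissible a b γ ρ → realEnergy γ φ μ ≤ realEnergy γ φ ρ) :
    ∫ p, curveLog γ p ∂(μ.prod μ) ≤ 2 - log (b - a) + |log c| + 4 * M * (b - a) := by
  have := isProbabilityMeasure_unif hab
  have := hμ.prob
  have hu := isAdmissible_unif hγ hc hab (ae_unif_mem a b)
  have h1 := hmin _ hu
  have h2 := integral_curveLog_unif_le hγ hc hab (ae_unif_mem a b)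
  have osc : ∀ ν : Measure ℝ, IsAdmissible a b γ ν → |(∫ x, φ x ∂ν) - φ a| ≤ M * (b - a) := by
    intro ν hν
    have := hν.prob
    have e : (∫ x, φ x ∂ν) - φ a = ∫ x, (φ x - φ a) ∂ν := by
      rw [integral_sub (integrable_of_continuous hν.carried hφ) (integrable_const _)]
      simp
    rw [e]
    have h := norm_integral_le_of_norm_le_const (μ := ν) (f := fun x => φ x - φ a)
      (C := M * (b - a)) (by
        filter_upwards [hν.carried] with x hx
        refine (hφM x hx a (left_mem_Icc.2 hab.le)).trans ?_
        gcongr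
        rw [abs_of_nonneg (sub_nonneg.2 hx.1)]
        linarith [hx.2])
    simpa using h
  have o1 := abs_le.1 (osc _ hμ)
  have o2 := abs_le.1 (osc _ hu)
  rw [realEnergy, realEnergy] at h1
  linarith [o1.1, o2.2]

end CurveGas
end

noncomputable section
namespace CurveGas
open Filter Topology Real

/-! ### Spread points -/

section Spread

variable {N : ℕ} {x : Fin N → ℝ}

lemma sortedSeq_coe (x : Fin N → ℝ) (k : Fin N) : sortedSeq x k = x (Tuple.sort x k) := by
  simp [sortedSeq]

lemma sortedSeq_mono {i j : ℕ} (hij : i ≤ j) (hj : j < N) : sortedSeq x i ≤ sortedSeq x j := by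
  have h := Tuple.monotone_sort x (show (⟨i, hij.trans_lt hj⟩ : Fin N) ≤ ⟨j, hj⟩ from hij)
  simpa [sortedSeq, hj, hij.trans_lt hj] using h

/-- Each increment is a maximum and dominates both of its arguments: gaps never shrink, and `k`
steps cover at least `k N⁻³`. -/
lemma spreadSeq_sub_le (x : Fin N → ℝ) (i k : ℕ) :
    sortedSeq x (i + k) - sortedSeq x i ≤ spreadSeq x (i + k) - spreadSeq x i ∧
      k * ((N : ℝ) ^ 3)⁻¹ ≤ spreadSeq x (i + k) - spreadSeq x i := by
  induction k with
  | zero => simp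
  | succ k ih =>
    rw [← add_assoc, spreadSeq]
    have h1 := le_max_left (sortedSeq x (i + k + 1) - sortedSeq x (i + k)) (((N : ℝ) ^ 3)⁻¹)
    have h2 := le_max_right (sortedSeq x (i + k + 1) - sortedSeq x (i + k)) (((N : ℝ) ^ 3)⁻¹)
    push_cast
    exact ⟨by linarith [ih.1], by linarith [ih.2]⟩

lemma sortedSeq_le_spreadSeq (x : Fin N → ℝ) (k : ℕ) : sortedSeq x k ≤ spreadSeq x k := by
  have h := (spreadSeq_sub_le x 0 k).1
  simp only [zero_add] at h
  have : spreadSeq x 0 = sortedSeq x 0 := rfl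
  linarith

/-- Sorted gaps are nonnegative, so the maximum is at most the sum; each step displaces by at most
`N⁻³`, in total by less than `N⁻²`. -/
lemma spreadSeq_le {k : ℕ} (hk : k < N) :
    spreadSeq x k ≤ sortedSeq x k + k * ((N : ℝ) ^ 3)⁻¹ := by
  induction k with
  | zero => simp [spreadSeq]
  | succ k ih =>
    have h1 := ih (by omega)
    have h2 : max (sortedSeq x (k + 1) - sortedSeq x k) (((N : ℝ) ^ 3)⁻¹) ≤
        (sortedSeq x (k + 1) - sortedSeq x k) + ((N : ℝ) ^ 3)⁻¹ :=
      max_le_add_of_nonneg (sub_nonneg.2 (sortedSeq_mono (Nat.le_succ k) hk)) (by positivity)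
    rw [spreadSeq]
    push_cast
    linarith

lemma abs_sortedSeq_sub_le (i j : Fin N) :
    |sortedSeq x i - sortedSeq x j| ≤ |spreadSeq x i - spreadSeq x j| := by
  wlog h : j ≤ i generalizing i j
  · rw [abs_sub_comm, abs_sub_comm (spreadSeq x i)]
    exact this j i (le_of_not_ge h)
  have h1 := (spreadSeq_sub_le x j (i - j)).1
  rw [Nat.add_sub_cancel' (by exact h)] at h1
  rw [abs_of_nonneg (sub_nonneg.2 (sortedSeq_mono (by exact h) i.2))]
  exact h1.trans (le_abs_self _)

lemma le_abs_spreadSeq_sub {i j : Fin N} (hij : i ≠ j) :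
    ((N : ℝ) ^ 3)⁻¹ ≤ |spreadSeq x i - spreadSeq x j| := by
  wlog h : j < i generalizing i j
  · rw [abs_sub_comm]
    exact this hij.symm (lt_of_le_of_ne (le_of_not_gt h) hij)
  have h1 := (spreadSeq_sub_le x j (i - j)).2
  rw [Nat.add_sub_cancel' (by exact h.le)] at h1
  refine le_trans ?_ (h1.trans (le_abs_self _))
  have h2 : (1 : ℝ) ≤ ((i - j : ℕ) : ℝ) := by
    have : j.val < i.val := h
    exact_mod_cast (by omega : 1 ≤ i.val - j.val)
  exact le_mul_of_one_le_left (by positivity) h2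

lemma abs_spreadSeq_sub_sortedSeq_le (x : Fin N → ℝ) (k : Fin N) :
    |spreadSeq x k - sortedSeq x k| ≤ (N - 1) * ((N : ℝ) ^ 3)⁻¹ := by
  rw [abs_of_nonneg (sub_nonneg.2 (sortedSeq_le_spreadSeq x k))]
  have h1 := spreadSeq_le (x := x) k.2
  have h2 : (k : ℝ) ≤ N - 1 := by
    have : k.val + 1 ≤ N := k.2
    have : ((k.val + 1 : ℕ) : ℝ) ≤ N := by exact_mod_cast this
    push_cast at this
    linarith
  have h3 : (k : ℝ) * ((N : ℝ) ^ 3)⁻¹ ≤ (N - 1) * ((N : ℝ) ^ 3)⁻¹ := by gcongr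
  linarith

end Spread

/-! ### The regularised empirical measure -/

/-- The uniform law on the interval of length `N⁻⁶` around the `k`-th spread point. -/
def blob {N : ℕ} (x : Fin N → ℝ) (k : ℕ) : Measure ℝ :=
  unif (spreadSeq x k - (2 * (N : ℝ) ^ 6)⁻¹) (spreadSeq x k + (2 * (N : ℝ) ^ 6)⁻¹)

variable {a b a' b' c Λ R : ℝ} {γ : ℝ → ℂ} {N : ℕ} {x : Fin N → ℝ}

lemma blob_length (hN : 0 < N) (k : ℕ) :
    spreadSeq x k + (2 * (N : ℝ) ^ 6)⁻¹ - (spreadSeq x k - (2 * (N : ℝ) ^ 6)⁻¹) =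
      ((N : ℝ) ^ 6)⁻¹ := by
  have : (0 : ℝ) < N := by exact_mod_cast hN
  field_simp
  ring

lemma blob_lt (hN : 0 < N) (k : ℕ) :
    spreadSeq x k - (2 * (N : ℝ) ^ 6)⁻¹ < spreadSeq x k + (2 * (N : ℝ) ^ 6)⁻¹ := by
  have : (0 : ℝ) < N := by exact_mod_cast hN
  have h : (0 : ℝ) < ((N : ℝ) ^ 6)⁻¹ := by positivity
  rw [← blob_length (x := x) hN k] at h
  linarith

lemma isProbabilityMeasure_blob (hN : 0 < N) (k : ℕ) : IsProbabilityMeasure (blob x k) :=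
  isProbabilityMeasure_unif (blob_lt hN k)

lemma regEmpirical_eq (hN : 0 < N) (x : Fin N → ℝ) :
    regEmpirical x = (N : ℝ≥0∞)⁻¹ • ∑ k : Fin N, blob x k := by
  simp only [regEmpirical, blob, unif, blob_length hN, inv_inv]
  rw [ENNReal.ofReal_pow (by positivity), ENNReal.ofReal_natCast]

lemma natCast_inv_mul_self (hN : 0 < N) : (N : ℝ≥0∞)⁻¹ * N = 1 :=
  ENNReal.inv_mul_cancel (by exact_mod_cast hN.ne') (ENNReal.natCast_ne_top N)

lemma isProbabilityMeasure_regEmpirical (hN : 0 < N) (x : Fin N → ℝ) :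
    IsProbabilityMeasure (regEmpirical x) := by
  have := fun k => isProbabilityMeasure_blob (x := x) hN k
  refine ⟨?_⟩
  rw [regEmpirical_eq hN, Measure.smul_apply, Measure.finsetSum_apply]
  simp [natCast_inv_mul_self hN]

/-- Averaging preserves the density bound `N⁶` of the single blobs. This gives admissibility, and
absolute continuity for the linear statistics. -/
lemma regEmpirical_le (hN : 0 < N) (x : Fin N → ℝ) :
    regEmpirical x ≤ ((N : ℝ≥0∞) ^ 6) • volume := by
  rw [regEmpirical]
  calc _ ≤ (N : ℝ≥0∞)⁻¹ • ∑ k : Fin N, ((N : ℝ≥0∞) ^ 6) • (volume : Measure ℝ) := by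
        gcongr
        exact Measure.restrict_le_self
    _ = _ := by
        rw [Finset.sum_const, Finset.card_univ, Fintype.card_fin, ← Nat.cast_smul_eq_nsmul ℝ≥0∞,
          smul_smul, natCast_inv_mul_self hN, one_smul]

lemma ae_blob_of_ae_regEmpirical (hN : 0 < N) {p : ℝ → Prop} (h : ∀ᵐ u ∂(regEmpirical x), p u)
    (k : Fin N) : ∀ᵐ u ∂(blob x k), p u := by
  rw [ae_iff, regEmpirical_eq hN, Measure.smul_apply, Measure.finsetSum_apply, smul_eq_mul,
    mul_eq_zero, Finset.sum_eq_zero_iff] at h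
  rcases h with h | h
  · simp at h
  · exact ae_iff.2 (h k (Finset.mem_univ k))

lemma ae_regEmpirical_of_ae_blob (hN : 0 < N) {p : ℝ → Prop}
    (h : ∀ k : Fin N, ∀ᵐ u ∂(blob x k), p u) : ∀ᵐ u ∂(regEmpirical x), p u := by
  rw [ae_iff, regEmpirical_eq hN, Measure.smul_apply, Measure.finsetSum_apply, smul_eq_mul,
    mul_eq_zero, Finset.sum_eq_zero_iff]
  exact Or.inr fun k _ => ae_iff.1 (h k)

lemma isAdmissible_regEmpirical (hγ : IsRegularCurve a' b' c Λ R γ) (hc : 0 < c) (hN : 0 < N)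
    (hx : ∀ᵐ u ∂(regEmpirical x), u ∈ Icc a' b') : IsAdmissible a' b' γ (regEmpirical x) :=
  have := isProbabilityMeasure_regEmpirical hN x
  isAdmissible_of_le hγ hc (by finiteness) (regEmpirical_le hN x) hx

lemma ae_blob_mem (x : Fin N → ℝ) (k : ℕ) : ∀ᵐ u ∂(blob x k),
    u ∈ Icc (spreadSeq x k - (2 * (N : ℝ) ^ 6)⁻¹) (spreadSeq x k + (2 * (N : ℝ) ^ 6)⁻¹) :=
  ae_unif_mem _ _

lemma ae_blob_abs_sub_sortedSeq_le (hN : 0 < N) (k : Fin N) :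
    ∀ᵐ u ∂(blob x k), |u - sortedSeq x k| ≤ ((N : ℝ) ^ 2)⁻¹ := by
  have hN' : (1 : ℝ) ≤ N := by exact_mod_cast hN
  filter_upwards [ae_blob_mem x k] with u hu
  have h1 : |u - spreadSeq x k| ≤ (2 * (N : ℝ) ^ 6)⁻¹ :=
    abs_le.2 ⟨by linarith [hu.1], by linarith [hu.2]⟩
  have h2 := abs_spreadSeq_sub_sortedSeq_le x k
  have h3 : (2 * (N : ℝ) ^ 6)⁻¹ ≤ ((N : ℝ) ^ 3)⁻¹ := by
    apply inv_anti₀ (by positivity)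
    have : (N : ℝ) ^ 3 ≤ N ^ 6 := pow_le_pow_right₀ hN' (by norm_num)
    have : 0 < (N : ℝ) ^ 6 := by positivity
    linarith
  have h4 : (N : ℝ) * ((N : ℝ) ^ 3)⁻¹ = ((N : ℝ) ^ 2)⁻¹ := by field_simp
  have h5 := abs_sub_le u (spreadSeq x k) (sortedSeq x k)
  linarith

lemma sortedSeq_mem (hx : x ∈ configs a b N) (k : Fin N) : sortedSeq x k ∈ Icc a b := by
  rw [sortedSeq_coe]
  exact hx _ (mem_univ _)

lemma ae_regEmpirical_mem (hN : 0 < N) (hx : x ∈ configs a b N) :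
    ∀ᵐ u ∂(regEmpirical x), u ∈ Icc (a - ((N : ℝ) ^ 2)⁻¹) (b + ((N : ℝ) ^ 2)⁻¹) := by
  refine ae_regEmpirical_of_ae_blob hN fun k => ?_
  filter_upwards [ae_blob_abs_sub_sortedSeq_le hN k] with u hu
  have h1 := sortedSeq_mem hx k
  have h2 := abs_le.1 hu
  exact ⟨by linarith [h1.1], by linarith [h1.2]⟩

/-- The regularised configurations stay in a larger interval for large `N`. -/
lemma regFits_of_le (hN : 0 < N) (ha : ((N : ℝ) ^ 2)⁻¹ ≤ a - a') (hb : ((N : ℝ) ^ 2)⁻¹ ≤ b' - b) :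
    RegFits a b a' b' N ∧ ∀ x ∈ configs a b N, ∀ k : Fin N, spreadSeq x k ∈ Icc a' b' := by
  refine ⟨fun x hx => ?_, fun x hx k => ?_⟩
  · refine ae_iff.1 ((ae_regEmpirical_mem hN hx).mono fun u hu => ?_)
    exact ⟨by linarith [hu.1], by linarith [hu.2]⟩
  · have h1 := sortedSeq_mem hx k
    have h2 := abs_le.1 (abs_spreadSeq_sub_sortedSeq_le x k)
    have hN' : (0 : ℝ) < N := by exact_mod_cast hN
    have h4 : (N : ℝ) * ((N : ℝ) ^ 3)⁻¹ = ((N : ℝ) ^ 2)⁻¹ := by field_simp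
    have h5 : (0 : ℝ) < ((N : ℝ) ^ 3)⁻¹ := by positivity
    exact ⟨by linarith [h1.1], by linarith [h1.2]⟩

lemma integral_regEmpirical (hN : 0 < N) {f : ℝ → ℝ} (hf : ∀ k : Fin N, Integrable f (blob x k)) :
    ∫ u, f u ∂(regEmpirical x) = (N : ℝ)⁻¹ * ∑ k : Fin N, ∫ u, f u ∂(blob x k) := by
  rw [regEmpirical_eq hN, integral_smul_measure, integral_finsetSum_measure fun k _ => hf k]
  simp

lemma sum_sortedSeq (f : ℝ → ℝ) : ∑ k : Fin N, f (sortedSeq x k) = ∑ k, f (x k) := by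
  simp_rw [sortedSeq_coe]
  exact Equiv.sum_comp (Tuple.sort x) fun k => f (x k)

/-- On the `k`-th blob `T u` is within `2 N⁻²` of the `k`-th sorted point; the factor `4` leaves
room. The bound has the shape required of `r` in `energy_coercive`. -/
lemma integral_field_regEmpirical_le (hN : 0 < N) (hx : x ∈ configs a b N) {φ : ℝ → ℝ}
    (hφ : Continuous φ) {M : ℝ} (hM : 0 ≤ M)
    (hφM : ∀ x ∈ Icc a b, ∀ y ∈ Icc a b, |φ x - φ y| ≤ M * |x - y|) {T : ℝ → ℝ} (hT : Measurable T)
    (hTm : ∀ u ∈ Icc (a - ((N : ℝ) ^ 2)⁻¹) (b + ((N : ℝ) ^ 2)⁻¹),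
      T u ∈ Icc a b ∧ |T u - u| ≤ ((N : ℝ) ^ 2)⁻¹) :
    ∫ u, φ (T u) ∂(regEmpirical x) ≤
      (N : ℝ)⁻¹ * (∑ k, φ (x k)) + 4 * M * ((N : ℝ) ^ 2)⁻¹ := by
  have := fun k => isProbabilityMeasure_blob (x := x) hN k
  have hN' : (0 : ℝ) < N := by exact_mod_cast hN
  have hmem := fun k => ae_blob_of_ae_regEmpirical hN (ae_regEmpirical_mem hN hx) k
  have hi : ∀ k : Fin N, Integrable (fun u => φ (T u)) (blob x k) := by
    intro k
    obtain ⟨B, hB⟩ := isCompact_Icc.exists_bound_of_continuousOn hφ.continuousOn (s := Icc a b)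
    exact (integrable_const B).mono' (hφ.measurable.comp hT).aestronglyMeasurable
      ((hmem k).mono fun u hu => hB _ (hTm u hu).1)
  have hk : ∀ k : Fin N, ∫ u, φ (T u) ∂(blob x k) ≤
      φ (sortedSeq x k) + 4 * M * ((N : ℝ) ^ 2)⁻¹ := by
    intro k
    have h : ∫ u, φ (T u) ∂(blob x k) ≤
        ∫ _, (φ (sortedSeq x k) + 4 * M * ((N : ℝ) ^ 2)⁻¹) ∂(blob x k) := by
      refine integral_mono_ae (hi k) (integrable_const _) ?_
      filter_upwards [hmem k, ae_blob_abs_sub_sortedSeq_le hN k] with u hu hu'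
      have h1 := (le_abs_self _).trans (hφM _ (hTm u hu).1 _ (sortedSeq_mem hx k))
      have h2 : |T u - sortedSeq x k| ≤ 4 * ((N : ℝ) ^ 2)⁻¹ := by
        have h3 := abs_sub_le (T u) u (sortedSeq x k)
        have h4 := (hTm u hu).2
        have h5 : (0 : ℝ) < ((N : ℝ) ^ 2)⁻¹ := by positivity
        linarith
      have h3 := mul_le_mul_of_nonneg_left h2 hM
      linarith
    simpa using h
  rw [integral_regEmpirical hN hi]
  calc _ ≤ (N : ℝ)⁻¹ * ∑ k : Fin N, (φ (sortedSeq x k) + 4 * M * ((N : ℝ) ^ 2)⁻¹) := by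
        gcongr with k
        exact hk k
    _ = _ := by
        rw [Finset.sum_add_distrib, sum_sortedSeq, Finset.sum_const, Finset.card_univ,
          Fintype.card_fin, nsmul_eq_mul, mul_add, inv_mul_cancel_left₀ hN'.ne']

lemma isAdmissible_blob (hγ : IsRegularCurve a' b' c Λ R γ) (hc : 0 < c) (hN : 0 < N)
    (hfit : ∀ᵐ u ∂(regEmpirical x), u ∈ Icc a' b') (k : Fin N) :
    IsAdmissible a' b' γ (blob x k) :=
  isAdmissible_unif hγ hc (blob_lt hN k) (ae_blob_of_ae_regEmpirical hN hfit k)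

lemma integral_curveLog_regEmpirical (hγ : IsRegularCurve a' b' c Λ R γ) (hc : 0 < c) (hN : 0 < N)
    (hfit : ∀ᵐ u ∂(regEmpirical x), u ∈ Icc a' b') :
    ∫ p, curveLog γ p ∂((regEmpirical x).prod (regEmpirical x)) =
      ((N : ℝ) ^ 2)⁻¹ * ∑ i : Fin N, ∑ j : Fin N,
        ∫ p, curveLog γ p ∂((blob x i).prod (blob x j)) := by
  have := fun k => isProbabilityMeasure_blob (x := x) hN k
  have hadm := isAdmissible_blob hγ hc hN hfit
  rw [regEmpirical_eq hN, ← Measure.sum_fintype, Measure.prod_smul_left,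
    Measure.prod_smul_right, Measure.prod_sum, Measure.sum_fintype, smul_smul,
    integral_smul_measure, integral_finsetSum_measure fun k _ =>
      (hadm k.1).cross hγ hc (hadm k.2), Fintype.sum_prod_type]
  simp [pow_two]

lemma integral_curveLog_blob_le (hγ : IsRegularCurve a' b' c Λ R γ) (hc : 0 < c) (hN : 0 < N)
    (hfit : ∀ᵐ u ∂(regEmpirical x), u ∈ Icc a' b') (i : Fin N) :
    ∫ p, curveLog γ p ∂((blob x i).prod (blob x i)) ≤ 2 + 6 * log N + |log c| := by
  have h := integral_curveLog_unif_le hγ hc (blob_lt hN i) (ae_blob_of_ae_regEmpirical hN hfit i)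
  rw [blob_length hN, log_inv, log_pow] at h
  push_cast at h
  rw [blob]
  linarith

/-- A crude bound for the energy of the regularised empirical measure. -/
lemma integral_curveLog_regEmpirical_le_log (hγ : IsRegularCurve a' b' c Λ R γ) (hc : 0 < c)
    (hN : 0 < N) (hfit : ∀ᵐ u ∂(regEmpirical x), u ∈ Icc a' b') :
    ∫ p, curveLog γ p ∂((regEmpirical x).prod (regEmpirical x)) ≤ 2 + 6 * log N + |log c| := by
  have hN' : (0 : ℝ) < N := by exact_mod_cast hN
  have hadm := isAdmissible_blob hγ hc hN hfit
  have hpair : ∀ i j : Fin N, ∫ p, curveLog γ p ∂((blob x i).prod (blob x j)) ≤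
      2 + 6 * log N + |log c| := by
    intro i j
    -- Positivity bounds a mutual energy by the mean of the two self-energies, so no information on
    -- the distances between blobs is needed.
    have h := (hadm i).quadDiff_nonneg hγ hc (hadm j)
    have h1 := integral_curveLog_blob_le hγ hc hN hfit i
    have h2 := integral_curveLog_blob_le hγ hc hN hfit j
    rw [quadDiff] at h
    linarith
  rw [integral_curveLog_regEmpirical hγ hc hN hfit]
  calc _ ≤ ((N : ℝ) ^ 2)⁻¹ * ∑ _i : Fin N, ∑ _j : Fin N, (2 + 6 * log N + |log c|) := by
        gcongr with i _ j _
        exact hpair i j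
    _ = _ := by
        simp only [Finset.sum_const, Finset.card_univ, Fintype.card_fin, nsmul_eq_mul]
        field_simp

/-- The logarithmic energy of the regularised empirical measure is controlled by the discrete
energy of the configuration. -/
theorem integral_curveLog_regEmpirical_le (hγ : IsRegularCurve a' b' c Λ R γ) (hc : 0 < c)
    (hΛ : 0 ≤ Λ) (hN : 2 ≤ N) (ha : a' ≤ a) (hb : b ≤ b') (hx : x ∈ configs a b N)
    (hinj : Function.Injective x) (hfit : ∀ᵐ u ∂(regEmpirical x), u ∈ Icc a' b') :
    ∫ p, curveLog γ p ∂((regEmpirical x).prod (regEmpirical x)) ≤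
      ((N : ℝ) ^ 2)⁻¹ * (∑ i, ∑ j, curveLog γ (x i, x j)) +
        (3 + 6 * log N + |log c| + 2 * Λ) / N := by
  have hN0 : 0 < N := by omega
  have hN' : (2 : ℝ) ≤ N := by exact_mod_cast hN
  have hN1 : (0 : ℝ) < N := by linarith
  have := fun k => isProbabilityMeasure_blob (x := x) hN0 k
  have hmem := fun k => ae_blob_of_ae_regEmpirical hN0 hfit k
  have hadm := isAdmissible_blob hγ hc hN0 hfit
  have hbig : ∀ k : Fin N, sortedSeq x k ∈ Icc a' b' := fun k =>
    ⟨ha.trans (sortedSeq_mem hx k).1, (sortedSeq_mem hx k).2.trans hb⟩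
  have hoff : ∀ i j : Fin N, i ≠ j → ∫ p, curveLog γ p ∂((blob x i).prod (blob x j)) ≤
      curveLog γ (sortedSeq x i, sortedSeq x j) + (1 + 2 * Λ) / N := by
    intro i j hij
    have hne : sortedSeq x i ≠ sortedSeq x j := by
      rw [sortedSeq_coe, sortedSeq_coe]
      exact fun h => hij ((Tuple.sort x).injective (hinj h))
    have h : ∫ p, curveLog γ p ∂((blob x i).prod (blob x j)) ≤
        ∫ _, (curveLog γ (sortedSeq x i, sortedSeq x j) + (1 + 2 * Λ) / N)
          ∂((blob x i).prod (blob x j)) := by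
      refine integral_mono_ae ((hadm i).cross hγ hc (hadm j)) (integrable_const _) ?_
      filter_upwards [ae_prod_mem (hmem i) (hmem j),
        Measure.quasiMeasurePreserving_fst.ae (ae_blob_mem x i),
        Measure.quasiMeasurePreserving_snd.ae (ae_blob_mem x j),
        Measure.quasiMeasurePreserving_fst.ae (ae_blob_abs_sub_sortedSeq_le (x := x) hN0 i),
        Measure.quasiMeasurePreserving_snd.ae (ae_blob_abs_sub_sortedSeq_le (x := x) hN0 j)]
        with p hp hq1 hq2 h1 h2
      have s1 := le_abs_spreadSeq_sub (x := x) hij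
      have s2 := abs_sortedSeq_sub_le (x := x) i j
      have s3 : |spreadSeq x i - spreadSeq x j| ≤ |p.1 - p.2| + ((N : ℝ) ^ 6)⁻¹ := by
        have e : 2 * (2 * (N : ℝ) ^ 6)⁻¹ = ((N : ℝ) ^ 6)⁻¹ := by
          field_simp
        have t1 := neg_abs_le (p.1 - p.2)
        have t2 := le_abs_self (p.1 - p.2)
        exact abs_le.2 ⟨by linarith [hq1.2, hq2.1], by linarith [hq1.1, hq2.2]⟩
      have d0 : 0 < |sortedSeq x i - sortedSeq x j| := abs_pos.2 (sub_ne_zero.2 hne)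
      set A := |spreadSeq x i - spreadSeq x j|
      set t := ((N : ℝ) ^ 3)⁻¹
      have ht : ((N : ℝ) ^ 6)⁻¹ = t * t := by
        rw [← mul_inv, ← pow_add]
      have t0 : 0 < t := by positivity
      have t1 : t ≤ (4 * (N : ℝ))⁻¹ := by
        apply inv_anti₀ (by positivity)
        nlinarith
      have t2 : (4 * (N : ℝ))⁻¹ ≤ 1 / 8 := by
        rw [inv_eq_one_div]
        apply one_div_le_one_div_of_le <;> linarith
      -- Two blobs change a distance by at most `N⁻⁶ = t²`, while the spread points are at least `t
      -- = N⁻³` apart: the relative loss is `t`, and spreading has not decreased the sorted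
      -- distance.
      have s4 : (1 - t) * |sortedSeq x i - sortedSeq x j| ≤ |p.1 - p.2| := by
        rw [ht] at s3
        nlinarith
      have s5 := log_le_log (mul_pos (by linarith) d0) s4
      rw [log_mul (by linarith) d0.ne'] at s5
      have s6 : -(1 / N) ≤ log (1 - t) := by
        have u1 := one_sub_inv_le_log_of_pos (show 0 < 1 - t by linarith)
        have u2 : (1 - t)⁻¹ ≤ 1 + 2 * t := by
          rw [inv_le_iff_one_le_mul₀ (by linarith)]
          nlinarith
        have u3 : 2 * (4 * (N : ℝ))⁻¹ ≤ 1 / N := by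
          rw [mul_inv, one_div]
          have : 0 < (N : ℝ)⁻¹ := by positivity
          linarith
        linarith
      have hpne : p.1 ≠ p.2 := by
        intro hpp
        rw [hpp, sub_self, abs_zero] at s4
        exact absurd s4 (not_le.2 (mul_pos (by linarith) d0))
      have s7 := (abs_le.1 (hγ.chord _ hp.1 _ hp.2 _ (hbig i) _ (hbig j) hpne hne)).1
      have s8 : Λ * (|p.1 - sortedSeq x i| + |p.2 - sortedSeq x j|) ≤ 2 * Λ / N := by
        have v1 : ((N : ℝ) ^ 2)⁻¹ ≤ (N : ℝ)⁻¹ := by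
          apply inv_anti₀ hN1
          nlinarith
        calc _ ≤ Λ * ((N : ℝ)⁻¹ + (N : ℝ)⁻¹) := by
              gcongr
              · exact h1.trans v1
              · exact h2.trans v1
          _ = _ := by
              field_simp
              ring
      have e1 := curveLog_eq γ p
      have e2 := curveLog_eq γ (sortedSeq x i, sortedSeq x j)
      have e3 : chordLog γ (p.1, p.2) = chordLog γ p := rfl
      simp only [lineLog] at e1 e2
      rw [e1, e2, add_div]
      linarith
    simpa using h
  have hterm : ∀ i j : Fin N, ∫ p, curveLog γ p ∂((blob x i).prod (blob x j)) ≤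
      curveLog γ (sortedSeq x i, sortedSeq x j) + (1 + 2 * Λ) / N +
        if i = j then 2 + 6 * log N + |log c| else 0 := by
    intro i j
    split_ifs with h
    · subst h
      -- By `log 0 = 0` the diagonal contributes nothing to the discrete double sum; the self-energy
      -- of a blob is paid for separately, of order `log N` for each of the `N` blobs.
      have e : curveLog γ (sortedSeq x i, sortedSeq x i) = 0 := by simp [curveLog]
      have : 0 ≤ (1 + 2 * Λ) / N := by positivity
      linarith [integral_curveLog_blob_le hγ hc hN0 hfit i]
    · linarith [hoff i j h]
  have hsum : ∑ i : Fin N, ∑ j : Fin N, curveLog γ (sortedSeq x i, sortedSeq x j) =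
      ∑ i, ∑ j, curveLog γ (x i, x j) := by
    simp_rw [sortedSeq_coe]
    rw [Equiv.sum_comp (Tuple.sort x) fun i => ∑ j, curveLog γ (x i, x (Tuple.sort x j))]
    exact Finset.sum_congr rfl fun i _ =>
      Equiv.sum_comp (Tuple.sort x) fun j => curveLog γ (x i, x j)
  rw [integral_curveLog_regEmpirical hγ hc hN0 hfit]
  calc _ ≤ ((N : ℝ) ^ 2)⁻¹ * ∑ i : Fin N, ∑ j : Fin N,
        (curveLog γ (sortedSeq x i, sortedSeq x j) + (1 + 2 * Λ) / N +
        if i = j then 2 + 6 * log N + |log c| else 0) := by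
        gcongr with i _ j _
        exact hterm i j
    _ = _ := by
        simp only [Finset.sum_add_distrib, Finset.sum_ite_eq, Finset.mem_univ, if_true,
          Finset.sum_const, Finset.card_univ, Fintype.card_fin, nsmul_eq_mul, hsum]
        field_simp
        ring

end CurveGas
end

noncomputable section
namespace CurveGas
open Filter Topology Real

/-! ### Lower bound for the discrete energy -/

lemma IsRegularCurve.mono {a b a' b' c Λ R : ℝ} {γ : ℝ → ℂ} (hγ : IsRegularCurve a' b' c Λ R γ)
    (ha : a' ≤ a) (hb : b ≤ b') : IsRegularCurve a b c Λ R γ := by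
  have h := Icc_subset_Icc ha hb
  exact ⟨hγ.continuous, fun x hx => hγ.bound x (h hx),
    fun x hx y hy => hγ.lower x (h hx) y (h hy), fun x hx y hy => hγ.upper x (h hx) y (h hy),
    fun x hx y hy x' hx' y' hy' => hγ.chord x (h hx) y (h hy) x' (h hx') y' (h hy')⟩

/-- A curve, a Lipschitz field on `[a, b]` and the minimiser of the corresponding energy. -/
structure IsGas (a b a' b' c Λ R M : ℝ) (γ : ℝ → ℂ) (φ : ℝ → ℝ) (μ : Measure ℝ) : Prop where
  curve : IsRegularCurve a' b' c Λ R γ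
  cont : Continuous φ
  lip : ∀ x ∈ Icc a b, ∀ y ∈ Icc a b, |φ x - φ y| ≤ M * |x - y|
  adm : IsAdmissible a b γ μ
  minimal : ∀ ρ, IsAdmissible a b γ ρ → realEnergy γ φ μ ≤ realEnergy γ φ ρ

/-- The energy of a configuration. -/
def discreteEnergy (γ : ℝ → ℂ) (φ : ℝ → ℝ) {N : ℕ} (x : Fin N → ℝ) : ℝ :=
  ((N : ℝ) ^ 2)⁻¹ * (∑ i, ∑ j, curveLog γ (x i, x j)) + 2 * ((N : ℝ)⁻¹ * ∑ k, φ (x k))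

variable {a b a' b' c Λ R M : ℝ} {γ : ℝ → ℂ}

/-- Lets constants be absorbed into multiples of `log N` for all `N ≥ 2`. -/
lemma one_le_two_mul_log {N : ℕ} (hN : 2 ≤ N) : 1 ≤ 2 * log N := by
  have h1 : log 2 ≤ log N := log_le_log (by norm_num) (by exact_mod_cast hN)
  linarith [log_two_gt_d9]

/-- The discrete energy of a configuration exceeds the minimal energy by the squared logarithmic
distance of its regularised empirical measure to the minimiser, up to `O(log N / N)`. -/
theorem exists_discreteEnergy_ge (ha : a' ≤ a) (hab : a < b) (hb : b ≤ b') (hc : 0 < c)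
    (hΛ : 0 ≤ Λ) (hM : 0 ≤ M) : ∃ C : ℝ, 0 ≤ C ∧ ∀ R γ φ μ, IsGas a b a' b' c Λ R M γ φ μ →
      ∀ N : ℕ, 2 ≤ N → ∀ x : Fin N → ℝ, x ∈ configs a b N → Function.Injective x →
        (∀ᵐ u ∂(regEmpirical x), u ∈ Icc a' b') →
        realEnergy γ φ μ + quadDiff (curveLog γ) (regEmpirical x) μ - C * log N / N ≤
          discreteEnergy γ φ x := by
  set B := 2 + |log c| + 2 * |log (c⁻¹ * (b' - a'))| +
    (2 - log (b - a) + |log c| + 4 * M * (b - a)) with hB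
  set K := 2 / (b - a) + 2 * Λ + 8 * M with hK
  have hK0 : 0 ≤ K := by
    have := sub_pos.2 hab
    positivity
  refine ⟨6 + 2 * |B| + 2 * K + 2 * (3 + |log c| + 2 * Λ) + 6, by positivity, ?_⟩
  intro R γ φ μ h N hN x hx hinj hfit
  have hN0 : 0 < N := by omega
  have hN' : (2 : ℝ) ≤ N := by exact_mod_cast hN
  have hN1 : (0 : ℝ) < N := by linarith
  have hlog := one_le_two_mul_log hN
  have hμ' := h.adm.mono ha hb
  have hL := isAdmissible_regEmpirical h.curve hc hN0 hfit
  -- With `ρ = N⁻²` and `s = N⁻¹` the contraction error is `O(1 / N)`, and the lost fraction `D² /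
  -- N` is `O(log N / N)` by the crude bound `hD`.
  have hco := energy_coercive h.curve hc hΛ ha hb hab h.cont h.lip hM h.adm h.minimal hL
    (ρ := ((N : ℝ) ^ 2)⁻¹) (by positivity) (ae_regEmpirical_mem hN0 hx)
    (r := (N : ℝ)⁻¹ * ∑ k, φ (x k))
    (fun T hT hTm => integral_field_regEmpirical_le hN0 hx h.cont hM h.lip hT hTm)
    (s := (N : ℝ)⁻¹) (by positivity) (inv_le_one_of_one_le₀ (by linarith))
  have hI := integral_curveLog_regEmpirical_le h.curve hc hΛ hN ha hb hx hinj hfit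
  have hD : quadDiff (curveLog γ) (regEmpirical x) μ ≤ 6 * log N + B := by
    have h1 := integral_curveLog_regEmpirical_le_log h.curve hc hN0 hfit
    have h2 := integral_curveLog_ge h.curve hc hL hμ'
    have h3 := integral_curveLog_minimiser_le (h.curve.mono ha hb) hc hab h.cont hM h.lip h.adm
      h.minimal
    rw [quadDiff]
    linarith
  have hD' : (N : ℝ)⁻¹ * quadDiff (curveLog γ) (regEmpirical x) μ ≤
      (N : ℝ)⁻¹ * ((6 + 2 * |B|) * log N) := by
    gcongr
    have := le_abs_self B
    have := abs_nonneg B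
    nlinarith
  have e1 : K * ((N : ℝ) ^ 2)⁻¹ / (N : ℝ)⁻¹ = (N : ℝ)⁻¹ * K := by
    field_simp
  have e2 : (N : ℝ)⁻¹ * K ≤ (N : ℝ)⁻¹ * (2 * K * log N) := by
    gcongr
    nlinarith
  have e3 : (3 + 6 * log N + |log c| + 2 * Λ) / N ≤
      (N : ℝ)⁻¹ * ((2 * (3 + |log c| + 2 * Λ) + 6) * log N) := by
    rw [div_eq_inv_mul]
    gcongr
    have : 0 ≤ 3 + |log c| + 2 * Λ := by positivity
    nlinarith
  rw [e1] at hco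
  have e4 : (6 + 2 * |B| + 2 * K + 2 * (3 + |log c| + 2 * Λ) + 6) * log N / N =
      (N : ℝ)⁻¹ * ((6 + 2 * |B|) * log N) + (N : ℝ)⁻¹ * (2 * K * log N) +
      (N : ℝ)⁻¹ * ((2 * (3 + |log c| + 2 * Λ) + 6) * log N) := by
    rw [div_eq_inv_mul]
    ring
  rw [discreteEnergy, e4]
  linarith

end CurveGas
end

noncomputable section
namespace CurveGas
open Filter Topology Real

/-! ### Lower bound for the partition function -/

/-- Jensen's inequality for the exponential, without integrability of the exponential. -/
lemma ofReal_exp_neg_integral_le {Ω : Type*} [MeasurableSpace Ω] {P : Measure Ω}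
    [IsProbabilityMeasure P] {h : Ω → ℝ} (hh : Integrable h P) :
    ENNReal.ofReal (exp (-∫ x, h x ∂P)) ≤ ∫⁻ x, ENNReal.ofReal (exp (-h x)) ∂P := by
  set m := ∫ x, h x ∂P with hm
  -- The tangent line of `exp` at `-m`, evaluated at `-h x`. It is integrable and lies below `exp
  -- (-h x)`, whose own integral may be infinite.
  set g : Ω → ℝ := fun x => exp (-m) * ((1 + m) - h x) with hg
  have hgi : Integrable g P := ((integrable_const _).sub hh).const_mul _
  have e : ∫ x, g x ∂P = exp (-m) := by
    rw [hg, integral_const_mul, integral_sub (integrable_const _) hh]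
    simp [← hm]
  have hle : ∀ x, g x ≤ exp (-h x) := by
    intro x
    have h1 := add_one_le_exp (m - h x)
    have h2 : exp (-h x) = exp (-m) * exp (m - h x) := by
      rw [← exp_add]
      congr 1
      ring
    rw [h2]
    exact mul_le_mul_of_nonneg_left (by linarith) (exp_pos _).le
  rw [← e]
  refine le_trans ?_ (lintegral_mono fun x => ENNReal.ofReal_le_ofReal (hle x))
  rw [integral_eq_lintegral_pos_part_sub_lintegral_neg_part hgi]
  exact (ENNReal.ofReal_le_ofReal (sub_le_self _ ENNReal.toReal_nonneg)).trans
    ENNReal.ofReal_toReal_le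

variable {a b a' b' c Λ R M : ℝ} {γ : ℝ → ℂ} {N : ℕ}

lemma measurableSet_configs (a b : ℝ) (N : ℕ) : MeasurableSet (configs a b N) :=
  MeasurableSet.univ_pi fun _ => measurableSet_Icc

lemma volume_configs (hab : a ≤ b) : volume (configs a b N) = ENNReal.ofReal ((b - a) ^ N) := by
  rw [configs, volume_pi_pi]
  simp [Real.volume_Icc, ENNReal.ofReal_pow (sub_nonneg.2 hab)]

lemma shrink_mem {x v ε : ℝ} (hx : x ∈ Icc a b) (hv : v ∈ Icc a b) (h0 : 0 ≤ ε) (h1 : ε ≤ 1) :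
    (1 - ε) * x + ε * v ∈ Icc a b := by
  have := convex_Icc a b hx hv (sub_nonneg.2 h1) h0 (by ring)
  simpa using this

/-- By convexity `v ↦ (1 - ε) x + ε v` maps the box into itself, and its Jacobian is `ε ^ N`.
Averaging over `v` thus replaces a possibly singular law by one with density at most a multiple of
`ε ^ (-N)`. -/
lemma lintegral_shrink_le {x : Fin N → ℝ} (hx : x ∈ configs a b N) {ε : ℝ} (h0 : 0 < ε)
    (h1 : ε ≤ 1) {F : (Fin N → ℝ) → ℝ≥0∞} (hF : Measurable F) :
    ENNReal.ofReal (ε ^ N) * ∫⁻ v in configs a b N, F (fun k => (1 - ε) * x k + ε * v k) ≤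
      ∫⁻ u in configs a b N, F u := by
  set G := (configs a b N).indicator F with hG
  have hGm : Measurable G := hF.indicator (measurableSet_configs a b N)
  set y : Fin N → ℝ := (1 - ε) • x with hy
  have step : ∫⁻ v in configs a b N, F (fun k => (1 - ε) * x k + ε * v k) ≤
      ∫⁻ v, G (y + ε • v) := by
    rw [← lintegral_indicator (measurableSet_configs a b N)]
    refine lintegral_mono fun v => ?_
    by_cases hv : v ∈ configs a b N
    · have hm : y + ε • v ∈ configs a b N := fun k _ =>
        shrink_mem (hx k (mem_univ k)) (hv k (mem_univ k)) h0.le h1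
      rw [indicator_of_mem hv, hG, indicator_of_mem hm]
      rfl
    · rw [indicator_of_notMem hv]
      exact zero_le
  have e : ∫⁻ v, G (y + ε • v) = ENNReal.ofReal ((ε ^ N)⁻¹) * ∫⁻ u, G u := by
    have hm : Measurable fun u => G (y + u) := hGm.comp (measurable_const_add y)
    rw [← lintegral_map (f := fun u => G (y + u)) hm (measurable_const_smul ε),
      Measure.map_addHaar_smul _ h0.ne', lintegral_smul_measure, lintegral_add_left_eq_self]
    simp [abs_of_pos h0]
  calc _ ≤ ENNReal.ofReal (ε ^ N) * (ENNReal.ofReal ((ε ^ N)⁻¹) * ∫⁻ u, G u) := by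
        gcongr
        exact step.trans_eq e
    _ = ∫⁻ u, G u := by
        rw [← mul_assoc, ← ENNReal.ofReal_mul (by positivity),
          mul_inv_cancel₀ (by positivity), ENNReal.ofReal_one, one_mul]
    _ = _ := lintegral_indicator (measurableSet_configs a b N) F

lemma measurePreserving_pair (μ : Measure ℝ) [IsProbabilityMeasure μ] {i j : Fin N} (hij : i ≠ j) :
    MeasurePreserving (fun x : Fin N → ℝ => (x i, x j)) (Measure.pi fun _ => μ) (μ.prod μ) := by
  refine ⟨by fun_prop, ?_⟩
  have h1 : ProbabilityTheory.iIndepFun (fun (i : Fin N) (x : Fin N → ℝ) => x i)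
      (Measure.pi fun _ => μ) :=
    ProbabilityTheory.iIndepFun_pi (X := fun _ s => s) fun _ => aemeasurable_id
  have h2 := (ProbabilityTheory.indepFun_iff_map_prod_eq_prod_map_map
    (measurable_pi_apply i).aemeasurable (measurable_pi_apply j).aemeasurable).1
    (h1.indepFun hij)
  rw [h2]
  congr 1
  · exact (measurePreserving_eval (fun _ : Fin N => μ) i).map_eq
  · exact (measurePreserving_eval (fun _ : Fin N => μ) j).map_eq

lemma ae_pi_mem_configs {μ : Measure ℝ} [IsProbabilityMeasure μ] (hμ : ∀ᵐ x ∂μ, x ∈ Icc a b) :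
    ∀ᵐ x ∂(Measure.pi fun _ : Fin N => μ), x ∈ configs a b N := by
  have h : ∀ᵐ x ∂(Measure.pi fun _ : Fin N => μ), ∀ i, x i ∈ Icc a b :=
    ae_all_iff.2 fun i =>
      (measurePreserving_eval (fun _ : Fin N => μ) i).quasiMeasurePreserving.ae hμ
  exact h.mono fun x hx i _ => hx i

/-- The mean discrete energy of a sample of the minimiser, contracted towards a fixed
configuration. -/
lemma integral_discreteEnergy_le (ha : a' ≤ a) (hb : b ≤ b') (hc : 0 < c)
    (hΛ : 0 ≤ Λ) (hM : 0 ≤ M) {φ : ℝ → ℝ} {μ : Measure ℝ} (h : IsGas a b a' b' c Λ R M γ φ μ)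
    (hN : 0 < N) {ε : ℝ} (h0 : 0 < ε) (h1 : ε < 1) {v : Fin N → ℝ} (hv : v ∈ configs a b N) {J : ℝ}
    (hJ : (∫ p, curveLog γ p ∂(μ.prod μ)) + (|log (1 - ε)| + 2 * Λ * (ε * (b - a))) = J) :
    Integrable (fun x => discreteEnergy γ φ fun k => (1 - ε) * x k + ε * v k)
        (Measure.pi fun _ : Fin N => μ) ∧
      ∫ x, discreteEnergy γ φ (fun k => (1 - ε) * x k + ε * v k) ∂(Measure.pi fun _ : Fin N => μ) ≤
        J + |J| / N + 2 * ((∫ x, φ x ∂μ) + M * (ε * (b - a))) := by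
  have := h.adm.prob
  have hN' : (0 : ℝ) < N := by exact_mod_cast hN
  have hμ' := h.adm.mono ha hb
  set P := Measure.pi fun _ : Fin N => μ
  set T : Fin N → ℝ → ℝ := fun k s => (1 - ε) * s + ε * v k with hT
  have hTm : ∀ k, Measurable (T k) := fun k => by fun_prop
  have hκ : 0 < 1 - ε := sub_pos.2 h1
  have hTT : ∀ k x y, T k x - T k y = (1 - ε) * (x - y) := fun k x y => by
    simp only [hT]
    ring
  have hTI : ∀ k, ∀ x ∈ Icc a b, T k x ∈ Icc a b ∧ |T k x - x| ≤ ε * (b - a) := by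
    intro k x hx
    have hvk := hv k (mem_univ k)
    refine ⟨shrink_mem hx hvk h0.le h1.le, ?_⟩
    have e : T k x - x = ε * (v k - x) := by
      simp only [hT]
      ring
    rw [e, abs_mul, abs_of_pos h0]
    gcongr
    exact abs_sub_le_iff.2 ⟨by linarith [hvk.2, hx.1], by linarith [hvk.1, hx.2]⟩
  have hTμ : ∀ k, ∀ᵐ x ∂μ, T k x ∈ Icc a b ∧ |T k x - x| ≤ ε * (b - a) := fun k =>
    h.adm.carried.mono fun x hx => hTI k x hx
  have hTμ' : ∀ k, ∀ᵐ x ∂μ, T k x ∈ Icc a' b' ∧ |T k x - x| ≤ ε * (b - a) := fun k =>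
    (hTμ k).mono fun x hx => ⟨⟨ha.trans hx.1.1, hx.1.2.trans hb⟩, hx.2⟩
  have adm : ∀ k, IsAdmissible a' b' γ (μ.map (T k)) := fun k =>
    (isAdmissible_map_affine h.curve hc hΛ ha hb hκ (hTT k) (hTm k) hμ' (hTμ k)).mono ha hb
  have self : ∀ k, ∫ p, curveLog γ p ∂((μ.map (T k)).prod (μ.map (T k))) ≤ J := by
    intro k
    have := (abs_le.1 (integral_curveLog_affine h.curve hc hΛ hκ (hTT k) (hTm k) hμ' hμ' (hTμ' k)
      (hTμ' k)).2).2
    linarith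
  -- Different particles are contracted towards different points, so the image measures differ;
  -- positivity bounds their mutual energy by the common bound `J` for the self-energies.
  have cross : ∀ i j, ∫ p, curveLog γ p ∂((μ.map (T i)).prod (μ.map (T j))) ≤ J := by
    intro i j
    have h3 := (adm i).quadDiff_nonneg h.curve hc (adm j)
    rw [quadDiff] at h3
    linarith [self i, self j]
  have hmK := measurable_curveLog h.curve.continuous.measurable
  -- The diagonal terms vanish, while `J` may be negative; adding `|J|` there gives a bound of one
  -- form for all pairs and costs only `|J| / N`.
  have pair : ∀ i j, Integrable (fun x : Fin N → ℝ => curveLog γ (T i (x i), T j (x j))) P ∧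
      ∫ x, curveLog γ (T i (x i), T j (x j)) ∂P ≤ J + if i = j then |J| else 0 := by
    intro i j
    rcases eq_or_ne i j with rfl | hij
    · have e : (fun x : Fin N → ℝ => curveLog γ (T i (x i), T i (x i))) = fun _ => 0 := by
        funext x
        simp [curveLog]
      rw [e]
      refine ⟨integrable_zero _ _ _, ?_⟩
      simp only [integral_zero, if_true]
      linarith [neg_abs_le J]
    · have hmp := measurePreserving_pair μ hij
      have := adm i
      have hmap : (μ.map (T i)).prod (μ.map (T j)) = (μ.prod μ).map (Prod.map (T i) (T j)) :=
        Measure.map_prod_map _ _ (hTm i) (hTm j)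
      have hTT' : Measurable (Prod.map (T i) (T j)) := (hTm i).prodMap (hTm j)
      have i1 := (adm i).cross h.curve hc (adm j)
      have c1 := cross i j
      rw [hmap] at i1 c1
      rw [integrable_map_measure hmK.aestronglyMeasurable hTT'.aemeasurable] at i1
      rw [integral_map hTT'.aemeasurable hmK.aestronglyMeasurable] at c1
      have i2 := hmp.integrable_comp_of_integrable i1
      refine ⟨i2, ?_⟩
      rw [if_neg hij, add_zero]
      refine le_trans (le_of_eq ?_) c1
      rw [← hmp.map_eq]
      exact (integral_map (f := curveLog γ ∘ Prod.map (T i) (T j)) hmp.measurable.aemeasurable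
        (hmK.comp hTT').aestronglyMeasurable).symm
  have hiφ := integrable_of_continuous h.adm.carried h.cont
  have single : ∀ k, Integrable (fun x : Fin N → ℝ => φ (T k (x k))) P ∧
      ∫ x, φ (T k (x k)) ∂P ≤ (∫ x, φ x ∂μ) + M * (ε * (b - a)) := by
    intro k
    have hmp := measurePreserving_eval (fun _ : Fin N => μ) k
    have i1 : Integrable (fun s => φ (T k s)) μ := by
      obtain ⟨B, hB⟩ := isCompact_Icc.exists_bound_of_continuousOn h.cont.continuousOn
        (s := Icc a b)
      exact (integrable_const B).mono' (h.cont.measurable.comp (hTm k)).aestronglyMeasurable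
        ((hTμ k).mono fun u hu => hB _ hu.1)
    refine ⟨hmp.integrable_comp_of_integrable i1, ?_⟩
    have e : ∫ x, φ (T k (x k)) ∂P = ∫ s, φ (T k s) ∂μ := by
      conv_rhs => rw [← hmp.map_eq]
      exact (integral_map (f := fun s => φ (T k s)) hmp.measurable.aemeasurable
        (h.cont.measurable.comp (hTm k)).aestronglyMeasurable).symm
    rw [e]
    have h2 : ∫ s, φ (T k s) ∂μ ≤ ∫ s, (φ s + M * (ε * (b - a))) ∂μ := by
      refine integral_mono_ae i1 (hiφ.add (integrable_const _)) ?_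
      filter_upwards [hTμ k, h.adm.carried] with s hs hs'
      have h3 := (le_abs_self _).trans (h.lip _ hs.1 _ hs')
      have h4 := mul_le_mul_of_nonneg_left hs.2 hM
      linarith
    rw [integral_add hiφ (integrable_const _)] at h2
    simpa using h2
  have I1 : Integrable (fun x : Fin N → ℝ => ((N : ℝ) ^ 2)⁻¹ *
      ∑ i, ∑ j, curveLog γ (T i (x i), T j (x j))) P :=
    (integrable_finsetSum _ fun i _ => integrable_finsetSum _ fun j _ => (pair i j).1).const_mul _
  have I2 : Integrable (fun x : Fin N → ℝ => 2 * ((N : ℝ)⁻¹ * ∑ k, φ (T k (x k)))) P :=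
    ((integrable_finsetSum _ fun k _ => (single k).1).const_mul _).const_mul _
  refine ⟨I1.add I2, ?_⟩
  have e : ∫ x, discreteEnergy γ φ (fun k => (1 - ε) * x k + ε * v k) ∂P =
      ((N : ℝ) ^ 2)⁻¹ * (∑ i, ∑ j, ∫ x, curveLog γ (T i (x i), T j (x j)) ∂P) +
        2 * ((N : ℝ)⁻¹ * ∑ k, ∫ x, φ (T k (x k)) ∂P) := by
    have e1 : ∫ x, discreteEnergy γ φ (fun k => (1 - ε) * x k + ε * v k) ∂P =
      ∫ x, (((N : ℝ) ^ 2)⁻¹ * (∑ i, ∑ j, curveLog γ (T i (x i), T j (x j))) +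
        2 * ((N : ℝ)⁻¹ * ∑ k, φ (T k (x k)))) ∂P := rfl
    rw [e1, integral_add I1 I2, integral_const_mul, integral_const_mul, integral_const_mul,
      integral_finsetSum _ fun i _ => integrable_finsetSum _ fun j _ => (pair i j).1,
      integral_finsetSum _ fun k _ => (single k).1]
    congr 3
    funext i
    exact integral_finsetSum _ fun j _ => (pair i j).1
  rw [e]
  have s1 : ((N : ℝ) ^ 2)⁻¹ * (∑ i, ∑ j, ∫ x, curveLog γ (T i (x i), T j (x j)) ∂P) ≤
      J + |J| / N := by
    calc _ ≤ ((N : ℝ) ^ 2)⁻¹ * ∑ i : Fin N, ∑ j : Fin N, (J + if i = j then |J| else 0) := by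
          gcongr with i _ j _
          exact (pair i j).2
      _ = _ := by
          simp only [Finset.sum_add_distrib, Finset.sum_ite_eq, Finset.mem_univ, if_true,
            Finset.sum_const, Finset.card_univ, Fintype.card_fin, nsmul_eq_mul]
          field_simp
  have s2 : (N : ℝ)⁻¹ * ∑ k, ∫ x, φ (T k (x k)) ∂P ≤ (∫ x, φ x ∂μ) + M * (ε * (b - a)) := by
    calc _ ≤ (N : ℝ)⁻¹ * ∑ _k : Fin N, ((∫ x, φ x ∂μ) + M * (ε * (b - a))) := by
          gcongr with k
          exact (single k).2
      _ = _ := by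
          simp only [Finset.sum_const, Finset.card_univ, Fintype.card_fin, nsmul_eq_mul]
          field_simp
  linarith

lemma measurable_discreteEnergy (hγ : Measurable γ) {φ : ℝ → ℝ} (hφ : Measurable φ) :
    Measurable fun x : Fin N → ℝ => discreteEnergy γ φ x := by
  have := measurable_curveLog hγ
  unfold discreteEnergy
  fun_prop

/-- The Jacobian at `ε = N⁻²` is `exp (-2 N log N)`; the volume of the box and the energy error are
exponentials of `O(N)`, absorbed into `N log N`. -/
lemma exp_le_shrink_mul_exp {β K d : ℝ} (hN : 2 ≤ N) (hβ : 0 < β) (hK : 0 ≤ K) (hd : 0 < d)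
    (E : ℝ) : exp (-(β / 2 * (N : ℝ) ^ 2 * E) - (β * K + 2 + 2 * |log d|) * (N * log N)) ≤
      (((N : ℝ) ^ 2)⁻¹) ^ N * (d ^ N * exp (-(β / 2 * (N : ℝ) ^ 2 * (E + K / N)))) := by
  have hN' : (2 : ℝ) ≤ N := by exact_mod_cast hN
  have hN1 : (0 : ℝ) < N := by linarith
  have hlog := one_le_two_mul_log hN
  have e1 : (((N : ℝ) ^ 2)⁻¹) ^ N = exp (-(2 * (N * log N))) := by
    rw [← exp_log (pow_pos (inv_pos.2 (pow_pos hN1 2)) N), log_pow, log_inv, log_pow]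
    push_cast
    congr 1
    ring
  have e2 : d ^ N = exp (N * log d) := by
    rw [← exp_log (pow_pos hd N), log_pow]
  rw [e1, e2, ← exp_add, ← exp_add]
  apply exp_le_exp.2
  have e3 : β / 2 * (N : ℝ) ^ 2 * (E + K / N) = β / 2 * (N : ℝ) ^ 2 * E + β / 2 * K * N := by
    field_simp
  have t1 : (N : ℝ) ≤ 2 * (N * log N) := by nlinarith
  have t2 : β / 2 * K * N ≤ β / 2 * K * (2 * (N * log N)) := by gcongr
  have t3 : -(N * log d) ≤ |log d| * (2 * (N * log N)) := by
    calc -(N * log d) ≤ |log d| * N := by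
          nlinarith [neg_abs_le (log d)]
      _ ≤ _ := by gcongr
  rw [e3]
  linarith

/-- Lower bound for the partition function of a gas. -/
theorem exists_lintegral_gibbs_ge {β : ℝ} (hβ : 0 < β) (ha : a' ≤ a) (hab : a < b) (hb : b ≤ b')
    (hc : 0 < c) (hΛ : 0 ≤ Λ) (hM : 0 ≤ M) :
    ∃ C : ℝ, 0 ≤ C ∧ ∀ R γ φ μ, IsGas a b a' b' c Λ R M γ φ μ → ∀ N : ℕ, 2 ≤ N →
      ENNReal.ofReal (exp (-(β / 2 * (N : ℝ) ^ 2 * realEnergy γ φ μ) - C * (N * log N))) ≤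
        ∫⁻ x in configs a b N,
          ENNReal.ofReal (exp (-(β / 2 * (N : ℝ) ^ 2 * discreteEnergy γ φ x))) := by
  have hba : 0 < b - a := sub_pos.2 hab
  set Q := 1 + 2 * Λ * (b - a) with hQ
  set B := |log (c⁻¹ * (b - a))| + |2 - log (b - a) + |log c| + 4 * M * (b - a)| + Q with hB
  set K := Q + B + 2 * M * (b - a) with hK
  have hQ0 : 0 ≤ Q := by positivity
  have hB0 : 0 ≤ B := by positivity
  have hK0 : 0 ≤ K := by positivity
  refine ⟨β * K + 2 + 2 * |log (b - a)|, by positivity, ?_⟩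
  intro R γ φ μ h N hN
  have := h.adm.prob
  have hN0 : 0 < N := by omega
  have hN' : (2 : ℝ) ≤ N := by exact_mod_cast hN
  have hN1 : (0 : ℝ) < N := by linarith
  have hlog := one_le_two_mul_log hN
  set ε : ℝ := ((N : ℝ) ^ 2)⁻¹ with hε
  have ε0 : 0 < ε := by positivity
  have ε1 : ε ≤ (2 * (N : ℝ))⁻¹ := by
    apply inv_anti₀ (by positivity)
    nlinarith
  have ε2 : (2 * (N : ℝ))⁻¹ ≤ 1 / 4 := by
    rw [inv_eq_one_div]
    apply one_div_le_one_div_of_le <;> linarith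
  have ε3 : ε < 1 := by linarith
  have ε4 : ε ≤ 1 / N := by
    rw [mul_inv] at ε1
    have : 0 < (N : ℝ)⁻¹ := by positivity
    rw [one_div]
    linarith
  have hlogε : |log (1 - ε)| ≤ 1 / N := by
    have u1 := one_sub_inv_le_log_of_pos (show 0 < 1 - ε by linarith)
    have u2 : (1 - ε)⁻¹ ≤ 1 + 2 * ε := by
      rw [inv_le_iff_one_le_mul₀ (by linarith)]
      nlinarith
    have u3 : log (1 - ε) ≤ 0 := log_nonpos (by linarith) (by linarith)
    rw [abs_of_nonpos u3]
    rw [mul_inv] at ε1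
    rw [one_div]
    linarith
  set J := (∫ p, curveLog γ p ∂(μ.prod μ)) + (|log (1 - ε)| + 2 * Λ * (ε * (b - a))) with hJ
  have hq : |log (1 - ε)| + 2 * Λ * (ε * (b - a)) ≤ Q / N := by
    have : 2 * Λ * (ε * (b - a)) ≤ 2 * Λ * (1 / N * (b - a)) := by gcongr
    calc _ ≤ 1 / N + 2 * Λ * (1 / N * (b - a)) := add_le_add hlogε this
      _ = _ := by
        rw [hQ]
        field_simp
  have hJB : |J| ≤ B := by
    have h2 := integral_curveLog_ge (h.curve.mono ha hb) hc h.adm h.adm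
    have h3 := integral_curveLog_minimiser_le (h.curve.mono ha hb) hc hab h.cont hM h.lip h.adm
      h.minimal
    have h4 : Q / N ≤ Q := div_le_self hQ0 (by linarith)
    have h5 : 0 ≤ |log (1 - ε)| + 2 * Λ * (ε * (b - a)) := by positivity
    have h6 := le_abs_self (2 - log (b - a) + |log c| + 4 * M * (b - a))
    have h7 := abs_nonneg (log (c⁻¹ * (b - a)))
    have h8 := abs_nonneg (2 - log (b - a) + |log c| + 4 * M * (b - a))
    exact abs_le.2 ⟨by linarith, by linarith⟩
  set E := realEnergy γ φ μ with hE
  set F : (Fin N → ℝ) → ℝ≥0∞ := fun x =>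
    ENNReal.ofReal (exp (-(β / 2 * (N : ℝ) ^ 2 * discreteEnergy γ φ x))) with hF
  have hFm : Measurable F := by
    have := measurable_discreteEnergy (N := N) h.curve.continuous.measurable h.cont.measurable
    fun_prop
  have hv : ∀ v ∈ configs a b N, ENNReal.ofReal (exp (-(β / 2 * (N : ℝ) ^ 2 * (E + K / N)))) ≤
      ∫⁻ x, F (fun k => (1 - ε) * x k + ε * v k) ∂(Measure.pi fun _ : Fin N => μ) := by
    intro v hv
    obtain ⟨i1, i2⟩ := integral_discreteEnergy_le ha hb hc hΛ hM h hN0 ε0 ε3 hv hJ.symm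
    refine le_trans (ENNReal.ofReal_le_ofReal (exp_le_exp.2 ?_))
      (ofReal_exp_neg_integral_le (i1.const_mul (β / 2 * (N : ℝ) ^ 2)))
    rw [integral_const_mul, neg_le_neg_iff]
    gcongr
    refine i2.trans ?_
    have h1 : |J| / N ≤ B / N := by gcongr
    have h2 : M * (ε * (b - a)) ≤ M * (1 / N * (b - a)) := by gcongr
    have h3 : K / N = Q / N + B / N + 2 * (M * (1 / N * (b - a))) := by
      rw [hK]
      field_simp
    rw [hE, realEnergy, h3]
    linarith
  -- Average over `v` in the box and over `N` independent samples of `μ`. For fixed `v` Jensen's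
  -- inequality bounds the inner integral from below (`hv`); after exchanging the integrals, the
  -- change of variables bounds it from above for fixed `x`.
  have main : ENNReal.ofReal (ε ^ N) * (ENNReal.ofReal ((b - a) ^ N) *
      ENNReal.ofReal (exp (-(β / 2 * (N : ℝ) ^ 2 * (E + K / N))))) ≤
      ∫⁻ x in configs a b N, F x := by
    have hmeas : Measurable fun p : (Fin N → ℝ) × (Fin N → ℝ) =>
        F (fun k => (1 - ε) * p.1 k + ε * p.2 k) :=
      hFm.comp (by fun_prop)
    calc _ ≤ ENNReal.ofReal (ε ^ N) * ∫⁻ v in configs a b N,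
          ∫⁻ x, F (fun k => (1 - ε) * x k + ε * v k) ∂(Measure.pi fun _ : Fin N => μ) := by
          gcongr
          rw [← volume_configs hab.le, mul_comm, ← setLIntegral_const]
          exact setLIntegral_mono' (measurableSet_configs a b N) hv
      _ = ENNReal.ofReal (ε ^ N) * ∫⁻ x, (∫⁻ v in configs a b N,
          F (fun k => (1 - ε) * x k + ε * v k)) ∂(Measure.pi fun _ : Fin N => μ) := by
          rw [lintegral_lintegral_swap]
          exact (hmeas.comp measurable_swap).aemeasurable
      _ = ∫⁻ x, (ENNReal.ofReal (ε ^ N) * ∫⁻ v in configs a b N,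
          F (fun k => (1 - ε) * x k + ε * v k)) ∂(Measure.pi fun _ : Fin N => μ) := by
          rw [lintegral_const_mul _ hmeas.lintegral_prod_right']
      _ ≤ ∫⁻ _, (∫⁻ u in configs a b N, F u) ∂(Measure.pi fun _ : Fin N => μ) := by
          refine lintegral_mono_ae ?_
          filter_upwards [ae_pi_mem_configs h.adm.carried] with x hx
          exact lintegral_shrink_le hx ε0 ε3.le hFm
      _ = _ := by simp
  refine le_trans ?_ main
  rw [← ENNReal.ofReal_mul (by positivity), ← ENNReal.ofReal_mul (by positivity)]
  refine ENNReal.ofReal_le_ofReal ?_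
  exact exp_le_shrink_mul_exp hN hβ hK0 hba E

end CurveGas
end

noncomputable section
namespace CurveGas
open Filter Topology Real

/-! ### Large deviations in logarithmic distance -/

lemma sum_Ioi_eq_half {N : ℕ} {f : Fin N → Fin N → ℝ} (hs : ∀ i j, f i j = f j i)
    (h0 : ∀ i, f i i = 0) : ∑ i, ∑ j ∈ Finset.Ioi i, f i j = 1 / 2 * ∑ i, ∑ j, f i j := by
  have h1 : ∀ i, ∑ j, f i j = ∑ j ∈ Finset.Ioi i, f i j + ∑ j ∈ Finset.Iio i, f i j := by
    intro i
    have hd : Disjoint (Finset.Ioi i) (Finset.Iio i) := by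
      rw [Finset.disjoint_left]
      intro j hj hj'
      exact absurd (Finset.mem_Ioi.1 hj) (not_lt.2 (Finset.mem_Iio.1 hj').le)
    rw [← Finset.sum_union hd]
    symm
    refine Finset.sum_subset (Finset.subset_univ _) fun j _ hj => ?_
    have : j = i := by
      simp only [Finset.mem_union, Finset.mem_Ioi, Finset.mem_Iio, not_or, not_lt] at hj
      exact le_antisymm hj.1 hj.2
    rw [this, h0]
  have h2 : ∑ i, ∑ j ∈ Finset.Iio i, f i j = ∑ i, ∑ j ∈ Finset.Ioi i, f i j := by
    rw [Finset.sum_comm' (t' := Finset.univ) (s' := fun j => Finset.Ioi j) (by simp)]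
    exact Finset.sum_congr rfl fun i _ => Finset.sum_congr rfl fun j _ => hs j i
  simp_rw [h1]
  rw [Finset.sum_add_distrib, h2]
  ring

variable {a b a' b' c Λ R M β : ℝ} {γ γ₀ : ℝ → ℂ} {φ : ℝ → ℝ} {w : ℂ → ℂ} {N : ℕ} {x : Fin N → ℝ}

/-- Each unordered pair occurs once in the product and twice in the double sum, hence `β / 2`.
Distinct points are needed to write a distance as the exponential of its logarithm, as `log 0 = 0`.
-/
lemma weight_eq (hN : 0 < N) (hinj : InjOn γ (Icc a b)) (hγ₀ : ∀ x ∈ Icc a b, γ₀ x = γ x)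
    (hφ₀ : ∀ x ∈ Icc a b, field γ₀ w x = φ x) (hx : x ∈ configs a b N)
    (hxi : Function.Injective x) : weight β γ₀ w N x =
      (∏ k, ‖deriv γ₀ (x k)‖) * exp (-(β / 2 * (N : ℝ) ^ 2 * discreteEnergy γ φ x)) := by
  have hN' : (0 : ℝ) < N := by exact_mod_cast hN
  have hm : ∀ k, x k ∈ Icc a b := fun k => hx k (mem_univ k)
  have h1 : ∏ i : Fin N, ∏ j ∈ Finset.Ioi i, ‖γ₀ (x i) - γ₀ (x j)‖ ^ β =
      exp (-(β / 2 * ∑ i, ∑ j, curveLog γ (x i, x j))) := by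
    have e : -(β / 2 * ∑ i, ∑ j, curveLog γ (x i, x j)) =
        ∑ i, ∑ j ∈ Finset.Ioi i, -β * curveLog γ (x i, x j) := by
      simp_rw [← Finset.mul_sum]
      rw [sum_Ioi_eq_half (f := fun i j => curveLog γ (x i, x j))
        (fun i j => curveLog_swap γ (x j, x i)) (fun i => by simp [curveLog])]
      ring
    rw [e, exp_sum]
    refine Finset.prod_congr rfl fun i _ => ?_
    rw [exp_sum]
    refine Finset.prod_congr rfl fun j hj => ?_
    have hne : γ (x i) ≠ γ (x j) := fun h =>
      (Finset.mem_Ioi.1 hj).ne (hxi (hinj (hm i) (hm j) h))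
    rw [hγ₀ _ (hm i), hγ₀ _ (hm j), rpow_def_of_pos (norm_pos_iff.2 (sub_ne_zero.2 hne)), curveLog]
    congr 1
    ring
  rw [weight, h1, Finset.prod_mul_distrib, ← exp_sum]
  simp_rw [hφ₀ _ (hm _)]
  rw [mul_left_comm, ← exp_add, Finset.sum_neg_distrib, ← Finset.mul_sum, discreteEnergy]
  congr 2
  field_simp
  ring

/-- Configurations with a coincidence lie in finitely many proper subspaces. -/
lemma ae_injective (N : ℕ) : ∀ᵐ x : Fin N → ℝ, Function.Injective x := by
  have h : ∀ i j : Fin N, i ≠ j → ∀ᵐ x : Fin N → ℝ, x i ≠ x j := by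
    intro i j hij
    let S : Submodule ℝ (Fin N → ℝ) :=
      LinearMap.ker (LinearMap.proj (R := ℝ) (φ := fun _ : Fin N => ℝ) i - LinearMap.proj j)
    have hS : S ≠ ⊤ := by
      intro hS
      have h1 : (Pi.single i 1 : Fin N → ℝ) ∈ S := hS ▸ Submodule.mem_top
      simp [S, hij.symm] at h1
    have h2 := Measure.addHaar_submodule volume S hS
    rw [ae_iff]
    convert h2 using 2
    ext y
    simp [S, sub_eq_zero]
  have h' : ∀ᵐ x : Fin N → ℝ, ∀ i j : Fin N, i ≠ j → x i ≠ x j :=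
    ae_all_iff.2 fun i => ae_all_iff.2 fun j => by
      by_cases hij : i = j
      · simp [hij]
      · filter_upwards [h i j hij] with y hy _ using hy
  filter_upwards [h'] with y hy i j hij
  by_contra hne
  exact hy i j hne hij

lemma exists_partitionFunction_ge (hβ : 0 < β) (ha : a' ≤ a) (hab : a < b) (hb : b ≤ b')
    (hc : 0 < c) (hΛ : 0 ≤ Λ) (hM : 0 ≤ M) :
    ∃ C : ℝ, 0 ≤ C ∧ ∀ R γ φ μ, IsGas a b a' b' c Λ R M γ φ μ → ∀ γ₀ w,
      (∀ x ∈ Icc a b, γ₀ x = γ x) → (∀ x ∈ Icc a b, field γ₀ w x = φ x) →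
      (∀ x ∈ Icc a b, c ≤ ‖deriv γ₀ x‖) → ∀ N : ℕ, 2 ≤ N →
      ENNReal.ofReal (c ^ N * exp (-(β / 2 * (N : ℝ) ^ 2 * realEnergy γ φ μ) - C * (N * log N))) ≤
        partitionFunction β a b γ₀ w N := by
  obtain ⟨C, hC, H⟩ := exists_lintegral_gibbs_ge hβ ha hab hb hc hΛ hM
  refine ⟨C, hC, fun R γ φ μ h γ₀ w hγ₀ hφ₀ hd N hN => ?_⟩
  rw [ENNReal.ofReal_mul (by positivity)]
  refine (mul_le_mul_right (H R γ φ μ h N hN) _).trans ?_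
  have hm := measurable_discreteEnergy (N := N) h.curve.continuous.measurable h.cont.measurable
  rw [← lintegral_const_mul _ (by fun_prop), partitionFunction]
  refine lintegral_mono_ae ?_
  filter_upwards [ae_restrict_mem (measurableSet_configs a b N),
    ae_restrict_of_ae (ae_injective N)] with x hx hxi
  rw [weight_eq (by omega) ((h.curve.mono ha hb).injOn hc) hγ₀ hφ₀ hx hxi,
    ← ENNReal.ofReal_mul (by positivity)]
  refine ENNReal.ofReal_le_ofReal ?_
  gcongr
  calc c ^ N = ∏ _k : Fin N, c := by simp
    _ ≤ _ := Finset.prod_le_prod (fun _ _ => hc.le) fun k _ => hd _ (hx k (mem_univ k))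

/-- Large deviations of the regularised empirical measure in logarithmic distance. -/
theorem exists_realModel_logDist_le (hβ : 0 < β) (ha : a' ≤ a) (hab : a < b) (hb : b ≤ b')
    (hc : 0 < c) (hΛ : 0 ≤ Λ) (hM : 0 ≤ M) :
    ∃ C : ℝ, 0 ≤ C ∧ ∀ R γ φ μ, IsGas a b a' b' c Λ R M γ φ μ → ∀ γ₀ w,
      (∀ x ∈ Icc a' b', γ₀ x = γ x) → (∀ x ∈ Icc a b, field γ₀ w x = φ x) →
      (∀ x ∈ Icc a b, c ≤ ‖deriv γ₀ x‖ ∧ ‖deriv γ₀ x‖ ≤ c⁻¹) → ∀ N : ℕ, 2 ≤ N →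
      RegFits a b a' b' N → ∀ δ : ℝ, 0 < δ →
      realModel β a b γ₀ w N {x | ENNReal.ofReal δ ≤ logDist γ₀ (regEmpirical x) μ} ≤
        ENNReal.ofReal (exp (-(β / 2 * (N : ℝ) ^ 2 * δ ^ 2) + C * N * log N)) := by
  obtain ⟨C₁, hC₁, H₁⟩ := exists_discreteEnergy_ge ha hab hb hc hΛ hM
  obtain ⟨C₂, hC₂, H₂⟩ := exists_partitionFunction_ge hβ ha hab hb hc hΛ hM
  refine ⟨β / 2 * C₁ + C₂ + 4 * |log c| + 2 * |log (b - a)|, by positivity, ?_⟩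
  intro R γ φ μ h γ₀ w hγ₀ hφ₀ hd N hN hfit δ hδ
  have hba : 0 < b - a := sub_pos.2 hab
  have hN0 : 0 < N := by omega
  have hN' : (2 : ℝ) ≤ N := by exact_mod_cast hN
  have hN1 : (0 : ℝ) < N := by linarith
  have hlog := one_le_two_mul_log hN
  have hγ₀' : ∀ x ∈ Icc a b, γ₀ x = γ x := fun x hx => hγ₀ x ⟨ha.trans hx.1, hx.2.trans hb⟩
  set E := realEnergy γ φ μ
  set A : Set (Fin N → ℝ) := {x | ENNReal.ofReal δ ≤ logDist γ₀ (regEmpirical x) μ}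
  -- `m` bounds the weight on the event and `z` bounds the partition function from below. Both
  -- contain the minimal energy `E`, which cancels in `m / z`.
  set m : ℝ := c⁻¹ ^ N * exp (-(β / 2 * (N : ℝ) ^ 2 * (E + δ ^ 2 - C₁ * log N / N)))
  set z : ℝ := c ^ N * exp (-(β / 2 * (N : ℝ) ^ 2 * E) - C₂ * (N * log N))
  have hz : 0 < z := by positivity
  have hm : 0 ≤ m := by positivity
  have hZ := H₂ R γ φ μ h γ₀ w hγ₀' hφ₀ (fun x hx => (hd x hx).1) N hN
  have hA : ∫⁻ x in A, ENNReal.ofReal (weight β γ₀ w N x) ∂(volume.restrict (configs a b N)) ≤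
      ENNReal.ofReal (m * (b - a) ^ N) := by
    have h1 : ∫⁻ x in A, ENNReal.ofReal (weight β γ₀ w N x) ∂(volume.restrict (configs a b N)) ≤
        ∫⁻ _ in A, ENNReal.ofReal m ∂(volume.restrict (configs a b N)) := by
      refine setLIntegral_mono_ae aemeasurable_const ?_
      filter_upwards [ae_restrict_mem (measurableSet_configs a b N),
        ae_restrict_of_ae (ae_injective N)] with x hx hxi hxA
      rw [weight_eq hN0 ((h.curve.mono ha hb).injOn hc) hγ₀' hφ₀ hx hxi]
      refine ENNReal.ofReal_le_ofReal ?_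
      have hf : ∀ᵐ u ∂(regEmpirical x), u ∈ Icc a' b' := ae_iff.2 (hfit x hx)
      have hL := isAdmissible_regEmpirical h.curve hc hN0 hf
      have hμ' := h.adm.mono ha hb
      have h2 : ENNReal.ofReal δ ≤ logDist γ₀ (regEmpirical x) μ := hxA
      rw [logDist_eq h.curve hc hγ₀ hL hμ', ENNReal.ofReal_le_ofReal_iff (sqrt_nonneg _)] at h2
      have h3 : δ ^ 2 ≤ quadDiff (curveLog γ) (regEmpirical x) μ := by
        rw [← sq_sqrt (hL.quadDiff_nonneg h.curve hc hμ')]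
        gcongr
      have h4 := H₁ R γ φ μ h N hN x hx hxi hf
      have h5 : ∏ k, ‖deriv γ₀ (x k)‖ ≤ c⁻¹ ^ N := by
        calc _ ≤ ∏ _k : Fin N, c⁻¹ :=
              Finset.prod_le_prod (fun _ _ => norm_nonneg _) fun k _ => (hd _ (hx k (mem_univ k))).2
          _ = _ := by simp
      have h6 : E + δ ^ 2 - C₁ * log N / N ≤ discreteEnergy γ φ x := by linarith
      show _ ≤ c⁻¹ ^ N * _
      gcongr
    refine h1.trans ?_
    rw [setLIntegral_const, ENNReal.ofReal_mul hm, ← volume_configs hab.le]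
    refine mul_le_mul_right ?_ _
    calc _ ≤ (volume.restrict (configs a b N)) univ := measure_mono (subset_univ _)
      _ = _ := by rw [Measure.restrict_apply_univ]
  rw [realModel, Measure.smul_apply, withDensity_apply', smul_eq_mul]
  calc _ ≤ (ENNReal.ofReal z)⁻¹ * ENNReal.ofReal (m * (b - a) ^ N) := by
        gcongr
    _ = ENNReal.ofReal (z⁻¹ * (m * (b - a) ^ N)) := by
        rw [← ENNReal.ofReal_inv_of_pos hz, ← ENNReal.ofReal_mul (inv_pos.2 hz).le]
    _ ≤ _ := ENNReal.ofReal_le_ofReal ?_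
  have e1 : c ^ N = exp (N * log c) := by
    rw [← exp_log (pow_pos hc N), log_pow]
  have e2 : (b - a) ^ N = exp (N * log (b - a)) := by
    rw [← exp_log (pow_pos hba N), log_pow]
  show (c ^ N * _)⁻¹ * ((c⁻¹ ^ N * _) * (b - a) ^ N) ≤ _
  rw [inv_pow, e1, e2, mul_inv, ← exp_neg, ← exp_neg, ← exp_add, ← exp_add, ← exp_add, ← exp_add]
  apply exp_le_exp.2
  have e3 : β / 2 * (N : ℝ) ^ 2 * (E + δ ^ 2 - C₁ * log N / N) =
      β / 2 * (N : ℝ) ^ 2 * E + β / 2 * (N : ℝ) ^ 2 * δ ^ 2 - β / 2 * C₁ * (N * log N) := by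
    field_simp
  have t1 : (N : ℝ) ≤ 2 * (N * log N) := by nlinarith
  have key : ∀ u : ℝ, N * u ≤ |u| * (2 * (N * log N)) := by
    intro u
    calc N * u ≤ |u| * N := by
          nlinarith [le_abs_self u]
      _ ≤ _ := by gcongr
  have t2 := key (-log c)
  have t3 := key (log (b - a))
  rw [abs_neg] at t2
  rw [e3]
  linarith

end CurveGas
end

noncomputable section
namespace CurveGas
open Filter Topology Real

/-! ### The logarithmic kernel of the line -/

lemma curveLog_ofReal : curveLog (fun x : ℝ => (x : ℂ)) = lineLog := by
  funext p
  rw [curveLog, lineLog, ← Complex.ofReal_sub, Complex.norm_real, Real.norm_eq_abs]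

lemma chordLog_ofReal (p : ℝ × ℝ) : chordLog (fun x : ℝ => (x : ℂ)) p = 0 := by
  have h := curveLog_eq (fun x : ℝ => (x : ℂ)) p
  rw [curveLog_ofReal] at h
  linarith

lemma isRegularCurve_ofReal (a b : ℝ) :
    IsRegularCurve a b 1 0 (max |a| |b|) (fun x : ℝ => (x : ℂ)) := by
  have h : ∀ x y : ℝ, ‖(x : ℂ) - y‖ = |x - y| := fun x y => by
    rw [← Complex.ofReal_sub, Complex.norm_real, Real.norm_eq_abs]
  refine ⟨Complex.continuous_ofReal, fun x hx => ?_, fun x _ y _ => ?_, fun x _ y _ => ?_,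
    fun x _ y _ x' _ y' _ _ _ => ?_⟩
  · rw [Complex.norm_real, Real.norm_eq_abs]
    exact abs_le_max_abs_abs hx.1 hx.2
  · simp [h]
  · simp [h]
  · simp [chordLog_ofReal]

variable {a b c Λ R : ℝ} {γ : ℝ → ℂ}

/-- The kernels of the curve and of the line differ by the bounded function `chordLog`. -/
lemma IsAdmissible.ofReal (hγ : IsRegularCurve a b c Λ R γ) (hc : 0 < c) {μ : Measure ℝ}
    (h : IsAdmissible a b γ μ) : IsAdmissible a b (fun x : ℝ => (x : ℂ)) μ := by
  have := h.prob
  refine ⟨h.prob, h.carried, h.atomless, ?_⟩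
  rw [curveLog_ofReal]
  have e : lineLog = fun p => curveLog γ p + chordLog γ p := funext fun p => by
    rw [curveLog_eq]
    ring
  rw [e]
  exact h.integrable.add (hγ.integrable_chordLog hc h.carried h.carried)

/-- On the line, the logarithmic distance dominates the dual Sobolev norm. -/
lemma exists_sq_integral_sub_le_line : ∃ C : ℝ, 0 ≤ C ∧ ∀ (a b : ℝ) (α β : Measure ℝ),
    IsAdmissible a b (fun x : ℝ => (x : ℂ)) α → IsAdmissible a b (fun x : ℝ => (x : ℂ)) β →
    ∀ f : ℝ → ℝ, ContDiff ℝ ∞ f → HasCompactSupport f →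
      ((∫ x, f x ∂α) - ∫ x, f x ∂β) ^ 2 ≤
        C * ((∫ x, deriv f x ^ 2) + ∫ x, f x ^ 2) * quadDiff lineLog α β := by
  let χ : ContDiffBump (0 : ℝ) := default
  have hχ : ContDiff ℝ ∞ χ := χ.contDiff
  set C := (∫ y, χ y ^ 2) + ∫ y, deriv χ y ^ 2
  have i1 : 0 ≤ ∫ y, χ y ^ 2 := integral_nonneg fun y => sq_nonneg _
  have i2 : 0 ≤ ∫ y, deriv χ y ^ 2 := integral_nonneg fun y => sq_nonneg _
  refine ⟨C, by positivity, fun a b α β hα hβ f hf hfc => ?_⟩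
  have := hα.prob
  have := hβ.prob
  have := hα.atomless
  have := hβ.atomless
  have hι := isRegularCurve_ofReal a b
  have hm : Measurable fun x : ℝ => (x : ℂ) := hι.continuous.measurable
  have hinj := hι.injOn one_pos
  have := nullSingletonClass_map hm hinj hα.carried
  have := nullSingletonClass_map hm hinj hβ.carried
  have := Measure.isProbabilityMeasure_map (μ := α) hm.aemeasurable
  have := Measure.isProbabilityMeasure_map (μ := β) hm.aemeasurable
  -- The line sits in the plane as the real axis, and `f` is thickened by a fixed bump with `χ 0 =
  -- 1`; the Dirichlet integral of the product is at most a constant times the squared `H¹` norm of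
  -- `f`.
  set F : ℂ → ℝ := fun z => f z.re * χ z.im
  have hF : ContDiff ℝ ∞ F :=
    (hf.comp Complex.reCLM.contDiff).mul (hχ.comp Complex.imCLM.contDiff)
  have hFc : HasCompactSupport F := by
    refine HasCompactSupport.intro (K := tsupport f ×ℂ tsupport χ)
      (hfc.isCompact.reProdIm χ.hasCompactSupport.isCompact) fun z hz => ?_
    rw [Complex.mem_reProdIm, not_and_or] at hz
    rcases hz with hz | hz
    · simp [F, image_eq_zero_of_notMem_tsupport hz]
    · simp [F, image_eq_zero_of_notMem_tsupport hz]
  have hd : ∀ z : ℂ, fderiv ℝ F z 1 = deriv f z.re * χ z.im ∧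
      fderiv ℝ F z Complex.I = f z.re * deriv χ z.im := by
    intro z
    have d1 : HasFDerivAt (fun z : ℂ => f z.re) (deriv f z.re • Complex.reCLM) z :=
      (hf.differentiable (by norm_num) z.re).hasDerivAt.comp_hasFDerivAt z Complex.reCLM.hasFDerivAt
    have d2 : HasFDerivAt (fun z : ℂ => χ z.im) (deriv χ z.im • Complex.imCLM) z :=
      (hχ.differentiable (by norm_num) z.im).hasDerivAt.comp_hasFDerivAt z Complex.imCLM.hasFDerivAt
    have d3 : HasFDerivAt F (f z.re • (deriv χ z.im • Complex.imCLM) +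
      χ z.im • (deriv f z.re • Complex.reCLM)) z := d1.mul d2
    rw [d3.fderiv]
    constructor
    · simp [mul_comm]
    · simp
  have hprod : ∀ u v : ℝ → ℝ, ∫ z : ℂ, (u z.re * v z.im) ^ 2 =
      (∫ x, u x ^ 2) * ∫ y, v y ^ 2 := by
    intro u v
    rw [← integral_prod_mul, ← Measure.volume_eq_prod,
      ← Complex.volume_preserving_equiv_real_prod.integral_comp
        Complex.measurableEquivRealProd.measurableEmbedding]
    simp [mul_pow, Complex.measurableEquivRealProd_apply]
  have h := sq_integral_sub_le (α := α.map fun x : ℝ => (x : ℂ)) (β := β.map fun x : ℝ => (x : ℂ))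
    (by simp) ((integrable_planeLog_map hm _ _).2 hα.integrable)
    ((integrable_planeLog_map hm _ _).2 (hα.cross hι one_pos hβ))
    ((integrable_planeLog_map hm _ _).2 hβ.integrable) hF hFc
  have hQ := hα.quadDiff_nonneg hι one_pos hβ
  rw [curveLog_ofReal] at hQ
  rw [quadDiff_planeLog_map hm, curveLog_ofReal,
    integral_map hm.aemeasurable hF.continuous.aestronglyMeasurable,
    integral_map hm.aemeasurable hF.continuous.aestronglyMeasurable] at h
  simp_rw [(hd _).1, (hd _).2] at h
  rw [hprod, hprod] at h
  have e : ∀ x : ℝ, F (x : ℂ) = f x := fun x => by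
    have : χ 0 = 1 := χ.one_of_mem_closedBall (Metric.mem_closedBall_self χ.rIn_pos.le)
    simp [F, this]
  simp_rw [e] at h
  refine h.trans ?_
  gcongr
  have j1 : 0 ≤ ∫ x, f x ^ 2 := integral_nonneg fun y => sq_nonneg _
  have j2 : 0 ≤ ∫ x, deriv f x ^ 2 := integral_nonneg fun y => sq_nonneg _
  nlinarith

/-! ### Smoothness of the minimiser under translations -/

lemma integral_prod_map_add (μ : Measure ℝ) [IsFiniteMeasure μ] {K : ℝ × ℝ → ℝ}
    (hK : Measurable K) (h : ℝ) :
    ∫ p, K p ∂(μ.prod (μ.map fun x => x + h)) = ∫ p, K (p.1, p.2 + h) ∂(μ.prod μ) := by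
  have e : μ.prod (μ.map fun x => x + h) = (μ.prod μ).map (Prod.map id fun x => x + h) := by
    rw [← Measure.map_prod_map _ _ measurable_id (measurable_add_const h), Measure.map_id]
  rw [e, integral_map (by fun_prop) hK.aestronglyMeasurable]
  rfl

lemma integrable_prod_map_add (μ : Measure ℝ) [IsFiniteMeasure μ] {K : ℝ × ℝ → ℝ}
    (hK : Measurable K) (h : ℝ) (hi : Integrable K (μ.prod (μ.map fun x => x + h))) :
    Integrable (fun p => K (p.1, p.2 + h)) (μ.prod μ) := by
  have e : μ.prod (μ.map fun x => x + h) = (μ.prod μ).map (Prod.map id fun x => x + h) := by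
    rw [← Measure.map_prod_map _ _ measurable_id (measurable_add_const h), Measure.map_id]
  rw [e, integrable_map_measure hK.aestronglyMeasurable (by fun_prop)] at hi
  exact hi

lemma isAdmissible_map_add (hγ : IsRegularCurve a b c Λ R γ) (hc : 0 < c) (hΛ : 0 ≤ Λ) {d h : ℝ}
    (hh : |h| ≤ d) {μ : Measure ℝ} (hμ : IsAdmissible a b γ μ)
    (hs : ∀ᵐ x ∂μ, x ∈ Icc (a + d) (b - d)) : IsAdmissible a b γ (μ.map fun x => x + h) := by
  have := abs_le.1 hh
  refine isAdmissible_map_affine (κ := 1) (δ := d) hγ hc hΛ le_rfl le_rfl one_pos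
    (fun x y => by ring) (measurable_add_const h) hμ (hs.mono fun x hx => ⟨⟨?_, ?_⟩, ?_⟩)
  · linarith [hx.1]
  · linarith [hx.2]
  · simpa using hh

lemma ae_ne_add (μ : Measure ℝ) [IsFiniteMeasure μ] [NullSingletonClass μ] (h : ℝ) :
    ∀ᵐ p ∂(μ.prod μ), p.1 ≠ p.2 + h := by
  have h1 : ∀ᵐ p ∂(μ.prod μ), ¬ (p.1 = p.2 + h) := by
    rw [ae_iff]
    simp only [not_not]
    rw [Measure.measure_prod_null (measurableSet_eq_fun (by fun_prop) (by fun_prop))]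
    refine .of_forall fun x => ?_
    refine Set.Subsingleton.measure_zero ?_ μ
    intro y hy z hz
    have hy' : x = y + h := hy
    have hz' : x = z + h := hz
    linarith
  exact h1

/-- The minimiser moves by `O(h)` in logarithmic distance under translations by `h`. -/
lemma quadDiff_lineLog_map_add_le (hγ : IsRegularCurve a b c Λ R γ) (hc : 0 < c) (hΛ : 0 ≤ Λ)
    {φ : ℝ → ℝ} (hφ : Continuous φ) {μ : Measure ℝ} (hμ : IsAdmissible a b γ μ)
    (hmin : ∀ ρ, IsAdmissible a b γ ρ → realEnergy γ φ μ ≤ realEnergy γ φ ρ) {C₁ C₂ d h : ℝ}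
    (hC₁ : ∀ x y h : ℝ, x ∈ Icc a b → x + h ∈ Icc a b → x - h ∈ Icc a b → y ∈ Icc a b →
      x ≠ y → x + h ≠ y → x - h ≠ y →
      2 * chordLog γ (x, y) - chordLog γ (x + h, y) - chordLog γ (x - h, y) ≤ C₁ * h ^ 2)
    (hC₂ : ∀ x h : ℝ, x + h ∈ Icc a b → x - h ∈ Icc a b →
      φ (x + h) + φ (x - h) - 2 * φ x ≤ C₂ * h ^ 2)
    (hs : ∀ᵐ x ∂μ, x ∈ Icc (a + d) (b - d)) (h0 : 0 ≤ h) (hd : h ≤ d) :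
    quadDiff lineLog μ (μ.map fun x => x + h) ≤ (C₁ + C₂) * h ^ 2 := by
  have := hμ.prob
  have := hμ.atomless
  have hι := isRegularCurve_ofReal a b
  have hμι := hμ.ofReal hγ hc
  have habs : |h| ≤ d := by rwa [abs_of_nonneg h0]
  have habs' : |-h| ≤ d := by rwa [abs_neg]
  have ap := isAdmissible_map_add hγ hc hΛ habs hμ hs
  have am := isAdmissible_map_add hγ hc hΛ habs' hμ hs
  have lp := ap.ofReal hγ hc
  have lm := am.ofReal hγ hc
  have hKm := measurable_curveLog hγ.continuous.measurable
  -- Both translates, by `h` and by `-h`, are competitors; adding the two inequalities leaves only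
  -- second differences.
  have v1 := variational_inequality hγ hc le_rfl le_rfl hφ hμ hmin ap
  have v2 := variational_inequality hγ hc le_rfl le_rfl hφ hμ hmin am
  have ip := integrable_prod_map_add μ hKm h (hμ.cross hγ hc ap)
  have im := integrable_prod_map_add μ hKm (-h) (hμ.cross hγ hc am)
  have jp := hμι.cross hι one_pos lp
  have jm := hμι.cross hι one_pos lm
  have j0 := hμι.integrable
  rw [curveLog_ofReal] at jp jm j0
  have jp' := integrable_prod_map_add μ measurable_lineLog h jp
  have jm' := integrable_prod_map_add μ measurable_lineLog (-h) jm
  rw [integral_prod_map_add μ hKm, integral_map (by fun_prop) hφ.aestronglyMeasurable] at v1 v2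
  have hsub : ∀ {x : ℝ}, x ∈ Icc (a + d) (b - d) → x ∈ Icc a b ∧ x + h ∈ Icc a b ∧
      x - h ∈ Icc a b := fun hx =>
    ⟨⟨by linarith [hx.1], by linarith [hx.2]⟩, ⟨by linarith [hx.1], by linarith [hx.2]⟩,
      ⟨by linarith [hx.1], by linarith [hx.2]⟩⟩
  have f0 := integrable_of_continuous hμ.carried hφ
  have fp : Integrable (fun x => φ (x + h)) μ :=
    integrable_of_continuous hμ.carried (hφ.comp (continuous_add_const h))
  have fm : Integrable (fun x => φ (x + -h)) μ :=
    integrable_of_continuous hμ.carried (hφ.comp (continuous_add_const (-h)))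
  have w1 : (∫ x, φ (x + h) ∂μ) + (∫ x, φ (x + -h) ∂μ) - 2 * ∫ x, φ x ∂μ ≤ C₂ * h ^ 2 := by
    rw [← integral_const_mul, ← integral_add fp fm, ← integral_sub (by exact fp.add fm)
      (f0.const_mul 2)]
    have : ∫ x, (φ (x + h) + φ (x + -h) - 2 * φ x) ∂μ ≤ ∫ _, C₂ * h ^ 2 ∂μ := by
      refine integral_mono_ae ((fp.add fm).sub (f0.const_mul 2)) (integrable_const _) ?_
      filter_upwards [hs] with x hx
      have := hC₂ x h (hsub hx).2.1 (hsub hx).2.2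
      simpa [sub_eq_add_neg] using this
    simpa using this
  -- The curve kernel is the line kernel minus the chord kernel, whose second difference is at least
  -- `-C₁ h²`; so the curve may be replaced by the line at cost `C₁ h²`.
  have w2 : (∫ p, curveLog γ (p.1, p.2 + h) ∂(μ.prod μ)) +
      (∫ p, curveLog γ (p.1, p.2 + -h) ∂(μ.prod μ)) - 2 * ∫ p, curveLog γ p ∂(μ.prod μ) ≤
      (∫ p, lineLog (p.1, p.2 + h) ∂(μ.prod μ)) +
      (∫ p, lineLog (p.1, p.2 + -h) ∂(μ.prod μ)) - 2 * (∫ p, lineLog p ∂(μ.prod μ)) +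
        C₁ * h ^ 2 := by
    have i1 := (ip.add im).sub (hμ.integrable.const_mul 2)
    have i2 := (jp'.add jm').sub (j0.const_mul 2)
    have hle : ∫ p, (curveLog γ (p.1, p.2 + h) + curveLog γ (p.1, p.2 + -h) - 2 * curveLog γ p)
        ∂(μ.prod μ) ≤ ∫ p, ((lineLog (p.1, p.2 + h) + lineLog (p.1, p.2 + -h) - 2 * lineLog p) +
          C₁ * h ^ 2) ∂(μ.prod μ) := by
      refine integral_mono_ae i1 (i2.add (integrable_const _)) ?_
      filter_upwards [ae_prod_mem hs hs, ae_ne_add μ 0, ae_ne_add μ h, ae_ne_add μ (-h)]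
        with p hp n0 np nm
      have hsw : ∀ u v : ℝ, chordLog γ (u, v) = chordLog γ (v, u) := fun u v => by
        simp only [chordLog]
        rw [norm_sub_rev, abs_sub_comm]
      have h1 := hC₁ p.2 p.1 h (hsub hp.2).1 (hsub hp.2).2.1 (hsub hp.2).2.2 (hsub hp.1).1
        (by simpa using n0.symm) np.symm (by simpa [sub_eq_add_neg] using nm.symm)
      rw [hsw, hsw (p.2 + h), hsw (p.2 - h), sub_eq_add_neg p.2 h] at h1
      have e0 : curveLog γ p = lineLog p - chordLog γ (p.1, p.2) := curveLog_eq γ p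
      have e1 := curveLog_eq γ (p.1, p.2 + h)
      have e2 := curveLog_eq γ (p.1, p.2 + -h)
      linarith
    rw [integral_add (by exact i2) (integrable_const _), integral_sub (by exact ip.add im)
      (hμ.integrable.const_mul 2), integral_sub (by exact jp'.add jm') (j0.const_mul 2),
      integral_add ip im, integral_add jp' jm', integral_const_mul, integral_const_mul] at hle
    simpa using hle
  -- Exchanging the two variables reverses the shift. Together with the translation invariance `w4`,
  -- the second difference becomes minus the quadratic form of `μ` and its translate.
  have w3 : ∫ p, lineLog (p.1, p.2 + -h) ∂(μ.prod μ) = ∫ p, lineLog (p.1, p.2 + h) ∂(μ.prod μ) := by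
    rw [← integral_prod_swap]
    refine integral_congr_ae (.of_forall fun p => ?_)
    simp only [lineLog, Prod.fst_swap, Prod.snd_swap]
    rw [abs_sub_comm]
    congr 3
    ring
  have w4 : ∫ p, lineLog p ∂((μ.map fun x => x + h).prod (μ.map fun x => x + h)) =
      ∫ p, lineLog p ∂(μ.prod μ) := by
    have e : (μ.map fun x => x + h).prod (μ.map fun x => x + h) =
        (μ.prod μ).map (Prod.map (fun x => x + h) fun x => x + h) :=
      Measure.map_prod_map _ _ (measurable_add_const h) (measurable_add_const h)
    rw [e, integral_map (by fun_prop) measurable_lineLog.aestronglyMeasurable]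
    simp [lineLog]
  rw [quadDiff, w4, integral_prod_map_add μ measurable_lineLog]
  linarith

end CurveGas
end

noncomputable section
namespace CurveGas
open Filter Topology Real
open scoped Manifold

/-! ### Absolute continuity of measures that are smooth under translations -/

/-- If `μ` moves by `O(h)` in logarithmic distance under translations by `h`, then the derivative
of `μ` is bounded in the dual Sobolev norm. -/
lemma exists_abs_integral_deriv_le {a b : ℝ} {μ : Measure ℝ} {C d : ℝ} (hd : 0 < d) (hC : 0 ≤ C)
    (hμ : IsAdmissible a b (fun x : ℝ => (x : ℂ)) μ)
    (hτ : ∀ h, 0 ≤ h → h ≤ d →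
      IsAdmissible a b (fun x : ℝ => (x : ℂ)) (μ.map fun x => x + h) ∧
        quadDiff lineLog μ (μ.map fun x => x + h) ≤ C * h ^ 2) :
    ∃ K : ℝ, 0 ≤ K ∧ ∀ f : ℝ → ℝ, ContDiff ℝ ∞ f → HasCompactSupport f →
      (∫ x, deriv f x ∂μ) ^ 2 ≤ K * ((∫ x, deriv f x ^ 2) + ∫ x, f x ^ 2) := by
  obtain ⟨C₀, hC₀, H⟩ := exists_sq_integral_sub_le_line
  have := hμ.prob
  refine ⟨C₀ * C, by positivity, fun f hf hfc => ?_⟩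
  have hf1 : ContDiff ℝ 1 f := hf.of_le (by norm_num)
  have hdf : ContDiff ℝ 1 (deriv f) := by
    have : ContDiff ℝ ∞ (deriv f) := (contDiff_infty_iff_deriv.1 hf).2
    exact this.of_le (by norm_num)
  obtain ⟨L, hL⟩ := hdf.lipschitzWith_of_hasCompactSupport hfc.deriv (by norm_num)
  set S := (∫ x, deriv f x ^ 2) + ∫ x, f x ^ 2
  have j1 : 0 ≤ ∫ x, f x ^ 2 := integral_nonneg fun y => sq_nonneg _
  have j2 : 0 ≤ ∫ x, deriv f x ^ 2 := integral_nonneg fun y => sq_nonneg _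
  have hS : 0 ≤ S := add_nonneg j2 j1
  have if0 := integrable_of_continuous hμ.carried hf.continuous
  have ifd := integrable_of_continuous hμ.carried hdf.continuous
  -- The difference quotient of `f`, integrated against `μ`, is bounded by duality, since the
  -- distance to the translate is `O(h)`; replacing it by the derivative costs `L h`, with `L` a
  -- Lipschitz constant of `deriv f`.
  have key : ∀ h ∈ Ioc 0 d, |∫ x, deriv f x ∂μ| ≤ √(C₀ * C * S) + L * h := by
    intro h hh
    obtain ⟨hadm, hq⟩ := hτ h hh.1.le hh.2
    have h1 := H a b μ _ hμ hadm f hf hfc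
    rw [integral_map (by fun_prop) hf.continuous.aestronglyMeasurable] at h1
    have ifh : Integrable (fun x => f (x + h)) μ :=
      integrable_of_continuous hμ.carried (hf.continuous.comp (continuous_add_const h))
    have h2 : ((∫ x, f x ∂μ) - ∫ x, f (x + h) ∂μ) ^ 2 ≤ (√(C₀ * C * S) * h) ^ 2 := by
      rw [mul_pow, sq_sqrt (by positivity)]
      calc _ ≤ C₀ * S * quadDiff lineLog μ (μ.map fun x => x + h) := h1
        _ ≤ C₀ * S * (C * h ^ 2) := by gcongr
        _ = _ := by ring
    have h3 := abs_le_of_sq_le_sq h2 (mul_nonneg (sqrt_nonneg _) hh.1.le)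
    have h4 : |(∫ x, f (x + h) ∂μ) - (∫ x, f x ∂μ) - h * ∫ x, deriv f x ∂μ| ≤ L * h ^ 2 := by
      rw [← integral_const_mul, ← integral_sub ifh if0, ← integral_sub (by exact ifh.sub if0)
        (ifd.const_mul h)]
      have hb : ∀ x, ‖f (x + h) - f x - h * deriv f x‖ ≤ L * h ^ 2 := by
        intro x
        obtain ⟨ξ, hξ, he⟩ := exists_deriv_eq_slope f (show x < x + h by linarith [hh.1])
          hf.continuous.continuousOn (hf1.differentiable (by norm_num)).differentiableOn
        have e : f (x + h) - f x = h * deriv f ξ := by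
          rw [he, add_sub_cancel_left]
          field_simp [hh.1.ne']
        have e2 : f (x + h) - f x - h * deriv f x = h * (deriv f ξ - deriv f x) := by
          rw [e]
          ring
        have l := hL.dist_le_mul ξ x
        rw [Real.dist_eq, Real.dist_eq] at l
        have l2 : |ξ - x| ≤ h := abs_le.2 ⟨by linarith [hξ.1, hh.1], by linarith [hξ.2]⟩
        rw [e2, norm_mul, Real.norm_eq_abs, Real.norm_eq_abs, abs_of_pos hh.1]
        calc h * |deriv f ξ - deriv f x| ≤ h * (L * h) :=
              mul_le_mul_of_nonneg_left (l.trans (by gcongr)) hh.1.le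
          _ = _ := by ring
      have := norm_integral_le_of_norm_le_const (μ := μ) (.of_forall hb)
      simpa using this
    have h5 : h * |∫ x, deriv f x ∂μ| ≤ h * (√(C₀ * C * S) + L * h) := by
      rw [← abs_of_pos hh.1, ← abs_mul, abs_of_pos hh.1]
      rw [abs_le] at h3 h4
      exact abs_le.2 ⟨by linarith [h3.1, h3.2, h4.1, h4.2], by linarith [h3.1, h3.2, h4.1, h4.2]⟩
    exact le_of_mul_le_mul_left h5 hh.1
  have hlim : |∫ x, deriv f x ∂μ| ≤ √(C₀ * C * S) := by
    have ht : Tendsto (fun h : ℝ => √(C₀ * C * S) + L * h) (𝓝[>] 0) (𝓝 (√(C₀ * C * S) + L * 0)) :=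
      (Continuous.tendsto (by fun_prop) 0).mono_left nhdsWithin_le_nhds
    rw [mul_zero, add_zero] at ht
    exact ge_of_tendsto ht (by
      filter_upwards [Ioc_mem_nhdsGT hd] with h hh using key h hh)
  calc (∫ x, deriv f x ∂μ) ^ 2 = |∫ x, deriv f x ∂μ| ^ 2 := (sq_abs _).symm
    _ ≤ √(C₀ * C * S) ^ 2 := by gcongr
    _ = _ := sq_sqrt (by positivity)

lemma exists_smooth_le_indicator {A U : Set ℝ} (hA : IsClosed A) (hU : IsOpen U) (hAU : A ⊆ U) :
    ∃ g : ℝ → ℝ, ContDiff ℝ ∞ g ∧ (∀ x ∈ A, g x = 1) ∧ (∀ x, x ∉ U → g x = 0) ∧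
      ∀ x, g x ∈ Icc (0 : ℝ) 1 := by
  obtain ⟨g, h0, h1, h2⟩ := exists_contMDiffMap_zero_one_of_isClosed 𝓘(ℝ, ℝ) (n := (⊤ : ℕ∞))
    hU.isClosed_compl hA (disjoint_compl_left_iff_subset.2 hAU)
  exact ⟨g, g.contMDiff.contDiff, fun x hx => h1 hx, fun x hx => h0 hx, h2⟩

lemma exists_cutoff {a b : ℝ} (hab : a < b) : ∃ χ : ℝ → ℝ, ContDiff ℝ ∞ χ ∧ HasCompactSupport χ ∧
    (∀ x, χ x ∈ Icc (0 : ℝ) 1) ∧ ∀ x ∈ Icc a b, χ =ᶠ[𝓝 x] 1 := by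
  let χ : ContDiffBump ((a + b) / 2) := ⟨b - a, 2 * (b - a), by linarith, by linarith⟩
  refine ⟨χ, χ.contDiff, χ.hasCompactSupport, fun x => ⟨χ.nonneg, χ.le_one⟩, fun x hx => ?_⟩
  refine χ.eventuallyEq_one_of_mem_ball ?_
  rw [Metric.mem_ball, Real.dist_eq]
  show |x - (a + b) / 2| < b - a
  have := sub_pos.2 hab
  exact abs_lt.2 ⟨by linarith [hx.1], by linarith [hx.2]⟩

/-- A primitive of a smooth approximation of an indicator. -/
lemma exists_primitive_of_le_indicator {g : ℝ → ℝ} (hg : ContDiff ℝ ∞ g) {U : Set ℝ}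
    (hU : MeasurableSet U) (hUt : volume U ≠ ⊤) (hg0 : ∀ x, 0 ≤ g x)
    (hgU : ∀ x, g x ≤ U.indicator (fun _ => (1 : ℝ)) x) :
    ∃ G : ℝ → ℝ, ContDiff ℝ ∞ G ∧ (∀ x, HasDerivAt G (g x) x) ∧ ∀ x, |G x| ≤ volume.real U := by
  have iU : Integrable (U.indicator fun _ => (1 : ℝ)) :=
    (integrable_indicator_iff hU).2 (integrableOn_const hUt)
  have eU : ∫ x, U.indicator (fun _ => (1 : ℝ)) x = volume.real U := by
    rw [integral_indicator hU]
    simp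
  have hn : ∀ x, ‖g x‖ ≤ U.indicator (fun _ => (1 : ℝ)) x := fun x => by
    rw [Real.norm_eq_abs, abs_of_nonneg (hg0 x)]
    exact hgU x
  have ig : Integrable g := iU.mono' hg.continuous.aestronglyMeasurable (.of_forall hn)
  have hGd : ∀ x, HasDerivAt (fun x => ∫ s in (0 : ℝ)..x, g s) (g x) x := fun x =>
    intervalIntegral.integral_hasDerivAt_right (hg.continuous.intervalIntegrable _ _)
      (hg.continuous.stronglyMeasurableAtFilter _ _) hg.continuous.continuousAt
  have hGdd : deriv (fun x => ∫ s in (0 : ℝ)..x, g s) = g := funext fun x => (hGd x).deriv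
  refine ⟨fun x => ∫ s in (0 : ℝ)..x, g s, contDiff_infty_iff_deriv.2
    ⟨fun x => (hGd x).differentiableAt, by rwa [hGdd]⟩, hGd, fun x => ?_⟩
  calc |∫ s in (0 : ℝ)..x, g s| ≤ ∫ s in uIoc 0 x, ‖g s‖ :=
        intervalIntegral.norm_integral_le_integral_norm_uIoc (f := g) (μ := volume)
    _ ≤ ∫ s, ‖g s‖ := setIntegral_le_integral ig.norm (.of_forall fun s => norm_nonneg _)
    _ ≤ ∫ s, U.indicator (fun _ => (1 : ℝ)) s := integral_mono ig.norm iU hn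
    _ = _ := eU

/-- The Sobolev norm of a cut off primitive is small if the primitive and the mass are small. -/
lemma integral_sq_cutoff_mul_le {χ G g : ℝ → ℝ} (hχ : ContDiff ℝ ∞ χ) (hχc : HasCompactSupport χ)
    (hχ01 : ∀ x, χ x ∈ Icc (0 : ℝ) 1) (hGd : ∀ x, HasDerivAt G (g x) x) {ε : ℝ}
    (hε : ε ∈ Ioo (0 : ℝ) 1) (hGε : ∀ x, |G x| ≤ ε) {U : Set ℝ} (hU : MeasurableSet U)
    (hUt : volume U ≠ ⊤) (hUε : volume.real U ≤ ε) (hg0 : ∀ x, 0 ≤ g x)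
    (hgU : ∀ x, g x ≤ U.indicator (fun _ => (1 : ℝ)) x) :
    (∫ x, deriv (fun x => χ x * G x) x ^ 2) + ∫ x, (χ x * G x) ^ 2 ≤
      (2 * (∫ x, deriv χ x ^ 2) + 2 + ∫ x, χ x ^ 2) * ε := by
  have hχ' : Continuous (deriv χ) := (contDiff_infty_iff_deriv.1 hχ).2.continuous
  have hsq : ∀ {u : ℝ → ℝ}, Continuous u → HasCompactSupport u → Integrable fun x => u x ^ 2 := by
    intro u hu huc
    simp_rw [sq]
    exact (hu.mul hu).integrable_of_hasCompactSupport huc.mul_right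
  have ic1 : Integrable fun x => deriv χ x ^ 2 :=
    hsq hχ' hχc.deriv
  have ic2 : Integrable fun x => χ x ^ 2 :=
    hsq hχ.continuous hχc
  have iU : Integrable (U.indicator fun _ => (1 : ℝ)) :=
    (integrable_indicator_iff hU).2 (integrableOn_const hUt)
  have eU : ∫ x, U.indicator (fun _ => (1 : ℝ)) x = volume.real U := by
    rw [integral_indicator hU]
    simp
  have hG2 : ∀ x, G x ^ 2 ≤ ε := by
    intro x
    rw [← sq_abs]
    calc |G x| ^ 2 ≤ ε ^ 2 := by
          gcongr
          exact hGε x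
      _ ≤ ε := by nlinarith [hε.1, hε.2]
  have b1 : ∫ x, (χ x * G x) ^ 2 ≤ ε * ∫ x, χ x ^ 2 := by
    rw [← integral_const_mul]
    refine integral_mono_of_nonneg (.of_forall fun x => sq_nonneg _) (ic2.const_mul _)
      (.of_forall fun x => ?_)
    show (χ x * G x) ^ 2 ≤ ε * χ x ^ 2
    rw [mul_pow, mul_comm]
    exact mul_le_mul_of_nonneg_right (hG2 x) (sq_nonneg _)
  have hfd : ∀ x, deriv (fun x => χ x * G x) x = deriv χ x * G x + χ x * g x := fun x =>
    HasDerivAt.deriv (by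
      exact (hχ.differentiable (by norm_num) x).hasDerivAt.mul (hGd x))
  -- From `(p + q)² ≤ 2 p² + 2 q²`: the term with `G` is small pointwise, while the term with `g` is
  -- only bounded by `1` but lives on the small set `U`.
  have hpt : ∀ x, deriv (fun x => χ x * G x) x ^ 2 ≤
      2 * ε * deriv χ x ^ 2 + 2 * U.indicator (fun _ => (1 : ℝ)) x := by
    intro x
    have h2 : (χ x * g x) ^ 2 ≤ U.indicator (fun _ => (1 : ℝ)) x := by
      have hg1 : g x ≤ 1 := (hgU x).trans (indicator_le_self' (fun _ _ => zero_le_one) x)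
      have h3 : χ x * g x ≤ 1 := mul_le_one₀ (hχ01 x).2 (hg0 x) hg1
      have h4 : χ x * g x ≤ g x := mul_le_of_le_one_left (hg0 x) (hχ01 x).2
      have h5 : 0 ≤ χ x * g x := mul_nonneg (hχ01 x).1 (hg0 x)
      calc (χ x * g x) ^ 2 ≤ χ x * g x := by
            rw [sq]
            exact mul_le_of_le_one_left h5 h3
        _ ≤ _ := h4.trans (hgU x)
    have h3 : (deriv χ x * G x) ^ 2 ≤ ε * deriv χ x ^ 2 := by
      rw [mul_pow, mul_comm]
      exact mul_le_mul_of_nonneg_right (hG2 x) (sq_nonneg _)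
    rw [hfd]
    have h6 := sq_nonneg (deriv χ x * G x - χ x * g x)
    calc (deriv χ x * G x + χ x * g x) ^ 2 = 2 * (deriv χ x * G x) ^ 2 + 2 * (χ x * g x) ^ 2 -
          (deriv χ x * G x - χ x * g x) ^ 2 := by ring
      _ ≤ _ := by linarith
  have b2 : ∫ x, deriv (fun x => χ x * G x) x ^ 2 ≤ 2 * ε * (∫ x, deriv χ x ^ 2) + 2 * ε := by
    have h := integral_mono_of_nonneg (μ := volume) (.of_forall fun x => sq_nonneg _)
      ((ic1.const_mul (2 * ε)).add (iU.const_mul 2)) (.of_forall hpt)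
    simp only [Pi.add_apply] at h
    rw [integral_add (ic1.const_mul _) (iU.const_mul _), integral_const_mul,
      integral_const_mul, eU] at h
    linarith
  linarith

/-- A measure whose derivative is bounded in the dual Sobolev norm does not charge compact null
sets. -/
lemma measure_eq_zero_of_isCompact {a b : ℝ} (hab : a < b) {μ : Measure ℝ}
    [IsProbabilityMeasure μ] (hμ : ∀ᵐ x ∂μ, x ∈ Icc a b) {K : ℝ} (hK : 0 ≤ K)
    (hd : ∀ f : ℝ → ℝ, ContDiff ℝ ∞ f → HasCompactSupport f →
      (∫ x, deriv f x ∂μ) ^ 2 ≤ K * ((∫ x, deriv f x ^ 2) + ∫ x, f x ^ 2))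
    {A : Set ℝ} (hA : IsCompact A) (hA0 : volume A = 0) : μ A = 0 := by
  obtain ⟨χ, hχ, hχc, hχ01, hχ1⟩ := exists_cutoff hab
  obtain ⟨Q, hQ⟩ : ∃ Q, Q = 2 * (∫ x, deriv χ x ^ 2) + 2 + ∫ x, χ x ^ 2 := ⟨_, rfl⟩
  have key : ∀ ε ∈ Ioo (0 : ℝ) 1, μ.real A ^ 2 ≤ K * Q * ε := by
    intro ε hε
    -- The null set is covered by an open set of volume below `ε`. The test function is a cut-off
    -- primitive of a smooth `g` with `1_A ≤ g ≤ 1_U`: its derivative equals `g` on `[a, b]`, while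
    -- its squared `H¹` norm is `O(ε)`.
    obtain ⟨U, hAU, hUo, hUε⟩ := A.exists_isOpen_lt_of_lt (μ := volume) (ENNReal.ofReal ε)
      (by rw [hA0]; exact ENNReal.ofReal_pos.2 hε.1)
    have hUr : volume.real U ≤ ε := ENNReal.toReal_le_of_le_ofReal hε.1.le hUε.le
    have hUt : volume U ≠ ⊤ := (hUε.trans ENNReal.ofReal_lt_top).ne
    obtain ⟨g, hg, hgA, hgU, hg01⟩ := exists_smooth_le_indicator hA.isClosed hUo hAU
    have hgle : ∀ x, g x ≤ U.indicator (fun _ => (1 : ℝ)) x := by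
      intro x
      by_cases hx : x ∈ U
      · rw [indicator_of_mem hx]
        exact (hg01 x).2
      · rw [indicator_of_notMem hx, hgU x hx]
    obtain ⟨G, hG, hGd, hGU⟩ := exists_primitive_of_le_indicator hg hUo.measurableSet hUt
      (fun x => (hg01 x).1) hgle
    have hb := integral_sq_cutoff_mul_le hχ hχc hχ01 hGd hε (fun x => (hGU x).trans hUr)
      hUo.measurableSet hUt hUr (fun x => (hg01 x).1) hgle
    have hfI : ∀ x ∈ Icc a b, deriv (fun x => χ x * G x) x = g x := by
      intro x hx
      have he : (fun x => χ x * G x) =ᶠ[𝓝 x] G := by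
        filter_upwards [hχ1 x hx] with y hy
        rw [hy, Pi.one_apply, one_mul]
      rw [he.deriv_eq, (hGd x).deriv]
    have e1 : ∫ x, deriv (fun x => χ x * G x) x ∂μ = ∫ x, g x ∂μ :=
      integral_congr_ae (hμ.mono fun x hx => hfI x hx)
    have e2 : μ.real A ≤ ∫ x, g x ∂μ := by
      rw [← integral_indicator_one hA.measurableSet]
      refine integral_mono ((integrable_indicator_iff hA.measurableSet).2 (by
        exact integrableOn_const (measure_ne_top _ _)))
        (integrable_of_continuous hμ hg.continuous) fun x => ?_
      by_cases hx : x ∈ A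
      · rw [indicator_of_mem hx, hgA x hx, Pi.one_apply]
      · rw [indicator_of_notMem hx]
        exact (hg01 x).1
    rw [← hQ] at hb
    calc μ.real A ^ 2 ≤ (∫ x, g x ∂μ) ^ 2 := by gcongr
      _ = (∫ x, deriv (fun x => χ x * G x) x ∂μ) ^ 2 := by rw [e1]
      _ ≤ _ := hd _ (hχ.mul hG) hχc.mul_right
      _ ≤ K * (Q * ε) := by gcongr
      _ = _ := by ring
  have hlim : μ.real A ^ 2 ≤ 0 := by
    have ht : Tendsto (fun ε : ℝ => K * Q * ε) (𝓝[>] 0) (𝓝 (K * Q * 0)) :=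
      (Continuous.tendsto (by fun_prop) 0).mono_left nhdsWithin_le_nhds
    rw [mul_zero] at ht
    exact ge_of_tendsto ht (by
      filter_upwards [Ioo_mem_nhdsGT one_pos] with ε hε using key ε hε)
  have h0 : μ.real A = 0 :=
    (pow_eq_zero_iff two_ne_zero).1 (le_antisymm hlim (sq_nonneg _))
  exact (measureReal_eq_zero_iff (measure_ne_top μ A)).1 h0

/-- Absolute continuity of a minimiser supported inside the open interval. -/
theorem absolutelyContinuous_of_isMinimiser {a b c Λ R : ℝ} {γ : ℝ → ℂ} (hab : a < b)
    (hγ : IsRegularCurve a b c Λ R γ) (hc : 0 < c) (hΛ : 0 ≤ Λ)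
    {φ : ℝ → ℝ} (hφ : Continuous φ) {μ : Measure ℝ} (hμ : IsAdmissible a b γ μ)
    (hmin : ∀ ρ, IsAdmissible a b γ ρ → realEnergy γ φ μ ≤ realEnergy γ φ ρ) {C₁ C₂ d : ℝ}
    (h1 : 0 ≤ C₁) (h2 : 0 ≤ C₂)
    (hC₁ : ∀ x y h : ℝ, x ∈ Icc a b → x + h ∈ Icc a b → x - h ∈ Icc a b → y ∈ Icc a b →
      x ≠ y → x + h ≠ y → x - h ≠ y →
      2 * chordLog γ (x, y) - chordLog γ (x + h, y) - chordLog γ (x - h, y) ≤ C₁ * h ^ 2)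
    (hC₂ : ∀ x h : ℝ, x + h ∈ Icc a b → x - h ∈ Icc a b →
      φ (x + h) + φ (x - h) - 2 * φ x ≤ C₂ * h ^ 2)
    (hd : 0 < d) (hs : ∀ᵐ x ∂μ, x ∈ Icc (a + d) (b - d)) : μ ≪ volume := by
  have := hμ.prob
  obtain ⟨K, hK, H⟩ := exists_abs_integral_deriv_le hd (add_nonneg h1 h2) (hμ.ofReal hγ hc)
    fun h h0 hhd => ⟨(isAdmissible_map_add hγ hc hΛ (by rwa [abs_of_nonneg h0]) hμ hs).ofReal hγ hc,
      quadDiff_lineLog_map_add_le hγ hc hΛ hφ hμ hmin hC₁ hC₂ hs h0 hhd⟩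
  refine Measure.AbsolutelyContinuous.mk fun B hB hB0 => ?_
  by_contra hne
  obtain ⟨A, hAB, hA, hpos⟩ := hB.exists_lt_isCompact (μ := μ) (pos_iff_ne_zero.2 hne)
  exact hpos.ne' (measure_eq_zero_of_isCompact hab hμ.carried hK H hA (measure_mono_null hAB hB0))

/-- A measure whose topological support lies in an open subset of `[a, b]` stays at positive
distance from the endpoints. -/
lemma exists_ae_mem_Icc_of_support_subset {a b : ℝ} {μ : Measure ℝ} {O : Set ℝ} (hO : IsOpen O)
    (hOab : O ⊆ Icc a b) (hμ : μ.support ⊆ O) :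
    ∃ d : ℝ, 0 < d ∧ ∀ᵐ x ∂μ, x ∈ Icc (a + d) (b - d) := by
  have hsub : μ.support ⊆ Ioo a b := hμ.trans (by
    rw [← interior_Icc]
    exact interior_maximal hOab hO)
  have hcpt : IsCompact μ.support :=
    isCompact_Icc.of_isClosed_subset Measure.isClosed_support (hμ.trans hOab)
  -- An open subset of `[a, b]` misses the endpoints, and compactness of the support turns this into
  -- a positive distance.
  obtain ⟨d, hd, hdi⟩ := hcpt.exists_cthickening_subset_open isOpen_Ioo hsub
  refine ⟨d, hd, ?_⟩
  have hae : ∀ᵐ x ∂μ, x ∈ μ.support := Measure.support_mem_ae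
  filter_upwards [hae] with x hx
  have hball := (Metric.closedBall_subset_cthickening hx d).trans hdi
  rw [Real.closedBall_eq_Icc] at hball
  have e1 := hball (left_mem_Icc.2 (by linarith))
  have e2 := hball (right_mem_Icc.2 (by linarith))
  exact ⟨by linarith [e1.1], by linarith [e2.2]⟩

end CurveGas
end

noncomputable section
namespace CurveGas
open Filter Topology Real
open scoped Convolution

/-! ### Lipschitz representatives of functions with bounded weak derivative -/

lemma ae_norm_le_toReal_eLpNorm {a b : ℝ} {f : ℝ → ℂ}
    (hf : MemLp f ⊤ (volume.restrict (Icc a b))) :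
    ∀ᵐ x ∂(volume.restrict (Icc a b)), ‖f x‖ ≤ (eLpNorm f ⊤ (volume.restrict (Icc a b))).toReal := by
  have h1 := ae_le_eLpNormEssSup (f := f) (μ := volume.restrict (Icc a b))
  filter_upwards [h1] with x hx
  rw [← eLpNorm_exponent_top] at hx
  have h2 := ENNReal.toReal_mono hf.2.ne hx
  simpa using h2

section Mollify

variable {a b : ℝ} {f g : ℝ → ℂ}

lemma locallyIntegrable_indicator (hf : MemLp f ⊤ (volume.restrict (Icc a b))) :
    LocallyIntegrable ((Icc a b).indicator f) := by
  have h : IntegrableOn f (Icc a b) := hf.integrable le_top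
  exact ((integrable_indicator_iff measurableSet_Icc).2 h).locallyIntegrable

/-- The derivative of a mollification is bounded by the weak derivative. -/
lemma norm_deriv_mollify_le (hf : IsW1Inf a b f g) (φ : ContDiffBump (0 : ℝ)) {x : ℝ}
    (hx : Icc (x - φ.rOut) (x + φ.rOut) ⊆ Ioo a b) :
    ‖(deriv (φ.normed volume) ⋆[ContinuousLinearMap.lsmul ℝ ℝ, volume]
      ((Icc a b).indicator f)) x‖ ≤ (eLpNorm g ⊤ (volume.restrict (Icc a b))).toReal := by
  set B := (eLpNorm g ⊤ (volume.restrict (Icc a b))).toReal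
  have hφ : ContDiff ℝ ∞ (φ.normed volume) := φ.contDiff_normed
  set ψ : ℝ → ℝ := fun t => φ.normed volume (x - t)
  have hψ : ContDiff ℝ ∞ ψ := hφ.comp (contDiff_const.sub contDiff_id)
  have hts : Function.support ψ ⊆ Icc (x - φ.rOut) (x + φ.rOut) := by
    intro t ht
    have h1 : x - t ∈ Function.support (φ.normed volume) := ht
    rw [φ.support_normed_eq, Metric.mem_ball, Real.dist_eq, sub_zero, abs_lt] at h1
    exact ⟨by linarith [h1.2], by linarith [h1.1]⟩
  have hts' : tsupport ψ ⊆ Icc (x - φ.rOut) (x + φ.rOut) := closure_minimal hts isClosed_Icc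
  have hψc : HasCompactSupport ψ := isCompact_Icc.of_isClosed_subset (isClosed_tsupport ψ) hts'
  have hd : ∀ t, deriv ψ t = -deriv (φ.normed volume) (x - t) := fun t => by
    have := deriv_comp_const_sub (φ.normed volume) x t
    exact this
  -- The reflected bump `ψ` is an admissible test function, since its support lies inside the open
  -- interval; the weak derivative then moves from `ψ` to `g`.
  have h1 : (deriv (φ.normed volume) ⋆[ContinuousLinearMap.lsmul ℝ ℝ, volume]
      ((Icc a b).indicator f)) x = ∫ t in Icc a b, ψ t • g t := by
    rw [convolution_lsmul_swap]
    have e : ∀ t, deriv (φ.normed volume) (x - t) • (Icc a b).indicator f t =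
        (Icc a b).indicator (fun t => -(deriv ψ t • f t)) t := by
      intro t
      by_cases ht : t ∈ Icc a b
      · rw [indicator_of_mem ht, indicator_of_mem ht, hd, neg_smul, neg_neg]
      · rw [indicator_of_notMem ht, indicator_of_notMem ht, smul_zero]
    simp_rw [e]
    rw [integral_indicator measurableSet_Icc, integral_neg,
      hf.weak_deriv ψ hψ hψc (hts'.trans hx), neg_neg]
  have iψ : Integrable ψ := hψ.continuous.integrable_of_hasCompactSupport hψc
  have hψ0 : ∀ t, 0 ≤ ψ t := fun t => φ.nonneg_normed _
  rw [h1]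
  calc ‖∫ t in Icc a b, ψ t • g t‖ ≤ ∫ t in Icc a b, ψ t * B := by
        refine norm_integral_le_of_norm_le (iψ.integrableOn.mul_const B) ?_
        filter_upwards [ae_norm_le_toReal_eLpNorm hf.memLp_deriv] with t ht
        rw [norm_smul, Real.norm_eq_abs, abs_of_nonneg (hψ0 t)]
        exact mul_le_mul_of_nonneg_left ht (hψ0 t)
    _ ≤ ∫ t, ψ t * B := setIntegral_le_integral (iψ.mul_const B)
        (.of_forall fun t => mul_nonneg (hψ0 t) ENNReal.toReal_nonneg)
    _ = B := by
        rw [integral_mul_const, integral_sub_left_eq_self (φ.normed volume) volume x,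
          φ.integral_normed, one_mul]

/-- Functions with bounded weak derivative are Lipschitz almost everywhere. -/
lemma exists_ae_lipschitz (hf : IsW1Inf a b f g) :
    ∃ S : Set ℝ, (∀ᵐ x ∂(volume.restrict (Icc a b)), x ∈ S) ∧ ∀ x ∈ S, ∀ y ∈ S,
      ‖f x - f y‖ ≤ (eLpNorm g ⊤ (volume.restrict (Icc a b))).toReal * |x - y| := by
  set B := (eLpNorm g ⊤ (volume.restrict (Icc a b))).toReal
  have h0 : ∀ n : ℕ, (0 : ℝ) < 1 / ((n : ℝ) + 1) := fun n => Nat.one_div_pos_of_nat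
  let φ : ℕ → ContDiffBump (0 : ℝ) := fun n =>
    ⟨1 / ((n : ℝ) + 1), 2 * (1 / ((n : ℝ) + 1)), h0 n, by linarith [h0 n]⟩
  have hlim : Tendsto (fun n => (φ n).rOut) atTop (𝓝 0) := by
    have := (tendsto_one_div_add_atTop_nhds_zero_nat (𝕜 := ℝ)).const_mul 2
    rw [mul_zero] at this
    exact this
  have hloc := locallyIntegrable_indicator hf.memLp
  set F := (Icc a b).indicator f
  -- At almost every point the mollifications converge to the function itself, so their common
  -- Lipschitz bound passes to `f` on a set of full measure.
  have hconv := ContDiffBump.ae_convolution_tendsto_right_of_locallyIntegrable (μ := volume)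
    (K := 2) hlim (.of_forall fun n => le_rfl) hloc
  refine ⟨{x | x ∈ Ioo a b ∧ Tendsto (fun n => ((φ n).normed volume
    ⋆[ContinuousLinearMap.lsmul ℝ ℝ, volume] F) x) atTop (𝓝 (F x))}, ?_, ?_⟩
  · have h1 : ∀ᵐ x ∂(volume.restrict (Icc a b)), x ∈ Ioo a b := by
      rw [← restrict_Ioo_eq_restrict_Icc]
      exact ae_restrict_mem measurableSet_Ioo
    filter_upwards [h1, ae_restrict_of_ae hconv] with x hx hx' using ⟨hx, hx'⟩
  · have key : ∀ x y : ℝ, x ≤ y → x ∈ Ioo a b → y ∈ Ioo a b → ∀ᶠ n in atTop,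
        ‖((φ n).normed volume ⋆[ContinuousLinearMap.lsmul ℝ ℝ, volume] F) y -
          ((φ n).normed volume ⋆[ContinuousLinearMap.lsmul ℝ ℝ, volume] F) x‖ ≤ B * (y - x) := by
      intro x y hxy hx hy
      have h1 : ∀ᶠ n in atTop, (φ n).rOut < min (x - a) (b - y) :=
        hlim.eventually_lt_const (lt_min (sub_pos.2 hx.1) (sub_pos.2 hy.2))
      filter_upwards [h1] with n hn
      have hn1 := hn.trans_le (min_le_left _ _)
      have hn2 := hn.trans_le (min_le_right _ _)
      refine norm_image_sub_le_of_norm_deriv_le_segment' (a := x) (b := y)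
        (f' := fun z => (deriv ((φ n).normed volume)
          ⋆[ContinuousLinearMap.lsmul ℝ ℝ, volume] F) z) (fun z hz => ?_) (fun z hz => ?_)
        y (right_mem_Icc.2 hxy)
      · exact ((φ n).hasCompactSupport_normed.hasDerivAt_convolution_left _
          (φ n).contDiff_normed hloc z).hasDerivWithinAt
      · refine norm_deriv_mollify_le hf (φ n) fun w hw => ?_
        exact ⟨by linarith [hw.1, hz.1], by linarith [hw.2, hz.2]⟩
    have lim : ∀ x y : ℝ, x ≤ y → x ∈ Ioo a b → y ∈ Ioo a b →
        Tendsto (fun n => ((φ n).normed volume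
          ⋆[ContinuousLinearMap.lsmul ℝ ℝ, volume] F) x) atTop (𝓝 (F x)) →
        Tendsto (fun n => ((φ n).normed volume
          ⋆[ContinuousLinearMap.lsmul ℝ ℝ, volume] F) y) atTop (𝓝 (F y)) →
        ‖f y - f x‖ ≤ B * (y - x) := by
      intro x y hxy hx hy tx ty
      have h1 := le_of_tendsto (ty.sub tx).norm (key x y hxy hx hy)
      have ex : F x = f x := indicator_of_mem (Ioo_subset_Icc_self hx) f
      have ey : F y = f y := indicator_of_mem (Ioo_subset_Icc_self hy) f
      rwa [ex, ey] at h1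
    rintro x ⟨hx, tx⟩ y ⟨hy, ty⟩
    rcases le_total x y with h | h
    · rw [norm_sub_rev, abs_sub_comm, abs_of_nonneg (sub_nonneg.2 h)]
      exact lim x y h hx hy tx ty
    · rw [abs_of_nonneg (sub_nonneg.2 h)]
      exact lim y x h hy hx ty tx

/-- Extension from `S` with the same Lipschitz constant, then clipping to `[-M, M]`, which does not
increase that constant and leaves the values on `S` unchanged. -/
lemma exists_lipschitz_extension {S : Set ℝ} {u : ℝ → ℝ} {M : ℝ} (hM : 0 ≤ M)
    (hb : ∀ x ∈ S, |u x| ≤ M) (hL : ∀ x ∈ S, ∀ y ∈ S, |u x - u y| ≤ M * |x - y|) :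
    ∃ v : ℝ → ℝ, (∀ x ∈ S, u x = v x) ∧ (∀ x, |v x| ≤ M) ∧ ∀ x y, |v x - v y| ≤ M * |x - y| := by
  have h1 : LipschitzOnWith M.toNNReal u S := by
    apply LipschitzOnWith.of_dist_le_mul
    intro x hx y hy
    rw [Real.dist_eq, Real.dist_eq, Real.coe_toNNReal _ hM]
    exact hL x hx y hy
  obtain ⟨w, hw, hwS⟩ := h1.extend_real
  have h2 : LipschitzWith M.toNNReal fun x => max (-M) (min M (w x)) :=
    (hw.const_min M).const_max (-M)
  refine ⟨fun x => max (-M) (min M (w x)), fun x hx => ?_, fun x => ?_, fun x y => ?_⟩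
  · have h3 := abs_le.1 (hb x hx)
    show u x = max (-M) (min M (w x))
    rw [← hwS hx, min_eq_right h3.2, max_eq_right h3.1]
  · exact abs_le.2 ⟨le_max_left _ _, max_le (by linarith) (min_le_left _ _)⟩
  · have := h2.dist_le_mul x y
    rwa [Real.dist_eq, Real.dist_eq, Real.coe_toNNReal _ hM] at this

/-- A function with bounded weak derivative has bounded Lipschitz real and imaginary parts, up to
a null set. -/
theorem exists_lipschitz_representative (hf : IsW1Inf a b f g) :
    ∃ u v : ℝ → ℝ, (∀ᵐ x ∂(volume.restrict (Icc a b)), f x = (u x : ℂ) + v x * Complex.I) ∧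
      (∀ x, |u x| ≤ w1InfNorm a b f g) ∧ (∀ x y, |u x - u y| ≤ w1InfNorm a b f g * |x - y|) ∧
      (∀ x, |v x| ≤ w1InfNorm a b f g) ∧ ∀ x y, |v x - v y| ≤ w1InfNorm a b f g * |x - y| := by
  obtain ⟨S, hS, hL⟩ := exists_ae_lipschitz hf
  set M := w1InfNorm a b f g with hMdef
  have hA : (eLpNorm f ⊤ (volume.restrict (Icc a b))).toReal ≤ M :=
    le_add_of_nonneg_right ENNReal.toReal_nonneg
  have hB : (eLpNorm g ⊤ (volume.restrict (Icc a b))).toReal ≤ M :=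
    le_add_of_nonneg_left ENNReal.toReal_nonneg
  have hM : 0 ≤ M := ENNReal.toReal_nonneg.trans hA
  set T := S ∩ {x | ‖f x‖ ≤ M}
  have hT : ∀ᵐ x ∂(volume.restrict (Icc a b)), x ∈ T := by
    filter_upwards [hS, ae_norm_le_toReal_eLpNorm hf.memLp] with x h1 h2 using ⟨h1, h2.trans hA⟩
  have hTL : ∀ x ∈ T, ∀ y ∈ T, ‖f x - f y‖ ≤ M * |x - y| := fun x hx y hy =>
    (hL x hx.1 y hy.1).trans (by gcongr)
  obtain ⟨u, hu, hub, huL⟩ := exists_lipschitz_extension (S := T) (u := fun x => (f x).re) hM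
    (fun x hx => (Complex.abs_re_le_norm _).trans hx.2)
    (fun x hx y hy => by
      rw [← Complex.sub_re]
      exact (Complex.abs_re_le_norm _).trans (hTL x hx y hy))
  obtain ⟨v, hv, hvb, hvL⟩ := exists_lipschitz_extension (S := T) (u := fun x => (f x).im) hM
    (fun x hx => (Complex.abs_im_le_norm _).trans hx.2)
    (fun x hx y hy => by
      rw [← Complex.sub_im]
      exact (Complex.abs_im_le_norm _).trans (hTL x hx y hy))
  refine ⟨u, v, ?_, hub, huL, hvb, hvL⟩
  filter_upwards [hT] with x hx
  rw [← hu x hx, ← hv x hx]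
  exact (Complex.re_add_im (f x)).symm

end Mollify

/-- Linear statistics of functions with bounded weak derivative are controlled by the logarithmic
distance, for absolutely continuous measures. -/
theorem exists_norm_integral_sub_le (a b : ℝ) {c : ℝ} (hc : 0 < c) (R : ℝ) :
    ∃ C : ℝ, 0 < C ∧ ∀ (Λ : ℝ) (γ : ℝ → ℂ), IsRegularCurve a b c Λ R γ → ∀ α β : Measure ℝ,
      IsAdmissible a b γ α → IsAdmissible a b γ β → α ≪ volume → β ≪ volume →
      ∀ f g : ℝ → ℂ, IsW1Inf a b f g →
        ‖(∫ s in Icc a b, f s ∂α) - ∫ s in Icc a b, f s ∂β‖ ≤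
          C * w1InfNorm a b f g * √(quadDiff (curveLog γ) α β) := by
  obtain ⟨C, hC, H⟩ := exists_abs_integral_sub_le a b (R := R) hc
  -- The factor `2` comes from the real and imaginary parts, estimated separately.
  refine ⟨2 * C, by positivity, fun Λ γ hγ α β hα hβ hαv hβv f g hf => ?_⟩
  have := hα.prob
  have := hβ.prob
  have := hα.atomless
  have := hβ.atomless
  obtain ⟨u, v, he, hub, huL, hvb, hvL⟩ := exists_lipschitz_representative hf
  set M := w1InfNorm a b f g
  have hM : 0 ≤ M := (abs_nonneg _).trans (hub 0)
  have cont : ∀ {w : ℝ → ℝ}, (∀ x y, |w x - w y| ≤ M * |x - y|) → Continuous w := by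
    intro w hw
    refine (LipschitzWith.of_dist_le_mul (K := M.toNNReal) fun x y => ?_).continuous
    rw [Real.dist_eq, Real.dist_eq, Real.coe_toNNReal _ hM]
    exact hw x y
  have hI : ∀ ν : Measure ℝ, IsAdmissible a b γ ν → ν ≪ volume →
      ∫ s in Icc a b, f s ∂ν = ((∫ s, u s ∂ν : ℝ) : ℂ) + ((∫ s, v s ∂ν : ℝ) : ℂ) * Complex.I := by
    intro ν hν hνv
    have := hν.prob
    have hr : ν.restrict (Icc a b) = ν := Measure.restrict_eq_self_of_ae_mem hν.carried
    have h1 : ν.restrict (Icc a b) ≪ volume.restrict (Icc a b) := hνv.restrict _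
    -- Absolute continuity enters here: the Lipschitz representative equals `f` only Lebesgue almost
    -- everywhere.
    have h2 := h1.ae_le he
    rw [integral_congr_ae h2, hr, integral_add, integral_mul_const, integral_complex_ofReal,
      integral_complex_ofReal]
    · exact (integrable_of_continuous hν.carried (cont huL)).ofReal
    · exact (integrable_of_continuous hν.carried (cont hvL)).ofReal.mul_const _
  have h1 := H γ hγ.continuous.measurable hγ.bound hγ.lower α β hα.carried hβ.carried hα.integrable
    (hα.cross hγ hc hβ) hβ.integrable u M hM (fun x _ => hub x) (fun x _ y _ => huL x y)
  have h2 := H γ hγ.continuous.measurable hγ.bound hγ.lower α β hα.carried hβ.carried hα.integrable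
    (hα.cross hγ hc hβ) hβ.integrable v M hM (fun x _ => hvb x) (fun x _ y _ => hvL x y)
  rw [hI α hα hαv, hI β hβ hβv]
  have e : ((∫ s, u s ∂α : ℝ) : ℂ) + ((∫ s, v s ∂α : ℝ) : ℂ) * Complex.I -
      (((∫ s, u s ∂β : ℝ) : ℂ) + ((∫ s, v s ∂β : ℝ) : ℂ) * Complex.I) =
      (((∫ s, u s ∂α) - ∫ s, u s ∂β : ℝ) : ℂ) +
        (((∫ s, v s ∂α) - ∫ s, v s ∂β : ℝ) : ℂ) * Complex.I := by
    push_cast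
    ring
  rw [e]
  refine (norm_add_le _ _).trans ?_
  rw [norm_mul, Complex.norm_I, mul_one, Complex.norm_real, Complex.norm_real, Real.norm_eq_abs,
    Real.norm_eq_abs]
  linarith

end CurveGas
end

noncomputable section
namespace CurveGas
open Filter Topology Real

/-! ### Concentration -/

/-- A family of curves and potentials gives gases with uniform constants, whose minimisers are
absolutely continuous. -/
theorem exists_isGas {a b a' b' : ℝ} (ha : a' < a) (hab : a < b) (hb : b < b') {η : ℝ → ℝ → ℂ}
    (hη : IsCurveFamily a' b' η) {W : ℝ → ℂ → ℂ} (hW : IsPotentialFamily a b η W)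
    {μ : ℝ → Measure ℝ} (hμ : ∀ t ∈ Icc (0 : ℝ) 1, IsEquilibriumMeasure a b (η t) (W t) (μ t))
    (hsupp : ∃ O : Set ℝ, IsOpen O ∧ O ⊆ Icc a b ∧ ∀ t ∈ Icc (0 : ℝ) 1, (μ t).support ⊆ O) :
    ∃ c Λ R M : ℝ, 0 < c ∧ 0 ≤ Λ ∧ 0 ≤ M ∧ ∀ t ∈ Icc (0 : ℝ) 1, ∃ γ φ,
      IsGas a b a' b' c Λ R M γ φ (μ t) ∧ (∀ x ∈ Icc a' b', η t x = γ x) ∧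
      (∀ x ∈ Icc a b, field (η t) (W t) x = φ x) ∧
      (∀ x ∈ Icc a b, c ≤ ‖deriv (η t) x‖ ∧ ‖deriv (η t) x‖ ≤ c⁻¹) ∧ μ t ≪ volume := by
  have hab' : a' < b' := ha.trans (hab.trans hb)
  have hsub : Icc a b ⊆ Icc a' b' := Icc_subset_Icc ha.le hb.le
  obtain ⟨c, hc, hbil⟩ := hη.exists_bilipschitz
  obtain ⟨Λ, R, hΛ, hreg⟩ := hη.exists_isRegularCurve hab' hc hbil
  obtain ⟨M, hM, hlip⟩ := exists_field_lipschitz ha hab hb hη hW hbil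
  obtain ⟨O, hO, hOab, hOμ⟩ := hsupp
  refine ⟨c, Λ, R, M, hc, hΛ, hM, fun t ht => ?_⟩
  have hγ := hη.contDiffOn ht
  have hγ' := hγ.mono hsub
  have hcl : ∀ x ∈ Icc a' b', η t x = clamp a' b' hab'.le (η t) x := fun x hx =>
    (clamp_of_mem hab'.le _ hx).symm
  have hf := contDiffOn_field hγ' (hW.analytic t ht)
  have hφ : Continuous (clamp a b hab.le (field (η t) (W t))) :=
    continuous_clamp hab.le hf.continuousOn
  have hφe : ∀ x ∈ Icc a b, field (η t) (W t) x = clamp a b hab.le (field (η t) (W t)) x :=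
    fun x hx => (clamp_of_mem hab.le _ hx).symm
  have hreg' := (hreg t ht).mono ha.le hb.le
  obtain ⟨hadm, hmin⟩ := (hμ t ht).isAdmissible hreg' hc hab (fun x hx => hcl x (hsub hx)) hφ hφe
  -- `C₁`, `C₂` and `d` may depend on `t`: they serve only to prove absolute continuity, which is
  -- qualitative. The quantitative constants `c`, `Λ`, `R`, `M` were fixed before `t`.
  obtain ⟨C₁, h1, hC₁⟩ := exists_chordLog_second_difference hab
    (hγ'.congr fun x hx => (hcl x (hsub hx)).symm) hc
    fun x hx y hy => ⟨hreg'.lower x hx y hy, hreg'.upper x hx y hy⟩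
  obtain ⟨C₂, h2, hC₂⟩ := exists_field_second_difference hab
    (hf.congr fun x hx => (hφe x hx).symm)
  obtain ⟨d, hd, hs⟩ := exists_ae_mem_Icc_of_support_subset hO hOab (hOμ t ht)
  refine ⟨clamp a' b' hab'.le (η t), clamp a b hab.le (field (η t) (W t)),
    ⟨hreg t ht, hφ, fun x hx y hy => ?_, hadm, hmin⟩, hcl, hφe,
    fun x hx => norm_deriv_bounds hγ (hbil t ht) ⟨ha.trans_le hx.1, hx.2.trans_lt hb⟩,
    absolutelyContinuous_of_isMinimiser hab hreg' hc hΛ hφ hadm hmin h1 h2 hC₁ hC₂ hd hs⟩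
  rw [← hφe x hx, ← hφe y hy]
  exact hlip t ht x hx y hy

lemma ae_realModel_mem (β a b : ℝ) (γ : ℝ → ℂ) (w : ℂ → ℂ) (N : ℕ) :
    ∀ᵐ x ∂(realModel β a b γ w N), x ∈ configs a b N :=
  Measure.ae_smul_measure ((withDensity_absolutelyContinuous _ _).ae_le
    (ae_restrict_mem (measurableSet_configs a b N))) _

lemma exists_forall_inv_sq_le {m : ℝ} (hm : 0 < m) :
    ∃ N₀ : ℕ, 2 ≤ N₀ ∧ ∀ N : ℕ, N₀ ≤ N → ((N : ℝ) ^ 2)⁻¹ ≤ m := by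
  obtain ⟨n, hn⟩ := exists_nat_ge m⁻¹
  refine ⟨max n 2, le_max_right _ _, fun N hN => ?_⟩
  have h1 : (n : ℝ) ≤ N := by exact_mod_cast (le_max_left _ _).trans hN
  have h2 : (2 : ℝ) ≤ N := by exact_mod_cast (le_max_right _ _).trans hN
  rw [inv_le_comm₀ (by positivity) hm]
  nlinarith

end CurveGas
end

theorem mainTheorem10 (β : ℝ) (hβ : 0 < β)
    (a b a' b' : ℝ) (ha : a' < a) (hab : a < b) (hb : b < b')
    (η : ℝ → ℝ → ℂ) (hη : CurveGas.IsCurveFamily a' b' η)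
    (W : ℝ → ℂ → ℂ) (hW : CurveGas.IsPotentialFamily a b η W)
    (μ : ℝ → Measure ℝ)
    (hμ : ∀ t ∈ Icc (0 : ℝ) 1, CurveGas.IsEquilibriumMeasure a b (η t) (W t) (μ t))
    (hsupp : ∃ O : Set ℝ, IsOpen O ∧ O ⊆ Icc a b ∧ ∀ t ∈ Icc (0 : ℝ) 1, (μ t).support ⊆ O) :
    ∃ C : ℝ, 0 < C ∧ ∃ C' : ℝ, 0 < C' ∧ ∃ N₀ : ℕ, 2 ≤ N₀ ∧
      -- large deviations in logarithmic distance
      (∀ N : ℕ, 2 ≤ N → CurveGas.RegFits a b a' b' N →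
        ∀ t ∈ Icc (0 : ℝ) 1, ∀ δ : ℝ, 0 < δ →
          CurveGas.realModel β a b (η t) (W t) N
              {x | ENNReal.ofReal δ ≤
                CurveGas.logDist (η t) (CurveGas.regEmpirical x) (μ t)} ≤
            ENNReal.ofReal (Real.exp (-(β / 2 * (N : ℝ) ^ 2 * δ ^ 2) + C * N * Real.log N))) ∧
      -- the spread points and the regularised empirical measure stay in the larger interval
      (∀ N : ℕ, N₀ ≤ N → CurveGas.RegFits a b a' b' N ∧
        ∀ x ∈ CurveGas.configs a b N, ∀ k : Fin N,
          CurveGas.spreadSeq x k ∈ Icc a' b') ∧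
      -- Gaussian tails for linear statistics
      (∀ N : ℕ, N₀ ≤ N → ∀ t ∈ Icc (0 : ℝ) 1, ∀ f g : ℝ → ℂ, CurveGas.IsW1Inf a' b' f g →
        0 < CurveGas.w1InfNorm a' b' f g → ∀ δ : ℝ, 0 < δ →
          CurveGas.realModel β a b (η t) (W t) N
              {x | δ ≤ ‖(∫ s in Icc a' b', f s ∂(CurveGas.regEmpirical x)) -
                ∫ s in Icc a' b', f s ∂(μ t)‖} ≤
            ENNReal.ofReal (Real.exp
              (-(C' * (N : ℝ) ^ 2 * δ ^ 2 / CurveGas.w1InfNorm a' b' f g ^ 2) +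
                C * N * Real.log N))) ∧
      -- concentration at rate `√(ln N / N)`
      (∀ A : ℝ, 0 < A → ∃ K : ℝ, 0 < K ∧
        ∀ N : ℕ, N₀ ≤ N → ∀ t ∈ Icc (0 : ℝ) 1, ∀ f g : ℝ → ℂ, CurveGas.IsW1Inf a' b' f g →
          0 < CurveGas.w1InfNorm a' b' f g →
          CurveGas.realModel β a b (η t) (W t) N
              {x | K * CurveGas.w1InfNorm a' b' f g * Real.sqrt (Real.log N / N) ≤
                ‖(∫ s in Icc a' b', f s ∂(CurveGas.regEmpirical x)) -
                  ∫ s in Icc a' b', f s ∂(μ t)‖} ≤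
            ENNReal.ofReal (Real.exp (-(A * N * Real.log N)))) := by
  obtain ⟨c, Λ, R, M, hc, hΛ, hM, H⟩ := CurveGas.exists_isGas ha hab hb hη hW hμ hsupp
  obtain ⟨C, hC, hLD⟩ := CurveGas.exists_realModel_logDist_le hβ ha.le hab hb.le hc hΛ hM
  obtain ⟨D, hD, hlin⟩ := CurveGas.exists_norm_integral_sub_le a' b' hc R
  obtain ⟨N₀, hN₀, hsmall⟩ := CurveGas.exists_forall_inv_sq_le
    (lt_min (sub_pos.2 ha) (sub_pos.2 hb))
  have hC' : 0 < β / (2 * D ^ 2) := by positivity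
  have hfits : ∀ N : ℕ, N₀ ≤ N → CurveGas.RegFits a b a' b' N ∧
      ∀ x ∈ CurveGas.configs a b N, ∀ k : Fin N, CurveGas.spreadSeq x k ∈ Icc a' b' :=
    fun N hN => CurveGas.regFits_of_le (by omega) ((hsmall N hN).trans (min_le_left _ _))
      ((hsmall N hN).trans (min_le_right _ _))
  have part1 : ∀ N : ℕ, 2 ≤ N → CurveGas.RegFits a b a' b' N →
      ∀ t ∈ Icc (0 : ℝ) 1, ∀ δ : ℝ, 0 < δ →
        CurveGas.realModel β a b (η t) (W t) N
            {x | ENNReal.ofReal δ ≤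
              CurveGas.logDist (η t) (CurveGas.regEmpirical x) (μ t)} ≤
          ENNReal.ofReal (Real.exp
            (-(β / 2 * (N : ℝ) ^ 2 * δ ^ 2) + (C + 1) * N * Real.log N)) := by
    intro N hN hfit t ht δ hδ
    obtain ⟨γ, φ, hgas, hγ, hφ, hd, -⟩ := H t ht
    refine (hLD R γ φ (μ t) hgas (η t) (W t) hγ hφ hd N hN hfit δ hδ).trans
      (ENNReal.ofReal_le_ofReal (Real.exp_le_exp.2 ?_))
    have : 0 ≤ Real.log N := Real.log_natCast_nonneg N
    gcongr
    linarith
  have part3 : ∀ N : ℕ, N₀ ≤ N → ∀ t ∈ Icc (0 : ℝ) 1, ∀ f g : ℝ → ℂ,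
      CurveGas.IsW1Inf a' b' f g → 0 < CurveGas.w1InfNorm a' b' f g → ∀ δ : ℝ, 0 < δ →
        CurveGas.realModel β a b (η t) (W t) N
            {x | δ ≤ ‖(∫ s in Icc a' b', f s ∂(CurveGas.regEmpirical x)) -
              ∫ s in Icc a' b', f s ∂(μ t)‖} ≤
          ENNReal.ofReal (Real.exp
            (-(β / (2 * D ^ 2) * (N : ℝ) ^ 2 * δ ^ 2 / CurveGas.w1InfNorm a' b' f g ^ 2) +
              (C + 1) * N * Real.log N)) := by
    intro N hN t ht f g hf hn δ hδ
    have hN0 : 0 < N := by omega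
    obtain ⟨γ, φ, hgas, hγ, -, -, hac⟩ := H t ht
    have hfit := (hfits N hN).1
    -- A deviation `δ` of the linear statistic forces a logarithmic distance of at least `δ / (D
    -- ‖f‖)`, which gives the rate `β / (2 D²)`.
    have h1 := part1 N (by omega) hfit t ht (δ / (D * CurveGas.w1InfNorm a' b' f g)) (by positivity)
    refine le_trans (measure_mono_ae ?_) (h1.trans (le_of_eq ?_))
    · filter_upwards [CurveGas.ae_realModel_mem β a b (η t) (W t) N] with x hx hxδ
      have hfx : ∀ᵐ u ∂(CurveGas.regEmpirical x), u ∈ Icc a' b' := ae_iff.2 (hfit x hx)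
      have hL := CurveGas.isAdmissible_regEmpirical hgas.curve hc hN0 hfx
      have hμ' := hgas.adm.mono ha.le hb.le
      have hLac : CurveGas.regEmpirical x ≪ volume :=
        Measure.absolutelyContinuous_of_le_smul (CurveGas.regEmpirical_le hN0 x)
      have h2 := hlin Λ γ hgas.curve _ _ hL hμ' hLac hac f g hf
      have h3 : δ ≤ ‖(∫ s in Icc a' b', f s ∂(CurveGas.regEmpirical x)) -
        ∫ s in Icc a' b', f s ∂(μ t)‖ := hxδ
      show ENNReal.ofReal _ ≤ CurveGas.logDist (η t) (CurveGas.regEmpirical x) (μ t)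
      rw [CurveGas.logDist_eq hgas.curve hc hγ hL hμ']
      refine ENNReal.ofReal_le_ofReal ?_
      rw [div_le_iff₀' (by positivity)]
      exact h3.trans h2
    · congr 3
      field_simp
  refine ⟨C + 1, by linarith, β / (2 * D ^ 2), hC', N₀, hN₀, part1, hfits, part3, ?_⟩
  intro A hA
  -- With this `K` the Gaussian term equals `-(A + C + 1) N log N`, and the error `(C + 1) N log N`
  -- leaves exactly `-A N log N`.
  refine ⟨√((A + (C + 1)) / (β / (2 * D ^ 2))), Real.sqrt_pos.2 (by positivity), ?_⟩
  intro N hN t ht f g hf hn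
  have hN1 : (1 : ℝ) < N := by exact_mod_cast (by omega : 1 < N)
  have hlog : 0 < Real.log N := Real.log_pos hN1
  have hr : 0 < Real.sqrt (Real.log N / N) := Real.sqrt_pos.2 (by positivity)
  have hK : 0 < √((A + (C + 1)) / (β / (2 * D ^ 2))) := Real.sqrt_pos.2 (by positivity)
  refine (part3 N hN t ht f g hf hn _ (by positivity)).trans (le_of_eq ?_)
  congr 2
  rw [mul_pow, mul_pow, Real.sq_sqrt (by positivity), Real.sq_sqrt (by positivity)]
  field_simp
  ring
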